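/- Let $G=(V,E)$ be a finite simple undirected graph with $m=|E|$ edges. A path is a finite (possibly empty) sequence of edges in which any two consecutive edges have a common vertex; it is edge-simple if no edge occurs in it twice; its length is its number of edges. The longest trail problem (LTP) asks for an edge-simple path of maximal length. For $S\subseteq E$ and $v,u\in E$ let $F(S,v,u)$ be a longest edge-simple path that uses only edges of $S$, starts with the edge $v$ and ends with the edge $u$ (if there is one; otherwise its length is $-\infty$), and let $P^1\circ P^2$ denote the concatenation of a path ending with an edge $y$ and a path starting with $y$, in which $y$ is not duplicated. Consider the following algorithm, where $\alpha=0.055$ and $m/2$, $m/4$, $(1-\alpha)m/4$ are rounded up to integers. 1. (Classical preprocessing.) Compute by dynamic programming, in the order of increasing $|S|$, and store, the paths $F(S,v,u)$ for all $v,u\in S$ and all $S\subseteq E$ with $|S|\le K$, where $F(S,u,u)=(u)$, and for $v\ne u$ the path $F(S,v,u)$ is a longest one among the paths $F(S\setminus\{u\},v,y)$ followed by $u$, over all $y\in S\setminus\{u\}$ that have a common vertex with $u$. Here $K$ is the largest size of the sets into which the innermost maximum finding of step 2 splits its sets; $K=(1-\alpha)m/4$ (rounded up) for all large $m$. 2.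 (Quantum part.) For each pair $(v,u)\in E^2$ find $F(E,v,u)$ by three nested quantum maximum findings: a path $F(S,v,u)$ is obtained by maximizing the length of $$F(S',v,y)\circ F((S\setminus S')\cup\{y\},y,u)$$ over all $S'\subseteq S$ with $|S'|=k$ and all $y\in S'$, where $k=m/2$ in the outermost maximum finding (with $S=E$), $k=m/4$ in the middle one and $k=(1-\alpha)m/4$ in the innermost one. The two paths are provided by coherent invocations of the next inner maximum finding, and, in the innermost one, by queries to the table stored in step 1. Each maximum finding is the Dürr–Høyer algorithm: starting from a uniformly random threshold candidate, one repeatedly replaces the threshold by a candidate of larger value, found by Grover search with a random number of iterations from an exponentially growing range (at most $\lceil\sqrt N\rceil$, where $N$ bounds the number of candidates), and one stops after $O(\log^2 N)$ trials. Each maximum finding is boosted: it is repeated $10(m+1)=O(m)$ times and the best result is taken. 3. Output a longest path among those found for all pairs $(v,u)$ (the empty path if there is none). The running time is the number of elementary steps of the classical preprocessing plus the number of queries and other basic input-independent unitary transformations performed in the quantum part. **Theorem.** This algorithm solves LTP with running time $O^*(1.728^m)$ and constant bounded error: there are constants $K_0$ and $d$ such that, for every finite simple graph $G$ with $m\ge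 0$ edges, given with any enumeration of its edges, the running time is at most $K_0\,(m+1)^d\cdot 1.728^m$, and the output is a longest edge-simple path of $G$ with probability at least $4/5$. -/

import Mathlib

namespace LongestTrail

noncomputable section

/-! ## Edge-simple paths in a graph -/

/-- Two edges have a common vertex. -/
def ShareVertex {V : Type*} (a b : Sym2 V) : Prop := ∃ x, x ∈ a ∧ x ∈ b

/-- A path: a finite sequence of edges in which every two consecutive edges have a common vertex. -/
def IsPath {V : Type*} (G : SimpleGraph V) (P : List G.edgeSet) : Prop :=
  P.IsChain fun a b => ShareVertex (a : Sym2 V) (b : Sym2 V)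

/-- An edge-simple path: no edge occurs twice (vertices may be revisited). -/
def IsEdgeSimplePath {V : Type*} (G : SimpleGraph V) (P : List G.edgeSet) : Prop :=
  IsPath G P ∧ P.Nodup

/-- A solution of the longest trail problem: an edge-simple path with the largest possible
number of edges. -/
def IsLongestTrail {V : Type*} (G : SimpleGraph V) (P : List G.edgeSet) : Prop :=
  IsEdgeSimplePath G P ∧ ∀ Q : List G.edgeSet, IsEdgeSimplePath G Q → Q.length ≤ P.length

/-! ## Unitary circuits with a step count -/

/-- Pure states of a register whose computational basis is the finite set `X`. -/
abbrev QState (X : Type) [Fintype X] := EuclideanSpace ℂ X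

/-- A unitary operator on the register `X`. -/
abbrev QGate (X : Type) [Fintype X] := QState X ≃ₗᵢ[ℂ] QState X

/-- The basis state `|x⟩`. -/
def ket {X : Type} [Fintype X] (x : X) : QState X :=
  open scoped Classical in EuclideanSpace.single x (1 : ℂ)

/-- The equal superposition `|C|^(-1/2) ∑_{x ∈ C} |x⟩`. -/
def uniformKet {X : Type} [Fintype X] (C : Finset X) : QState X :=
  WithLp.toLp 2 fun x => open scoped Classical in
    if x ∈ C then ((1 / Real.sqrt (C.card : ℝ) : ℝ) : ℂ) else 0

/-- State preparation: the reflection in the hyperplane orthogonal to `|x₀⟩ - |C⟩`, where `|C⟩` is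
the equal superposition over the nonempty set `C`. It maps `|x₀⟩` to `|C⟩`. -/
def prepareGate {X : Type} [Fintype X] (x₀ : X) (C : Finset X) : QGate X :=
  (Submodule.span ℂ {ket x₀ - uniformKet C})ᗮ.reflection

/-- Grover's diffusion `2|C⟩⟨C| - 1`. -/
def diffusionGate {X : Type} [Fintype X] (C : Finset X) : QGate X :=
  (Submodule.span ℂ {uniformKet C}).reflection

/-- The phase flip `|x⟩ ↦ -|x⟩` on the basis states with `p x`. -/
def phaseGate {X : Type} [Fintype X] (p : X → Prop) : QGate X :=
  LinearIsometryEquiv.piLpCongrRight 2 fun x =>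
    open scoped Classical in
    if p x then LinearIsometryEquiv.neg ℂ else LinearIsometryEquiv.refl ℂ ℂ

/-- The operator `|x⟩ ↦ |σ x⟩`. -/
def permGate {X Y : Type} [Fintype X] [Fintype Y] (σ : X ≃ Y) : QState X ≃ₗᵢ[ℂ] QState Y :=
  LinearIsometryEquiv.piLpCongrLeft 2 ℂ ℂ σ

/-- The controlled operator `∑_c |c⟩⟨c| ⊗ U c`. -/
def controlledGate {C X : Type} [Fintype C] [Fintype X] (U : C → QGate X) : QGate (C × X) :=
  (((permGate (Equiv.sigmaEquivProd C X).symm).trans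
    (LinearIsometryEquiv.piLpCurry ℂ 2 fun (_ : C) (_ : X) => ℂ)).trans
    (LinearIsometryEquiv.piLpCongrRight 2 U)).trans
    (((permGate (Equiv.sigmaEquivProd C X).symm).trans
      (LinearIsometryEquiv.piLpCurry ℂ 2 fun (_ : C) (_ : X) => ℂ)).symm)

/-- A circuit: the unitary it performs together with the number of its elementary steps. An
elementary step is an oracle query or one of the basic transformations below. -/
structure Circuit (X : Type) [Fintype X] where
  op : QGate X
  cost : ℕ

namespace Circuit

variable {X Y C : Type} [Fintype X] [Fintype Y] [Fintype C]

/-- The empty circuit. -/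
def idle : Circuit X := ⟨LinearIsometryEquiv.refl ℂ _, 0⟩

/-- A single elementary step. -/
def step (U : QGate X) : Circuit X := ⟨U, 1⟩

/-- First `a`, then `b`. -/
def comp (a b : Circuit X) : Circuit X := ⟨a.op.trans b.op, a.cost + b.cost⟩

/-- The inverse circuit. -/
def adjoint (a : Circuit X) : Circuit X := ⟨a.op.symm, a.cost⟩

/-- `n` successive copies of `a`. -/
def pow (a : Circuit X) : ℕ → Circuit X
  | 0 => idle
  | n + 1 => comp (pow a n) a

/-- The circuit `a c` is applied to the second register, coherently controlled by the content `c`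
of the first one. All branches run in lockstep, so that the cost is that of the longest one. -/
def select (a : C → Circuit X) : Circuit (C × X) :=
  ⟨controlledGate fun c => (a c).op, Finset.univ.sup fun c => (a c).cost⟩

/-- Apply `a` to the second register. -/
def onSnd (a : Circuit Y) : Circuit (X × Y) := select fun _ => a

/-- Apply `a` to the first register. -/
def onFst (a : Circuit X) : Circuit (X × Y) :=
  ⟨((permGate (Equiv.prodComm X Y)).trans (onSnd (X := Y) a).op).trans
    (permGate (Equiv.prodComm Y X)), (onSnd (X := Y) a).cost⟩

end Circuit

/-! ## Quantum subroutines -/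

/-- A quantum subroutine with (classical, but possibly superposed) input in `I` and output in `A`.
On the input `i` the circuit `circ i` acts on a workspace `W` that starts in the basis state
`|w0⟩`; the output is read off the final basis state `w` of the workspace as `out i w`. -/
structure Subroutine (I A : Type) where
  W : Type
  [fintypeW : Fintype W]
  w0 : W
  circ : I → Circuit W
  out : I → W → A

attribute [instance] Subroutine.fintypeW

namespace Subroutine

variable {I J A B S X : Type}

/-- The final state of the workspace on the input `i`. -/
def finalState (p : Subroutine I A) (i : I) : QState p.W := (p.circ i).op (ket p.w0)

theorem sum_finalState (p : Subroutine I A) (i : I) :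
    ∑ w, ENNReal.ofReal (‖p.finalState i w‖ ^ 2) = 1 := by
  classical
  rw [← ENNReal.ofReal_sum_of_nonneg (fun _ _ => by positivity), ← EuclideanSpace.norm_sq_eq,
    finalState, LinearIsometryEquiv.norm_map]
  simp [ket]

/-- The distribution of the output when the workspace is measured at the end (Born's rule). -/
def dist (p : Subroutine I A) (i : I) : PMF A :=
  (PMF.ofFintype (fun w => ENNReal.ofReal (‖p.finalState i w‖ ^ 2)) (p.sum_finalState i)).map
    (p.out i)

/-- A deterministic classical computation step. -/
def ret (f : I → A) : Subroutine I A where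
  W := Unit
  w0 := ()
  circ _ := Circuit.step (LinearIsometryEquiv.refl ℂ _)
  out i _ := f i

/-- Precompose with a classical function of the input. -/
def comap (p : Subroutine I A) (g : J → I) : Subroutine J A where
  W := p.W
  w0 := p.w0
  circ j := p.circ (g j)
  out j := p.out (g j)

/-- Run `p`, then run `q` on the input together with the outcome of `p`. The measurement of the
workspace of `p` is deferred: that workspace serves only as a control from then on, and `q` has a
fresh workspace. -/
def bind (p : Subroutine I A) (q : Subroutine (I × A) B) : Subroutine I B where
  W := p.W × q.W
  w0 := (p.w0, q.w0)
  circ i := ((p.circ i).onFst).comp (Circuit.select fun w => q.circ (i, p.out i w))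
  out i w := q.out (i, p.out i w.1) w.2

/-- Repeat `n` times a subroutine that updates a classical state. -/
def iterate (p : Subroutine (I × S) S) : ℕ → Subroutine (I × S) S
  | 0 => ret Prod.snd
  | n + 1 => (iterate p n).bind (p.comap fun t => (t.1.1, t.2))

/-- A uniformly random element of the finite set `C i`; the register starts in `|x₀⟩`. -/
def sample [Fintype X] (x₀ : X) (C : I → Finset X) : Subroutine I X where
  W := X
  w0 := x₀
  circ i := Circuit.step (prepareGate x₀ (C i))
  out _ x := x

/-- A query `|i⟩|z⟩ ↦ |i⟩|z + T i⟩` to the stored data `T`, where the elements of the finite set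
`A` are encoded by the integers modulo its cardinality. -/
def lookup [Fintype A] [Nonempty A] (T : I → A) : Subroutine I A :=
  haveI : NeZero (Fintype.card A) := ⟨Fintype.card_ne_zero⟩
  { W := Fin (Fintype.card A)
    w0 := 0
    circ := fun i => Circuit.step (permGate (Equiv.addRight (Fintype.equivFin A (T i))))
    out := fun _ z => (Fintype.equivFin A).symm z }

/-! ## Grover search and Dürr–Høyer maximum finding

The function to be maximised over the finite set `C j ⊆ X` of candidates, on the input `j : J`, is
`x ↦ val a`, where `a` is the output of the subroutine `f` on the input `(j, x)`. The subroutine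
`f` may itself be a quantum algorithm. `N` is an upper bound on the number of candidates, and `x₀` is
the blank symbol of the registers that hold candidates. -/

variable [Fintype X]

/-- On the registers `|x⟩|w₁⟩|w₂⟩`: compute `f` at `x` and at the threshold `thr` in the two
workspaces, flip the phase if the value at `x` is larger than the one at `thr`, uncompute. -/
def mark (val : A → WithBot ℕ) (f : Subroutine (J × X) A) (j : J) (thr : X) :
    Circuit (X × (f.W × f.W)) :=
  let compute : Circuit (X × (f.W × f.W)) :=
    Circuit.select fun x => ((f.circ (j, x)).onFst).comp ((f.circ (j, thr)).onSnd)
  (compute.comp (Circuit.step (phaseGate fun s =>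
    val (f.out (j, thr) s.2.2) < val (f.out (j, s.1) s.2.1)))).comp compute.adjoint

/-- On the input `(j, (thr, k))`: `k` iterations of Grover's algorithm, started in the equal
superposition of the candidates, for a candidate whose value is larger than that of `thr`. -/
def grover (x₀ : X) (C : J → Finset X) (val : A → WithBot ℕ) (f : Subroutine (J × X) A) :
    Subroutine (J × (X × ℕ)) X where
  W := X × (f.W × f.W)
  w0 := (x₀, (f.w0, f.w0))
  circ t := (Circuit.step (prepareGate x₀ (C t.1))).onFst.comp
    (((mark val f t.1 t.2.1).comp (Circuit.step (diffusionGate (C t.1))).onFst).pow t.2.2)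
  out _ s := s.1

/-- `⌈√N⌉` -/
def sqrtCeil (N : ℕ) : ℕ := ⌈Real.sqrt N⌉₊

/-- The number `min(⌈(6/5)^e⌉, ⌈√N⌉)` of admissible iteration counts of the exponential search after
`e` unsuccessful trials. -/
def searchRange (N e : ℕ) : ℕ := min ⌈((6 : ℝ) / 5) ^ e⌉₊ (sqrtCeil N)

/-- One trial of the exponential search inside Dürr–Høyer maximum finding. The state consists of
the current threshold and the number `e` of unsuccessful trials since the threshold was last
changed. A number `k` of Grover iterations is drawn uniformly from `{0, …, searchRange N e - 1}`, a
candidate is found by `k` Grover iterations and measured, and it becomes the new threshold (and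
`e` is reset to `0`) if its value is larger than that of the present threshold. -/
def trial (N : ℕ) (x₀ : X) (C : J → Finset X) (val : A → WithBot ℕ) (f : Subroutine (J × X) A) :
    Subroutine (J × (X × ℕ)) (X × ℕ) :=
  -- `t = (j, (thr, e))`
  (sample (0 : Fin (sqrtCeil N + 1)) (fun t : J × (X × ℕ) =>
    Finset.univ.filter fun k => (k : ℕ) < searchRange N t.2.2)).bind
  -- `t = ((j, (thr, e)), k)`
  (((grover x₀ C val f).comap fun t : (J × (X × ℕ)) × Fin (sqrtCeil N + 1) =>
    (t.1.1, (t.1.2.1, (t.2 : ℕ)))).bind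
  -- `t = (((j, (thr, e)), k), x)`; evaluate the new candidate `x`
  ((f.comap fun t : ((J × (X × ℕ)) × Fin (sqrtCeil N + 1)) × X => (t.1.1.1, t.2)).bind
  -- evaluate the threshold
  ((f.comap fun t : (((J × (X × ℕ)) × Fin (sqrtCeil N + 1)) × X) × A =>
    (t.1.1.1.1, t.1.1.1.2.1)).bind
  -- compare
  (ret fun t : ((((J × (X × ℕ)) × Fin (sqrtCeil N + 1)) × X) × A) × A =>
    if val t.2 < val t.1.2 then (t.1.1.2, 0)
    else (t.1.1.1.1.2.1, t.1.1.1.1.2.2 + 1)))))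

/-- The number of trials after which Dürr–Høyer maximum finding is interrupted. -/
def numTrials (N : ℕ) : ℕ := 16 * (Nat.clog 2 N + 3) ^ 2

/-- Dürr–Høyer maximum finding: start with a uniformly random threshold, replace it again and again by
a candidate with a larger value that is found by exponential search, return the last threshold. -/
def durrHoyer (N : ℕ) (x₀ : X) (C : J → Finset X) (val : A → WithBot ℕ)
    (f : Subroutine (J × X) A) : Subroutine J X :=
  ((sample x₀ C).bind
    (((trial N x₀ C val f).iterate (numTrials N)).comap fun t => (t.1, (t.2, 0)))).bind
  (ret fun t => t.2.1)

/-- Boosted maximum finding: run Dürr–Høyer maximum finding `r` times, evaluate `f` at each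
returned candidate, and return the best result (`a₀` is the initial, worst one). -/
def qmax (r N : ℕ) (x₀ : X) (a₀ : A) (C : J → Finset X) (val : A → WithBot ℕ)
    (f : Subroutine (J × X) A) : Subroutine J A :=
  let run : Subroutine (J × A) A :=
    ((durrHoyer N x₀ C val f).comap fun t : J × A => t.1).bind
    ((f.comap fun t : (J × A) × X => (t.1.1, t.2)).bind
    (ret fun t : ((J × A) × X) × A => if val t.1.1.2 < val t.2 then t.2 else t.1.1.2))
  (run.iterate r).comap fun j => (j, a₀)

end Subroutine

/-! ## The algorithm for the longest trail problem

The edges are numbered by `Fin m`. The only access to the graph is through the relation `adj` on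
`Fin m`, "the edges have a common vertex". -/

/-- A value of `F(S, v, u)`: a duplicate-free sequence of edges, or `none` if there is no path. -/
abbrev Entry (m : ℕ) := Option {l : List (Fin m) // l.Nodup}

/-- The length of a path; `⊥` (minus infinity) if there is none. -/
def Entry.len {m : ℕ} : Entry m → WithBot ℕ
  | none => ⊥
  | some l => (l.1.length : ℕ)

def Entry.ofList {m : ℕ} (l : List (Fin m)) : Entry m :=
  if h : l.Nodup then some ⟨l, h⟩ else none

/-- Append the edge `u`. -/
def Entry.snoc {m : ℕ} : Entry m → Fin m → Entry m
  | none, _ => none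
  | some l, u => Entry.ofList (l.1 ++ [u])

/-- The concatenation `P¹ ∘ P²`, without duplication of the common edge at which `P¹` ends and `P²`
starts. -/
def Entry.join {m : ℕ} : Entry m → Entry m → Entry m
  | some l, some l' => Entry.ofList (l.1 ++ l'.1.tail)
  | _, _ => none

/-- The table of the values `F(S, v, u)`. -/
abbrev Table (m : ℕ) := Finset (Fin m) → Fin m → Fin m → Entry m

section Algorithm

variable {m : ℕ} (adj : Fin m → Fin m → Prop)

open scoped Classical in
/-- The entry `F(S, v, u)`, computed from the entries `F(S \ {u}, v, y)` for the edges
`y ∈ S \ {u}` adjacent to `u`, and the number of elementary steps (one for each `y` tried, and one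
for the initialisation). -/
def getLen (T : Table m) (S : Finset (Fin m)) (v u : Fin m) : Entry m × ℕ :=
  if v = u then (Entry.ofList [v], 1)
  else
    (List.finRange m).foldl (fun st y =>
      let new := (T (S.erase u) v y).snoc u
      (if y ∈ S.erase u ∧ adj y u ∧ st.1.len < new.len then new else st.1, st.2 + 1)) (none, 1)

open scoped Classical in
/-- Process the entry `(S, v, u)` of the table; the state is the table and the number of steps made
so far. -/
def fillEntry (st : Table m × ℕ) (k : Finset (Fin m) × Fin m × Fin m) : Table m × ℕ :=
  if k.2.1 ∈ k.1 ∧ k.2.2 ∈ k.1 then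
    let r := getLen adj st.1 k.1 k.2.1 k.2.2
    (fun S v u => if (S, v, u) = k then r.1 else st.1 S v u, st.2 + r.2 + 1)
  else (st.1, st.2 + 1)

/-- All triples `(S, v, u)` with `|S| ≤ K`, in the order of increasing `|S|`. -/
def keys (m K : ℕ) : List (Finset (Fin m) × Fin m × Fin m) :=
  (List.range (K + 1)).flatMap fun s =>
    (Finset.powersetCard s (Finset.univ : Finset (Fin m))).toList.flatMap fun S =>
      (List.finRange m).flatMap fun v => (List.finRange m).map fun u => (S, v, u)

/-- The classical precomputation by dynamic programming: the table of `F(S, v, u)` for `|S| ≤ K`,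
and the number of steps. -/
def stepOne (K : ℕ) : Table m × ℕ :=
  (keys m K).foldl (fillEntry adj) (fun _ _ _ => none, 0)

end Algorithm

/-! The sizes, with rounding: `m/2`, `m/4`, `(1 - α) m/4`, for `α = 0.055`. -/

def alpha : ℚ := 55 / 1000

def size₂ (m : ℕ) : ℕ := ⌈(m : ℚ) / 2⌉₊

def size₄ (m : ℕ) : ℕ := ⌈(m : ℚ) / 4⌉₊

def sizeα (m : ℕ) : ℕ := ⌈(1 - alpha) * (m : ℚ) / 4⌉₊

/-- The largest size of the pieces `S'`, `(S \ S') ∪ {y}` of a set `S` of at most `s` elements when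
`|S'| = k` and `y ∈ S'`. -/
def pieceSize (s k : ℕ) : ℕ := max k (s - k + 1)

/-- The largest size of the sets for which the table is precomputed: those into which the innermost
maximum finding splits its sets. For all large `m` this is `sizeα m`. -/
def tableSize (m : ℕ) : ℕ :=
  pieceSize (pieceSize (pieceSize m (size₂ m)) (size₄ m)) (sizeα m)

/-- The candidates `(S', y)` with `S' ⊆ S`, `|S'| = k`, `y ∈ S'`. -/
def splits {m : ℕ} (k : ℕ) (S : Finset (Fin m)) : Finset (Finset (Fin m) × Fin m) :=
  Finset.univ.filter fun c => c.1 ⊆ S ∧ c.1.card = k ∧ c.2 ∈ c.1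

/-- The number of repetitions of each maximum finding. -/
def repetitions (m : ℕ) : ℕ := 10 * (m + 1)

/-- A subroutine that is given `(S, v, u)` and returns a value of `F(S, v, u)`. -/
abbrev PathFinder (m : ℕ) := Subroutine (Finset (Fin m) × Fin m × Fin m) (Entry m)

/-- One level of the recursion, for sets `S` of at most `s` elements: the maximum, over
`S' ⊆ S` with `|S'| = k` and `y ∈ S'`, of the length of the concatenation of `F(S', v, y)` and
`F((S \ S') ∪ {y}, y, u)`, where both paths are provided by `sub`. -/
def level {m : ℕ} (s k : ℕ) (e₀ : Fin m) (sub : PathFinder m) : PathFinder m :=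
  -- `t = ((S, v, u), (S', y))`
  Subroutine.qmax (repetitions m) (s.choose k * k) (∅, e₀) none (fun t => splits k t.1) Entry.len
    ((sub.comap fun t : (Finset (Fin m) × Fin m × Fin m) × (Finset (Fin m) × Fin m) =>
      (t.2.1, t.1.2.1, t.2.2)).bind
    ((sub.comap fun t : ((Finset (Fin m) × Fin m × Fin m) × (Finset (Fin m) × Fin m)) × Entry m =>
      (insert t.1.2.2 (t.1.1.1 \ t.1.2.1), t.1.2.2, t.1.1.2.2)).bind
    (Subroutine.ret fun t => t.1.2.join t.2)))

/-- The three nested maximum findings; the innermost one queries the table `T`. -/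
def finder {m : ℕ} (T : Table m) (e₀ : Fin m) : PathFinder m :=
  level m (size₂ m) e₀
    (level (pieceSize m (size₂ m)) (size₄ m) e₀
      (level (pieceSize (pieceSize m (size₂ m)) (size₄ m)) (sizeα m) e₀
        (Subroutine.lookup fun k => T k.1 k.2.1 k.2.2)))

/-- All pairs `(v, u)` of edges. -/
def edgePairs (m : ℕ) : List (Fin m × Fin m) := (List.finRange m).product (List.finRange m)

/-- The output distribution of the algorithm: after the precomputation, for all edges `v` and `u`
a path from `v` to `u` is searched for among all the edges, and the longest path that has been found
is returned (the empty path if there is none). -/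
def ltpOutput {m : ℕ} (adj : Fin m → Fin m → Prop) : PMF (List (Fin m)) :=
  let T := (stepOne adj (tableSize m)).1
  ((edgePairs m).foldl (fun (acc : PMF (Entry m)) p =>
      acc.bind fun best =>
        ((finder T p.1).dist (Finset.univ, p.1, p.2)).map fun r =>
          if best.len < r.len then r else best)
    (PMF.pure none)).map fun best => (best.map Subtype.val).getD []

/-- The running time of the algorithm: the number of steps of the classical precomputation plus the
number of queries and other elementary steps of all the quantum searches. -/
def ltpTime {m : ℕ} (adj : Fin m → Fin m → Prop) : ℕ :=
  let P := stepOne adj (tableSize m)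
  P.2 + ((edgePairs m).map fun p =>
    ((finder P.1 p.1).circ (Finset.univ, p.1, p.2)).cost + 1).sum

/-- The input of the algorithm for a graph whose edges are enumerated by `e`. -/
def edgeAdj {V : Type*} (G : SimpleGraph V) {m : ℕ} (e : Fin m ≃ G.edgeSet) (i j : Fin m) : Prop :=
  ShareVertex (e i : Sym2 V) (e j : Sym2 V)

end

end LongestTrail

namespace LongestTrail

noncomputable section

/-! ### Action of the basic gates -/

section Gates

variable {X Y C : Type} [Fintype X] [Fintype Y] [Fintype C]

/-! Correctness of the recursion is combinatorial. A trail inside `S`, cut after its `k`-th edge `y`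
(or after its last edge, if it is shorter), has its first part in some `k`-element `S' ⊆ S` and the
rest, preceded by `y`, in `(S \ S') ∪ {y}`. Conversely, trails in two such sets overlap only in `y`
and can be joined. Hence a best value for `S` is a maximum over the pairs `(S', y)`
(`IsTrail.split`, `IsTrail.join`, `isBest_of_max`). At the bottom the table is correct by dynamic
programming (`isBest_stepOne`).

The analytic difficulty is that each maximised function is itself the output of a quantum procedure
that may fail. Let `ε` bound the failure probability at each candidate. Comparing two values
coherently and uncomputing differs from the perfect phase oracle by at most `√(8ε)` in norm
(`mark_error`), so `k` Grover iterations drift by at most `k√(8ε)` (`groverStep_pow_error`). The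
ideal iteration is an explicit rotation (`idealGrover_apply`), and a random number of iterations
from a large enough range succeeds with probability at least `1/4` (`quarter_le_sum_sin_sq`).

Dürr–Høyer is controlled by a potential: the number of better candidates, which a success halves on
average, times a factor that shrinks while the search range grows. One trial multiplies it by at
most `1 - 1/(6(L+3))`, with `L = ⌈log₂ N⌉`, up to an additive error (`expect_trial_potential_le`).
Thus `O(L²)` trials leave failure probability `2⁻¹⁰` plus oracle errors, and `10(m+1)` repetitions
turn `2⁻¹⁰` into `2^(-100(m+1))` (`failure_qmax_le`). Each level takes a square root of the error
below and loses an exponential factor. With `y = 2^(-(m+1))` the errors of the three levels are at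
most `y^99`, `y^37`, `y^6` (`failure_finder_le`), and a union bound over the `m²` pairs suffices.

For the running time, a level multiplies the cost by a polynomial times `√N`. The product of the
three `N` is, up to polynomial factors, at most `2^m · 2^(m/2) · C(m/4, αm/4)`. The table costs
`∑_{s ≤ K} C(m, s)` with `K ≈ (1-α)m/4`. Generating-function bounds reduce both estimates to
numerical inequalities (`base_quantum`, `base_classical`) that `α = 0.055` nearly balances. -/

theorem ket_apply [DecidableEq X] (x y : X) : ket x y = if y = x then 1 else 0 := by
  classical
  simp [ket]

theorem norm_ket (x : X) : ‖ket x‖ = 1 := by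
  classical
  simp [ket]

theorem uniformKet_apply [DecidableEq X] (S : Finset X) (x : X) :
    uniformKet S x = if x ∈ S then ((1 / Real.sqrt (S.card : ℝ) : ℝ) : ℂ) else 0 := by
  simp [uniformKet]

theorem norm_uniformKet {S : Finset X} (hS : S.Nonempty) : ‖uniformKet S‖ = 1 := by
  classical
  have h : ‖uniformKet S‖ ^ 2 = 1 := by
    rw [EuclideanSpace.norm_sq_eq]
    have hc : (0 : ℝ) < S.card := by exact_mod_cast hS.card_pos
    have : ∀ x, ‖uniformKet S x‖ ^ 2 = if x ∈ S then 1 / (S.card : ℝ) else 0 := by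
      intro x
      rw [uniformKet_apply]
      split_ifs
      · rw [Complex.norm_real, Real.norm_eq_abs, sq_abs, div_pow, Real.sq_sqrt hc.le]; simp
      · simp
    simp_rw [this, Finset.sum_ite_mem, Finset.univ_inter, Finset.sum_const, nsmul_eq_mul]
    field_simp
  have h0 := norm_nonneg (uniformKet S)
  nlinarith

theorem permGate_apply (σ : X ≃ Y) (ψ : QState X) (y : Y) :
    permGate σ ψ y = ψ (σ.symm y) := by
  simp [permGate, LinearIsometryEquiv.piLpCongrLeft_apply, Equiv.piCongrLeft']

theorem phaseGate_apply (p : X → Prop) [DecidablePred p] (ψ : QState X) (x : X) :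
    phaseGate p ψ x = if p x then -ψ x else ψ x := by
  simp only [phaseGate, LinearIsometryEquiv.piLpCongrRight_apply]
  split_ifs <;> simp

theorem controlledGate_apply (U : C → QGate X) (ψ : QState (C × X)) (c : C) (x : X) :
    controlledGate U ψ (c, x) = U c (WithLp.toLp 2 fun x => ψ (c, x)) x := by
  rfl

theorem diffusionGate_apply {S : Finset X} (hS : S.Nonempty) (ψ : QState X) :
    diffusionGate S ψ = (2 * inner ℂ (uniformKet S) ψ) • uniformKet S - ψ := by
  rw [diffusionGate, Submodule.reflection_apply, Submodule.starProjection_singleton,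
    norm_uniformKet hS]
  simp [two_mul, add_smul, two_smul]

/-- All amplitudes are real, so the inner product is symmetric. A reflection can exchange two unit
vectors only if their inner product is real. -/
theorem inner_ket_uniformKet_im (S : Finset X) (x : X) :
    inner ℂ (uniformKet S) (ket x) = inner ℂ (ket x) (uniformKet S) := by
  classical
  simp only [PiLp.inner_apply, ket_apply, uniformKet_apply]
  refine Finset.sum_congr rfl fun y _ => ?_
  split_ifs <;> simp

theorem prepareGate_ket {S : Finset X} (hS : S.Nonempty) (x₀ : X) :
    prepareGate x₀ S (ket x₀) = uniformKet S := by
  set v := ket x₀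
  set w := uniformKet S
  have hv : inner ℂ v v = (1 : ℂ) := by
    rw [inner_self_eq_norm_sq_to_K, norm_ket]; simp
  have hw : inner ℂ w w = (1 : ℂ) := by
    rw [inner_self_eq_norm_sq_to_K, norm_uniformKet hS]; simp
  have hvw : inner ℂ w v = inner ℂ v w := inner_ket_uniformKet_im S x₀
  rw [prepareGate, Submodule.reflection_orthogonal_apply, Submodule.reflection_apply,
    Submodule.starProjection_singleton]
  -- For unit vectors with real inner product, the projection of `v` to the line of `v - w` is
  -- exactly `(v - w)/2`, so reflecting subtracts `v - w` from `v`.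
  have hn : ((‖v - w‖ ^ 2 : ℝ) : ℂ) = 2 * inner ℂ (v - w) v := by
    have := inner_self_eq_norm_sq_to_K (𝕜 := ℂ) (v - w)
    have h2 : ((‖v - w‖ ^ 2 : ℝ) : ℂ) = inner ℂ (v - w) (v - w) := by
      rw [this]; push_cast; rfl
    rw [h2, inner_sub_left, inner_sub_right, inner_sub_right, inner_sub_left, hv, hw, hvw]
    ring
  by_cases h0 : v - w = 0
  · have h1 : v = w := sub_eq_zero.mp h0
    have h2 : ket x₀ - uniformKet S = 0 := h0
    simp [h1, h2]
  · have hne : ((‖v - w‖ ^ 2 : ℝ) : ℂ) ≠ 0 := by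
      simpa using h0
    have h3 : inner ℂ (v - w) v / ((‖v - w‖ ^ 2 : ℝ) : ℂ) = 1 / 2 := by
      rw [div_eq_div_iff hne two_ne_zero, hn]; ring
    erw [h3]
    module

end Gates

/-! ### Product states -/

section Tensor

variable {X Y C : Type} [Fintype X] [Fintype Y] [Fintype C]

/-- The product state of two registers. -/
def tens (φ : QState X) (χ : QState Y) : QState (X × Y) :=
  WithLp.toLp 2 fun p => φ p.1 * χ p.2

@[simp] theorem tens_apply (φ : QState X) (χ : QState Y) (p : X × Y) :
    tens φ χ p = φ p.1 * χ p.2 := rfl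

theorem ket_prod (x : X) (y : Y) : ket (x, y) = tens (ket x) (ket y) := by
  classical
  ext p
  obtain ⟨a, b⟩ := p
  simp only [ket_apply, tens_apply, Prod.mk.injEq]
  by_cases h1 : a = x <;> by_cases h2 : b = y <;> simp [h1, h2]

theorem norm_tens (φ : QState X) (χ : QState Y) : ‖tens φ χ‖ = ‖φ‖ * ‖χ‖ := by
  have h : ‖tens φ χ‖ ^ 2 = (‖φ‖ * ‖χ‖) ^ 2 := by
    rw [mul_pow, EuclideanSpace.norm_sq_eq, EuclideanSpace.norm_sq_eq, EuclideanSpace.norm_sq_eq,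
      Fintype.sum_prod_type, Finset.sum_mul_sum]
    simp [mul_pow]
  exact (pow_left_inj₀ (norm_nonneg _) (by positivity) two_ne_zero).mp h

namespace Circuit

theorem select_op_apply (a : C → Circuit X) (ψ : QState (C × X)) (p : C × X) :
    (select a).op ψ p = (a p.1).op (WithLp.toLp 2 fun x => ψ (p.1, x)) p.2 :=
  controlledGate_apply (fun c => (a c).op) ψ p.1 p.2

theorem select_op_tens (a : C → Circuit X) (φ : QState C) (χ : QState X) (p : C × X) :
    (select a).op (tens φ χ) p = φ p.1 * (a p.1).op χ p.2 := by
  rw [select_op_apply]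
  have : (WithLp.toLp 2 fun x => tens φ χ (p.1, x) : QState X) = φ p.1 • χ := by
    ext x; simp
  rw [this, map_smul]
  simp

theorem onSnd_op_tens (a : Circuit Y) (φ : QState X) (χ : QState Y) :
    (onSnd a).op (tens φ χ) = tens φ (a.op χ) := by
  ext p
  rw [onSnd, select_op_tens, tens_apply]

theorem onFst_op_tens (a : Circuit X) (φ : QState X) (χ : QState Y) :
    (onFst a).op (tens φ χ) = tens (a.op φ) χ := by
  ext p
  have h1 : permGate (Equiv.prodComm X Y) (tens φ χ) = tens χ φ := by
    ext q; rw [permGate_apply]; simp [mul_comm]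
  simp only [onFst, LinearIsometryEquiv.coe_trans, Function.comp_apply]
  rw [permGate_apply, h1, onSnd_op_tens]
  simp [mul_comm]

@[simp] theorem comp_op_apply (a b : Circuit X) (ψ : QState X) :
    (comp a b).op ψ = b.op (a.op ψ) := rfl

@[simp] theorem step_op (U : QGate X) : (step U).op = U := rfl

theorem adjoint_op_op (a : Circuit X) (ψ : QState X) : a.adjoint.op (a.op ψ) = ψ := by
  simp [adjoint]

end Circuit

end Tensor

/-! ### Expected values of functions of the output -/

namespace Subroutine

variable {I J A B S X : Type}

/-- The expected value of `g` at the measured output. -/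
def expect (p : Subroutine I A) (i : I) (g : A → ℝ) : ℝ :=
  ∑ w, ‖p.finalState i w‖ ^ 2 * g (p.out i w)

theorem sum_norm_finalState (p : Subroutine I A) (i : I) : ∑ w, ‖p.finalState i w‖ ^ 2 = 1 := by
  rw [← EuclideanSpace.norm_sq_eq, finalState, LinearIsometryEquiv.norm_map, norm_ket]; simp

theorem expect_const (p : Subroutine I A) (i : I) (c : ℝ) : p.expect i (fun _ => c) = c := by
  rw [expect, ← Finset.sum_mul, sum_norm_finalState, one_mul]

theorem expect_mono (p : Subroutine I A) (i : I) {g h : A → ℝ} (H : ∀ a, g a ≤ h a) :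
    p.expect i g ≤ p.expect i h :=
  Finset.sum_le_sum fun _ _ => mul_le_mul_of_nonneg_left (H _) (by positivity)

theorem expect_add (p : Subroutine I A) (i : I) (g h : A → ℝ) :
    p.expect i (fun a => g a + h a) = p.expect i g + p.expect i h := by
  simp [expect, mul_add, Finset.sum_add_distrib]

theorem expect_le_of_le (p : Subroutine I A) (i : I) {g : A → ℝ} {c : ℝ} (H : ∀ a, g a ≤ c) :
    p.expect i g ≤ c :=
  (p.expect_mono i H).trans_eq (p.expect_const i c)

theorem expect_nonneg (p : Subroutine I A) (i : I) {g : A → ℝ} (H : ∀ a, 0 ≤ g a) :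
    0 ≤ p.expect i g :=
  Finset.sum_nonneg fun _ _ => mul_nonneg (by positivity) (H _)

theorem expect_ret (f : I → A) (i : I) (g : A → ℝ) : (ret f).expect i g = g (f i) := by
  change ∑ _w : Unit, ‖(ket () : QState Unit) ()‖ ^ 2 * g (f i) = _
  classical
  simp [ket_apply]

theorem expect_comap (p : Subroutine I A) (k : J → I) (j : J) (g : A → ℝ) :
    (p.comap k).expect j g = p.expect (k j) g := by
  unfold expect
  rfl

/-- The workspace of `p` acts only as a control after `p` has run, so amplitudes multiply as in a
path sum. This is what makes deferred measurement equivalent to measuring at once. -/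
theorem finalState_bind (p : Subroutine I A) (q : Subroutine (I × A) B) (i : I) (w : p.W × q.W) :
    (p.bind q).finalState i w = p.finalState i w.1 * q.finalState (i, p.out i w.1) w.2 := by
  change (((p.circ i).onFst).comp (Circuit.select fun w => q.circ (i, p.out i w))).op
    (ket (p.w0, q.w0)) w = _
  rw [Circuit.comp_op_apply, ket_prod, Circuit.onFst_op_tens, Circuit.select_op_tens]
  rfl

/-- Turns coherent composition into composition of classical conditional expectations; from here on,
all sequential analysis is probabilistic. -/
theorem expect_bind (p : Subroutine I A) (q : Subroutine (I × A) B) (i : I) (g : B → ℝ) :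
    (p.bind q).expect i g = p.expect i fun a => q.expect (i, a) g := by
  change ∑ w : p.W × q.W, ‖(p.bind q).finalState i w‖ ^ 2 * g (q.out (i, p.out i w.1) w.2) = _
  rw [Fintype.sum_prod_type, expect]
  refine Finset.sum_congr rfl fun w _ => ?_
  rw [expect, Finset.mul_sum]
  refine Finset.sum_congr rfl fun w' _ => ?_
  have h := p.finalState_bind q i (w, w')
  dsimp only at h ⊢
  rw [h, norm_mul, mul_pow, mul_assoc]

theorem expect_sample [Fintype X] (x₀ : X) (C : I → Finset X) (i : I) (hC : (C i).Nonempty)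
    (g : X → ℝ) : (sample x₀ C).expect i g = (∑ x ∈ C i, g x) / (C i).card := by
  classical
  have hc : (0 : ℝ) < (C i).card := by exact_mod_cast hC.card_pos
  change ∑ x : X, ‖prepareGate x₀ (C i) (ket x₀) x‖ ^ 2 * g x = _
  rw [prepareGate_ket hC]
  have h2 : ∀ x, ‖uniformKet (C i) x‖ ^ 2 * g x = if x ∈ C i then g x / (C i).card else 0 := by
    intro x
    rw [uniformKet_apply]
    split_ifs
    · rw [Complex.norm_real, Real.norm_eq_abs, sq_abs, div_pow, Real.sq_sqrt hc.le]; ring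
    · simp
  simp_rw [h2, Finset.sum_ite_mem, Finset.univ_inter, Finset.sum_div]

theorem expect_lookup [Fintype A] [Nonempty A] (T : I → A) (i : I) (g : A → ℝ) :
    (lookup T).expect i g = g (T i) := by
  classical
  have : NeZero (Fintype.card A) := ⟨Fintype.card_ne_zero⟩
  change ∑ z : Fin (Fintype.card A),
    ‖permGate (Equiv.addRight (Fintype.equivFin A (T i))) (ket 0) z‖ ^ 2
      * g ((Fintype.equivFin A).symm z) = _
  have h : ∀ z : Fin (Fintype.card A),
      ‖permGate (Equiv.addRight (Fintype.equivFin A (T i))) (ket 0) z‖ ^ 2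
        = if z = Fintype.equivFin A (T i) then 1 else 0 := by
    intro z
    rw [permGate_apply, ket_apply]
    split_ifs with h1 h2 h2 <;> simp_all [add_neg_eq_zero]
  simp [h]

theorem expect_iterate_zero (p : Subroutine (I × S) S) (t : I × S) (g : S → ℝ) :
    (p.iterate 0).expect t g = g t.2 := expect_ret _ _ _

theorem expect_iterate_succ (p : Subroutine (I × S) S) (n : ℕ) (t : I × S) (g : S → ℝ) :
    (p.iterate (n + 1)).expect t g = (p.iterate n).expect t fun s => p.expect (t.1, s) g := by
  rw [iterate, expect_bind]; rfl

/-- If one step turns `g k` into at most `g (k + 1) + τ`, then `n` steps turn `g k` into at most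
`g (k + n) + n τ`. -/
theorem expect_iterate_le (p : Subroutine (I × S) S) (i : I) (g : ℕ → S → ℝ) (τ : ℝ)
    (h : ∀ k s, p.expect (i, s) (g k) ≤ g (k + 1) s + τ) (n k : ℕ) (s : S) :
    (p.iterate n).expect (i, s) (g k) ≤ g (k + n) s + n * τ := by
  induction n generalizing k with
  | zero => simp [expect_iterate_zero]
  | succ n ih =>
    rw [expect_iterate_succ]
    refine (expect_mono _ _ fun s => h k s).trans ?_
    rw [expect_add, expect_const]
    refine (add_le_add_left (ih (k + 1)) τ).trans_eq ?_
    rw [show k + 1 + n = k + (n + 1) by ring]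
    push_cast
    ring

/-- The probability that the output lies in `E` is the expected value of the indicator of `E`. -/
theorem dist_apply_set (p : Subroutine I A) (i : I) (E : Set A) [DecidablePred (· ∈ E)] :
    (p.dist i).toOuterMeasure E = ENNReal.ofReal (p.expect i fun a => if a ∈ E then 1 else 0) := by
  rw [dist, PMF.toOuterMeasure_map_apply, PMF.toOuterMeasure_apply_fintype, expect,
    ENNReal.ofReal_sum_of_nonneg (fun _ _ => by positivity)]
  refine Finset.sum_congr rfl fun w _ => ?_
  by_cases h : p.out i w ∈ E <;> simp [Set.indicator, h, PMF.ofFintype_apply]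

end Subroutine

end

end LongestTrail

namespace LongestTrail

noncomputable section

/-! ### The ideal Grover iteration -/

section IdealGrover

open scoped Classical

variable {X : Type} [Fintype X]

/-- The state after `k` Grover iterations with a perfect phase oracle for `p`, started in the equal
superposition over `C`. -/
def idealGrover (C : Finset X) (p : X → Prop) : ℕ → QState X
  | 0 => uniformKet C
  | k + 1 => diffusionGate C (phaseGate p (idealGrover C p k))

/-- The angle of Grover's algorithm for `t` marked elements among `n`. -/
def groverAngle (t n : ℕ) : ℝ := Real.arcsin (Real.sqrt ((t : ℝ) / n))

theorem sin_groverAngle {t n : ℕ} (h : t ≤ n) :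
    Real.sin (groverAngle t n) = Real.sqrt ((t : ℝ) / n) := by
  rw [groverAngle, Real.sin_arcsin]
  · exact le_trans (by norm_num) (Real.sqrt_nonneg _)
  · refine Real.sqrt_le_one.mpr ?_
    exact div_le_one_of_le₀ (by exact_mod_cast h) (by positivity)

theorem cos_groverAngle {t n : ℕ} (h : t ≤ n) (hn : 0 < n) :
    Real.cos (groverAngle t n) = Real.sqrt (((n - t : ℕ) : ℝ) / n) := by
  rw [groverAngle, Real.cos_arcsin, Real.sq_sqrt (by positivity), Nat.cast_sub h]
  have : (n : ℝ) ≠ 0 := by positivity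
  congr 1
  field_simp

theorem norm_idealGrover {C : Finset X} (hC : C.Nonempty) (p : X → Prop) (k : ℕ) :
    ‖idealGrover C p k‖ = 1 := by
  induction k with
  | zero => exact norm_uniformKet hC
  | succ k ih => rw [idealGrover, LinearIsometryEquiv.norm_map, LinearIsometryEquiv.norm_map, ih]

theorem sqrt_div_mul_inv_sqrt {a n : ℝ} (ha : 0 < a) (hn : 0 ≤ n) :
    Real.sqrt (a / n) / Real.sqrt a = 1 / Real.sqrt n := by
  rw [Real.sqrt_div' _ hn]
  have := Real.sqrt_pos.mpr ha
  field_simp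

/-- The amplitudes after `k` Grover iterations. -/
theorem idealGrover_apply {C : Finset X} (hC : C.Nonempty) (p : X → Prop) [DecidablePred p] (k : ℕ) (x : X) :
    idealGrover C p k x =
      ((if x ∈ C then
        if p x then Real.sin ((2 * k + 1) * groverAngle (C.filter p).card C.card)
            / Real.sqrt (C.filter p).card
        else Real.cos ((2 * k + 1) * groverAngle (C.filter p).card C.card)
            / Real.sqrt (C.card - (C.filter p).card : ℕ)
      else 0 : ℝ) : ℂ) := by
  set t := (C.filter p).card with ht
  set n := C.card with hn
  set θ := groverAngle t n with hθ
  have htn : t ≤ n := Finset.card_filter_le _ _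
  have hn0 : 0 < n := hC.card_pos
  have hn0' : (0 : ℝ) < n := by exact_mod_cast hn0
  have hsin : Real.sin θ = Real.sqrt ((t : ℝ) / n) := sin_groverAngle htn
  have hcos : Real.cos θ = Real.sqrt (((n - t : ℕ) : ℝ) / n) := cos_groverAngle htn hn0
  have hcu : (C.filter fun x => ¬ p x).card = n - t := by
    have := Finset.card_filter_add_card_filter_not (s := C) p
    omega
  have htpos : ∀ x ∈ C, p x → (0 : ℝ) < t := fun x hx hp => by
    exact_mod_cast Finset.card_pos.mpr ⟨x, Finset.mem_filter.mpr ⟨hx, hp⟩⟩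
  have hupos : ∀ x ∈ C, ¬ p x → (0 : ℝ) < (n - t : ℕ) := fun x hx hp => by
    rw [← hcu]
    exact_mod_cast Finset.card_pos.mpr ⟨x, Finset.mem_filter.mpr ⟨hx, hp⟩⟩
  induction k generalizing x with
  | zero =>
    rw [idealGrover, uniformKet_apply]
    by_cases hx : x ∈ C
    · by_cases hp : p x
      · simp only [hx, hp, if_true, Nat.cast_zero, mul_zero, zero_add, one_mul, hsin]
        rw [sqrt_div_mul_inv_sqrt (htpos x hx hp) hn0'.le]
      · simp only [hx, hp, if_true, if_false, Nat.cast_zero, mul_zero, zero_add, one_mul, hcos]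
        rw [sqrt_div_mul_inv_sqrt (hupos x hx hp) hn0'.le]
    · simp [hx]
  | succ k ih =>
    have hinner : inner ℂ (uniformKet C) (phaseGate p (idealGrover C p k))
        = ((Real.cos ((2 * k + 2) * θ) : ℝ) : ℂ) := by
      rw [PiLp.inner_apply]
      have h1 : ∀ y, inner ℂ (uniformKet C y) (phaseGate p (idealGrover C p k) y)
          = (((if y ∈ C.filter p then
              -(Real.sin ((2 * k + 1) * θ) / Real.sqrt t / Real.sqrt n) else 0) +
            (if y ∈ C.filter (fun x => ¬ p x) then
              (Real.cos ((2 * k + 1) * θ) / Real.sqrt (n - t : ℕ) / Real.sqrt n) else 0) : ℝ)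
                : ℂ) := by
        intro y
        rw [uniformKet_apply, phaseGate_apply, ih y]
        by_cases hy : y ∈ C
        · by_cases hp : p y
          · simp [hy, hp]; ring
          · simp [hy, hp]; ring
        · simp [hy]
      simp_rw [h1]
      rw [← Complex.ofReal_sum]
      congr 1
      rw [Finset.sum_add_distrib, Finset.sum_ite_mem, Finset.sum_ite_mem, Finset.univ_inter,
        Finset.univ_inter, Finset.sum_const, Finset.sum_const, hcu, ← ht, nsmul_eq_mul,
        nsmul_eq_mul, show (2 * (k : ℝ) + 2) * θ = (2 * k + 1) * θ + θ by ring, Real.cos_add,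
        hsin, hcos, Real.sqrt_div' _ hn0'.le, Real.sqrt_div' _ hn0'.le]
      have e1 : (t : ℝ) * -(Real.sin ((2 * k + 1) * θ) / Real.sqrt t / Real.sqrt n)
          = -(Real.sin ((2 * k + 1) * θ) * ((t : ℝ) / Real.sqrt t / Real.sqrt n)) := by ring
      have e2 : ((n - t : ℕ) : ℝ) *
          (Real.cos ((2 * k + 1) * θ) / Real.sqrt (n - t : ℕ) / Real.sqrt n)
          = Real.cos ((2 * k + 1) * θ) * (((n - t : ℕ) : ℝ) / Real.sqrt (n - t : ℕ)
            / Real.sqrt n) := by ring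
      rw [e1, e2, Real.div_sqrt, Real.div_sqrt]
      ring
    rw [idealGrover, diffusionGate_apply hC, hinner]
    have e : phaseGate p (idealGrover C p k) x
        = if p x then -idealGrover C p k x else idealGrover C p k x := phaseGate_apply _ _ _
    rw [PiLp.sub_apply, PiLp.smul_apply, e, uniformKet_apply, ih x, smul_eq_mul]
    by_cases hx : x ∈ C
    · by_cases hp : p x
      · simp only [hx, hp, if_true]
        rw [← hn, ← sqrt_div_mul_inv_sqrt (htpos x hx hp) hn0'.le, ← hsin]
        -- Sum-to-product around the middle angle `(2k+2)θ`, which is the angle in `hinner`.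
        have : Real.sin ((2 * ((k + 1 : ℕ) : ℝ) + 1) * θ)
            = 2 * Real.cos ((2 * k + 2) * θ) * Real.sin θ + Real.sin ((2 * k + 1) * θ) := by
          have e1 : (2 * ((k + 1 : ℕ) : ℝ) + 1) * θ = (2 * k + 2) * θ + θ := by push_cast; ring
          have e2 : (2 * (k : ℝ) + 1) * θ = (2 * k + 2) * θ - θ := by ring
          rw [e1, e2, Real.sin_add, Real.sin_sub]; ring
        rw [this]
        push_cast
        ring
      · simp only [hx, hp, if_true, if_false]
        rw [← hn, ← sqrt_div_mul_inv_sqrt (hupos x hx hp) hn0'.le, ← hcos]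
        have : Real.cos ((2 * ((k + 1 : ℕ) : ℝ) + 1) * θ)
            = 2 * Real.cos ((2 * k + 2) * θ) * Real.cos θ - Real.cos ((2 * k + 1) * θ) := by
          have e1 : (2 * ((k + 1 : ℕ) : ℝ) + 1) * θ = (2 * k + 2) * θ + θ := by push_cast; ring
          have e2 : (2 * (k : ℝ) + 1) * θ = (2 * k + 2) * θ - θ := by ring
          rw [e1, e2, Real.cos_add, Real.cos_sub]; ring
        rw [this]
        push_cast
        ring
    · simp [hx]

theorem idealGrover_eq_zero {C : Finset X} (hC : C.Nonempty) (p : X → Prop) (k : ℕ) {x : X}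
    (hx : x ∉ C) : idealGrover C p k x = 0 := by
  rw [idealGrover_apply hC]; simp [hx]

/-- The mean of `G` over the outcomes of Grover's algorithm with a perfect oracle. -/
theorem sum_idealGrover {C : Finset X} (hC : C.Nonempty) (p : X → Prop) [DecidablePred p] (k : ℕ)
    (G : X → ℝ) :
    ∑ x, ‖idealGrover C p k x‖ ^ 2 * G x =
      Real.sin ((2 * k + 1) * groverAngle (C.filter p).card C.card) ^ 2
          * ((∑ x ∈ C.filter p, G x) / (C.filter p).card)
        + Real.cos ((2 * k + 1) * groverAngle (C.filter p).card C.card) ^ 2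
          * ((∑ x ∈ C.filter (fun x => ¬ p x), G x) / (C.card - (C.filter p).card : ℕ)) := by
  have h1 : ∀ x, ‖idealGrover C p k x‖ ^ 2 * G x =
      (if x ∈ C.filter p then
        Real.sin ((2 * k + 1) * groverAngle (C.filter p).card C.card) ^ 2
          / (C.filter p).card * G x else 0)
      + (if x ∈ C.filter (fun x => ¬ p x) then
        Real.cos ((2 * k + 1) * groverAngle (C.filter p).card C.card) ^ 2
          / (C.card - (C.filter p).card : ℕ) * G x else 0) := by
    intro x
    rw [idealGrover_apply hC, Complex.norm_real, Real.norm_eq_abs, sq_abs]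
    by_cases hx : x ∈ C
    · by_cases hp : p x
      · simp only [hx, hp, Finset.mem_filter, if_true, true_and, not_true, and_false, if_false,
          add_zero, div_pow]
        rw [Real.sq_sqrt (Nat.cast_nonneg _)]
      · simp only [hx, hp, Finset.mem_filter, if_true, true_and, not_false_eq_true, if_false,
          zero_add, div_pow]
        rw [Real.sq_sqrt (Nat.cast_nonneg _)]
    · simp [hx]
  simp_rw [h1]
  rw [Finset.sum_add_distrib, Finset.sum_ite_mem, Finset.sum_ite_mem, Finset.univ_inter,
    Finset.univ_inter, ← Finset.mul_sum, ← Finset.mul_sum]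
  ring

end IdealGrover

/-- The mean values of a function in two unit states differ by at most twice the distance of the
states. -/
theorem sum_norm_sq_le {X : Type} [Fintype X] (ψ χ : QState X) (hψ : ‖ψ‖ = 1) (hχ : ‖χ‖ = 1)
    {G : X → ℝ} (hG0 : ∀ x, 0 ≤ G x) (hG1 : ∀ x, G x ≤ 1) :
    ∑ x, ‖ψ x‖ ^ 2 * G x ≤ ∑ x, ‖χ x‖ ^ 2 * G x + 2 * ‖ψ - χ‖ := by
  -- Factor `a² - b² = (a - b)(a + b)`; Cauchy–Schwarz against each of the two unit states then
  -- contributes one `‖ψ - χ‖`.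
  have h1 : ∀ x, ‖ψ x‖ ^ 2 * G x - ‖χ x‖ ^ 2 * G x ≤ ‖(ψ - χ) x‖ * (‖ψ x‖ + ‖χ x‖) := by
    intro x
    have e : ‖ψ x‖ - ‖χ x‖ ≤ ‖(ψ - χ) x‖ := norm_sub_norm_le _ _
    have n1 := norm_nonneg (ψ x)
    have n2 := norm_nonneg (χ x)
    have n3 := norm_nonneg ((ψ - χ) x)
    have e2 : (‖ψ x‖ - ‖χ x‖) * (‖ψ x‖ + ‖χ x‖) ≤ ‖(ψ - χ) x‖ * (‖ψ x‖ + ‖χ x‖) :=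
      mul_le_mul_of_nonneg_right e (by positivity)
    have e3 : 0 ≤ ‖(ψ - χ) x‖ * (‖ψ x‖ + ‖χ x‖) := by positivity
    calc ‖ψ x‖ ^ 2 * G x - ‖χ x‖ ^ 2 * G x = ((‖ψ x‖ - ‖χ x‖) * (‖ψ x‖ + ‖χ x‖)) * G x := by ring
      _ ≤ (‖(ψ - χ) x‖ * (‖ψ x‖ + ‖χ x‖)) * G x := mul_le_mul_of_nonneg_right e2 (hG0 x)
      _ ≤ _ := mul_le_of_le_one_right e3 (hG1 x)
  have cs : ∀ φ : QState X, ‖φ‖ = 1 → ∑ x, ‖(ψ - χ) x‖ * ‖φ x‖ ≤ ‖ψ - χ‖ := by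
    intro φ hφ
    have := Finset.sum_mul_sq_le_sq_mul_sq Finset.univ (fun x => ‖(ψ - χ) x‖) (fun x => ‖φ x‖)
    rw [← EuclideanSpace.norm_sq_eq, ← EuclideanSpace.norm_sq_eq, hφ, one_pow, mul_one] at this
    exact le_of_sq_le_sq this (norm_nonneg _)
  have h2 := Finset.sum_le_sum fun x (_ : x ∈ Finset.univ) => h1 x
  simp_rw [mul_add] at h2
  rw [Finset.sum_sub_distrib, Finset.sum_add_distrib] at h2
  linarith [cs ψ hψ, cs χ hχ]

/-! ### Grover's algorithm with a faulty oracle -/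

namespace Subroutine

open scoped Classical

variable {J A X : Type} [Fintype X]

/-- The failure probability of `f` on the input `i`: the probability that the output is not in
`good`. -/
def failure {I : Type} (f : Subroutine I A) (i : I) (good : A → Prop) : ℝ :=
  f.expect i fun a => if good a then 0 else 1

/-- The true and the ideal state agree on every basis state in which both evaluations are correct.
Elsewhere amplitudes differ by at most twice their modulus, giving a factor `4` for squares, and
each of the two evaluations is wrong with weight at most `ε`; hence `8ε`. Failure is controlled only
at candidates, so `φ` has to vanish off `C`. -/
theorem mark_error (val : A → WithBot ℕ) (f : Subroutine (J × X) A) (j : J) (thr : X)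
    (C : Finset X) (V : X → WithBot ℕ) (ε : ℝ)
    (hf : ∀ x ∈ C, f.failure (j, x) (fun a => val a = V x) ≤ ε) (hthr : thr ∈ C)
    (φ : QState X) (hφ : ∀ x ∉ C, φ x = 0) :
    ‖(mark val f j thr).op (tens φ (ket (f.w0, f.w0)))
      - tens (phaseGate (fun x => V thr < V x) φ) (ket (f.w0, f.w0))‖ ≤ Real.sqrt (8 * ε) * ‖φ‖ := by
  set compute : Circuit (X × (f.W × f.W)) :=
    Circuit.select fun x => ((f.circ (j, x)).onFst).comp ((f.circ (j, thr)).onSnd) with hc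
  set P : QGate (X × (f.W × f.W)) := phaseGate fun s =>
    val (f.out (j, thr) s.2.2) < val (f.out (j, s.1) s.2.1) with hP
  set F : X → QState f.W := fun x => f.finalState (j, x) with hF
  have hcomp : ∀ (χ : QState X) (s : X × (f.W × f.W)),
      compute.op (tens χ (ket (f.w0, f.w0))) s = χ s.1 * (F s.1 s.2.1 * F thr s.2.2) := by
    intro χ s
    rw [hc, Circuit.select_op_tens, Circuit.comp_op_apply, ket_prod, Circuit.onFst_op_tens,
      Circuit.onSnd_op_tens]
    rfl
  have hmark : (mark val f j thr).op (tens φ (ket (f.w0, f.w0)))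
      = compute.adjoint.op (P (compute.op (tens φ (ket (f.w0, f.w0))))) := by
    have h : mark val f j thr = (compute.comp (Circuit.step P)).comp compute.adjoint := by
      rw [mark]
    rw [h, Circuit.comp_op_apply, Circuit.comp_op_apply, Circuit.step_op]
  -- Writing the ideal state as an uncomputed one lets unitarity cancel the uncomputation: the
  -- comparison takes place just after the phase flip.
  rw [hmark, ← Circuit.adjoint_op_op compute (tens (phaseGate _ φ) _),
    ← LinearIsometryEquiv.map_sub compute.adjoint.op,
    LinearIsometryEquiv.norm_map compute.adjoint.op]
  refine le_of_sq_le_sq ?_ (by positivity)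
  rw [EuclideanSpace.norm_sq_eq, mul_pow]
  set bad : X → f.W → ℝ := fun x w =>
    @ite ℝ (val (f.out (j, x) w) = V x) (Classical.propDecidable _) 0 1 with hbad
  have hbad0 : ∀ x w, 0 ≤ bad x w := fun x w => by simp only [hbad]; split_ifs <;> norm_num
  have hpt : ∀ s : X × (f.W × f.W),
      ‖(P (compute.op (tens φ (ket (f.w0, f.w0)))) -
        compute.op (tens (phaseGate (fun x => V thr < V x) φ) (ket (f.w0, f.w0)))) s‖ ^ 2
      ≤ 4 * ‖φ s.1‖ ^ 2 * (‖F s.1 s.2.1‖ ^ 2 * bad s.1 s.2.1 * ‖F thr s.2.2‖ ^ 2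
        + ‖F s.1 s.2.1‖ ^ 2 * (‖F thr s.2.2‖ ^ 2 * bad thr s.2.2)) := by
    intro s
    rw [PiLp.sub_apply, hP, phaseGate_apply, hcomp, hcomp, phaseGate_apply]
    by_cases h1 : val (f.out (j, s.1) s.2.1) = V s.1 ∧ val (f.out (j, thr) s.2.2) = V thr
    · rw [h1.1, h1.2]
      have h2 : ∀ a b c : ℂ, ∀ (q : Prop) (i₁ i₂ : Decidable q),
          (@ite ℂ q i₁ (-(a * (b * c))) (a * (b * c))) - (@ite ℂ q i₂ (-a) a) * (b * c) = 0 := by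
        intro a b c q i₁ i₂
        by_cases hq : q <;> simp [hq]
      rw [h2 (φ s.1) (F s.1 s.2.1) (F thr s.2.2) (V thr < V s.1)]
      have := hbad0 s.1 s.2.1
      have := hbad0 thr s.2.2
      simp only [norm_zero, ne_eq, OfNat.ofNat_ne_zero, not_false_eq_true, zero_pow]
      positivity
    · have hge : 1 ≤ bad s.1 s.2.1 + bad thr s.2.2 := by
        have := hbad0 s.1 s.2.1
        have := hbad0 thr s.2.2
        rw [not_and_or] at h1
        rcases h1 with h1 | h1 <;> simp only [hbad, h1, if_false] at * <;> linarith
      have : ∀ a b c : ℂ, ∀ (q r : Prop) [Decidable q] [Decidable r],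
          ‖(if q then -(a * (b * c)) else a * (b * c)) - (if r then -a else a) * (b * c)‖ ^ 2 ≤ 4 * ‖a‖ ^ 2 * (‖b‖ ^ 2 * ‖c‖ ^ 2) := by
        intro a b c q r _ _
        have h0 : 0 ≤ ‖a‖ * (‖b‖ * ‖c‖) := by positivity
        have h2 : ‖(if q then -(a * (b * c)) else a * (b * c))
          - (if r then -a else a) * (b * c)‖ ≤ 2 * (‖a‖ * (‖b‖ * ‖c‖)) := by
          refine (norm_sub_le _ _).trans_eq ?_
          split_ifs <;> simp <;> ring
        calc _ ≤ (2 * (‖a‖ * (‖b‖ * ‖c‖))) ^ 2 := pow_le_pow_left₀ (norm_nonneg _) h2 2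
          _ = _ := by ring
      refine (this (φ s.1) (F s.1 s.2.1) (F thr s.2.2) _ _).trans ?_
      have h3 : 0 ≤ 4 * ‖φ s.1‖ ^ 2 * (‖F s.1 s.2.1‖ ^ 2 * ‖F thr s.2.2‖ ^ 2) := by positivity
      calc _ ≤ 4 * ‖φ s.1‖ ^ 2 * (‖F s.1 s.2.1‖ ^ 2 * ‖F thr s.2.2‖ ^ 2)
              * (bad s.1 s.2.1 + bad thr s.2.2) := le_mul_of_one_le_right h3 hge
        _ = _ := by ring
  refine (Finset.sum_le_sum fun s _ => hpt s).trans ?_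
  rw [Fintype.sum_prod_type]
  have hone : ∀ x, ∑ w, ‖F x w‖ ^ 2 = 1 := fun x => f.sum_norm_finalState (j, x)
  have hfail : ∀ x, ∑ w, ‖F x w‖ ^ 2 * bad x w = f.failure (j, x) (fun a => val a = V x) :=
    fun x => rfl
  have hx : ∀ x, ∑ w : f.W × f.W, 4 * ‖φ x‖ ^ 2 * (‖F x w.1‖ ^ 2 * bad x w.1 * ‖F thr w.2‖ ^ 2
        + ‖F x w.1‖ ^ 2 * (‖F thr w.2‖ ^ 2 * bad thr w.2)) ≤ 8 * ε * ‖φ x‖ ^ 2 := by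
    intro x
    rw [← Finset.mul_sum, Finset.sum_add_distrib, Fintype.sum_prod_type, Fintype.sum_prod_type]
    simp_rw [← Finset.mul_sum, ← Finset.sum_mul]
    rw [hone, hone, hfail, hfail]
    by_cases hxC : x ∈ C
    · have h4 : 0 ≤ 4 * ‖φ x‖ ^ 2 := by positivity
      nlinarith [hf x hxC, hf thr hthr]
    · simp [hφ x hxC]
  refine (Finset.sum_le_sum fun x _ => hx x).trans ?_
  rw [← Finset.mul_sum, ← EuclideanSpace.norm_sq_eq]
  have hε : 0 ≤ ε := le_trans (f.expect_nonneg _ fun a => by split_ifs <;> norm_num) (hf thr hthr)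
  rw [Real.sq_sqrt (by positivity)]

/-- One iteration of Grover's algorithm. -/
def groverStep (C : J → Finset X) (val : A → WithBot ℕ) (f : Subroutine (J × X) A) (j : J)
    (thr : X) : Circuit (X × (f.W × f.W)) :=
  (mark val f j thr).comp (Circuit.step (diffusionGate (C j))).onFst

/-- Hybrid argument: later unitaries preserve earlier errors, so each iteration adds one marking
error. That error is measured on the ideal state, which is supported on the candidates and has its
workspace back in the initial state. -/
theorem groverStep_pow_error (C : J → Finset X) (val : A → WithBot ℕ)
    (f : Subroutine (J × X) A) (j : J) (thr : X) (V : X → WithBot ℕ) (ε : ℝ)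
    (hf : ∀ x ∈ C j, f.failure (j, x) (fun a => val a = V x) ≤ ε) (hthr : thr ∈ C j) (k : ℕ) :
    ‖((groverStep C val f j thr).pow k).op (tens (uniformKet (C j)) (ket (f.w0, f.w0)))
      - tens (idealGrover (C j) (fun x => V thr < V x) k) (ket (f.w0, f.w0))‖
      ≤ k * Real.sqrt (8 * ε) := by
  have hC : (C j).Nonempty := ⟨thr, hthr⟩
  set it := groverStep C val f j thr with hit
  induction k with
  | zero => simp [Circuit.pow, Circuit.idle, idealGrover]
  | succ k ih =>
    rw [Circuit.pow, Circuit.comp_op_apply, idealGrover]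
    set ψ := (it.pow k).op (tens (uniformKet (C j)) (ket (f.w0, f.w0)))
    set φ := idealGrover (C j) (fun x => V thr < V x) k with hφ
    have h1 : ‖it.op ψ - it.op (tens φ (ket (f.w0, f.w0)))‖ ≤ k * Real.sqrt (8 * ε) := by
      rw [← LinearIsometryEquiv.map_sub it.op, LinearIsometryEquiv.norm_map]; exact ih
    have h2 : ‖it.op (tens φ (ket (f.w0, f.w0)))
        - tens (diffusionGate (C j) (phaseGate (fun x => V thr < V x) φ)) (ket (f.w0, f.w0))‖
          ≤ Real.sqrt (8 * ε) := by
      have e : tens (diffusionGate (C j) (phaseGate (fun x => V thr < V x) φ)) (ket (f.w0, f.w0))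
          = (Circuit.step (diffusionGate (C j))).onFst.op
            (tens (phaseGate (fun x => V thr < V x) φ) (ket (f.w0, f.w0))) := by
        rw [Circuit.onFst_op_tens, Circuit.step_op]
      rw [e, hit, groverStep, Circuit.comp_op_apply,
        ← LinearIsometryEquiv.map_sub (Circuit.step (diffusionGate (C j))).onFst.op,
        LinearIsometryEquiv.norm_map (Circuit.step (diffusionGate (C j))).onFst.op]
      have hm := mark_error val f j thr (C j) V ε hf hthr φ
        fun x hx => idealGrover_eq_zero hC _ _ hx
      rw [hφ, norm_idealGrover hC, mul_one, ← hφ] at hm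
      exact hm
    refine (norm_sub_le_norm_sub_add_norm_sub _ (it.op (tens φ (ket (f.w0, f.w0)))) _).trans ?_
    push_cast
    linarith

/-- Grover's algorithm with a faulty oracle: the mean value of `G` exceeds the ideal one by at most
`2 k √(8 ε)`. -/
theorem expect_grover_le (x₀ : X) (C : J → Finset X) (val : A → WithBot ℕ)
    (f : Subroutine (J × X) A) (j : J) (thr : X) (V : X → WithBot ℕ) (ε : ℝ)
    (hf : ∀ x ∈ C j, f.failure (j, x) (fun a => val a = V x) ≤ ε) (hthr : thr ∈ C j) (k : ℕ)
    {G : X → ℝ} (hG0 : ∀ x, 0 ≤ G x) (hG1 : ∀ x, G x ≤ 1) :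
    (grover x₀ C val f).expect (j, (thr, k)) G
      ≤ ∑ x, ‖idealGrover (C j) (fun x => V thr < V x) k x‖ ^ 2 * G x
        + 2 * (k * Real.sqrt (8 * ε)) := by
  have hC : (C j).Nonempty := ⟨thr, hthr⟩
  have h1 := sum_norm_sq_le
    (((groverStep C val f j thr).pow k).op (tens (uniformKet (C j)) (ket (f.w0, f.w0))))
    (tens (idealGrover (C j) (fun x => V thr < V x) k) (ket (f.w0, f.w0)))
    (by rw [LinearIsometryEquiv.norm_map, norm_tens, norm_uniformKet hC, norm_ket, one_mul])
    (by rw [norm_tens, norm_idealGrover hC, norm_ket, one_mul])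
    (G := fun s => G s.1) (fun s => hG0 _) (fun s => hG1 _)
  have h2 : ∑ s : X × (f.W × f.W),
      ‖tens (idealGrover (C j) (fun x => V thr < V x) k) (ket (f.w0, f.w0)) s‖ ^ 2 * G s.1
      = ∑ x, ‖idealGrover (C j) (fun x => V thr < V x) k x‖ ^ 2 * G x := by
    have : ∑ w, ‖ket (f.w0, f.w0) w‖ ^ 2 = 1 := by
      rw [← EuclideanSpace.norm_sq_eq, norm_ket, one_pow]
    rw [Fintype.sum_prod_type]
    refine Finset.sum_congr rfl fun x _ => ?_
    simp_rw [tens_apply, norm_mul, mul_pow]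
    rw [← Finset.sum_mul, ← Finset.mul_sum, this, mul_one]
  have h3 := groverStep_pow_error C val f j thr V ε hf hthr k
  have h4 : (grover x₀ C val f).expect (j, (thr, k)) G = ∑ s : X × (f.W × f.W),
      ‖((groverStep C val f j thr).pow k).op (tens (uniformKet (C j)) (ket (f.w0, f.w0))) s‖ ^ 2
        * G s.1 := by
    change ∑ s : X × (f.W × f.W), ‖((groverStep C val f j thr).pow k).op
      ((Circuit.step (prepareGate x₀ (C j))).onFst.op (ket (x₀, (f.w0, f.w0)))) s‖ ^ 2 * G s.1 = _
    rw [ket_prod, Circuit.onFst_op_tens, Circuit.step_op, prepareGate_ket hC]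
  rw [h4, ← h2]
  linarith

end Subroutine

end

end LongestTrail

namespace LongestTrail

noncomputable section

/-! ### The success probability of exponential search -/

/-- With `x = (2k+1)θ` and `sin² x = (1 - cos 2x)/2`, the product `2 sin 2θ cos 2x = sin 4(k+1)θ -
sin 4kθ` telescopes. -/
theorem two_mul_sin_mul_sum_sin_sq (θ : ℝ) (M : ℕ) :
    2 * Real.sin (2 * θ) * ∑ k ∈ Finset.range M, Real.sin ((2 * k + 1) * θ) ^ 2
      = M * Real.sin (2 * θ) - Real.sin (4 * M * θ) / 2 := by
  induction M with
  | zero => simp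
  | succ M ih =>
    rw [Finset.sum_range_succ, mul_add, ih]
    have e1 : 4 * ((M + 1 : ℕ) : ℝ) * θ = 2 * ((2 * M + 1) * θ) + 2 * θ := by push_cast; ring
    have e2 : 4 * (M : ℝ) * θ = 2 * ((2 * M + 1) * θ) - 2 * θ := by ring
    rw [e1, e2, Real.sin_add, Real.sin_sub, Real.cos_two_mul ((2 * M + 1) * θ)]
    have := Real.sin_sq_add_cos_sq ((2 * (M : ℝ) + 1) * θ)
    have e3 : Real.cos ((2 * (M : ℝ) + 1) * θ) ^ 2 = 1 - Real.sin ((2 * (M : ℝ) + 1) * θ) ^ 2 := by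
      linarith
    rw [e3]
    push_cast
    ring

theorem sin_odd_mul_pi_div_two_sq (k : ℕ) : Real.sin ((2 * k + 1) * (Real.pi / 2)) ^ 2 = 1 := by
  have : (2 * (k : ℝ) + 1) * (Real.pi / 2) = Real.pi / 2 + k * Real.pi := by ring
  rw [this, Real.sin_add_nat_mul_pi, Real.sin_pi_div_two, mul_one, ← pow_mul, mul_comm, pow_mul]
  norm_num

/-- On average over the number of iterations Grover's algorithm succeeds with probability at least
`1/4`, if the range of the number of iterations is large enough. -/
theorem quarter_le_sum_sin_sq {θ : ℝ} (h0 : 0 ≤ θ) (h1 : θ ≤ Real.pi / 2) {M : ℕ}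
    (hM : 1 ≤ M * Real.sin θ) :
    (M : ℝ) / 4 ≤ ∑ k ∈ Finset.range M, Real.sin ((2 * k + 1) * θ) ^ 2 := by
  have hid := two_mul_sin_mul_sum_sin_sq θ M
  set s := ∑ k ∈ Finset.range M, Real.sin ((2 * k + 1) * θ) ^ 2 with hs
  have hsin : 0 ≤ Real.sin θ := Real.sin_nonneg_of_nonneg_of_le_pi h0 (by linarith [Real.pi_pos])
  have hM0 : (0 : ℝ) < M := by
    rcases Nat.eq_zero_or_pos M with h | h
    · simp [h] at hM; linarith
    · exact_mod_cast h
  -- The identity says that the sum equals `M/2 - sin(4Mθ)/(4 sin 2θ)`, so it remains to bound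
  -- `sin(4Mθ)` by `M sin 2θ`.
  have key : 0 < Real.sin (2 * θ) → Real.sin (4 * M * θ) ≤ M * Real.sin (2 * θ) →
      (M : ℝ) / 4 ≤ s := by
    intro hpos hle
    by_contra hlt
    push Not at hlt
    have : 2 * Real.sin (2 * θ) * s < 2 * Real.sin (2 * θ) * (M / 4) :=
      mul_lt_mul_of_pos_left hlt (by linarith)
    nlinarith
  -- If `cos θ ≥ 1/2`, then `sin 2θ ≥ sin θ` and `M sin 2θ ≥ 1`. Otherwise almost everything is
  -- marked and `sin 2θ` may be small, so the distance `δ` of `θ` from `π/2` is used instead.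
  by_cases hc : 1 / 2 ≤ Real.cos θ
  · have h2 : Real.sin θ ≤ Real.sin (2 * θ) := by rw [Real.sin_two_mul]; nlinarith
    have hpos : 0 < Real.sin θ := by
      rcases hsin.eq_or_lt with h | h
      · rw [← h] at hM; simp at hM; linarith
      · exact h
    refine key (lt_of_lt_of_le hpos h2) ((Real.sin_le_one _).trans (hM.trans ?_))
    exact mul_le_mul_of_nonneg_left h2 hM0.le
  · push Not at hc
    set δ := Real.pi / 2 - θ with hδ
    have hθ : θ = Real.pi / 2 - δ := by rw [hδ]; ring
    rcases (show 0 ≤ δ by rw [hδ]; linarith).eq_or_lt with h | hδ0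
    · have : θ = Real.pi / 2 := by rw [hθ, ← h, sub_zero]
      rw [hs, this]
      simp_rw [sin_odd_mul_pi_div_two_sq]
      simp
      linarith
    · have hδ4 : δ ≤ Real.pi / 4 := by
        by_contra hlt
        push Not at hlt
        have h2 : Real.cos θ = Real.sin δ := by rw [hθ, Real.cos_pi_div_two_sub]
        have h3 : Real.sin (Real.pi / 4) ≤ Real.sin δ :=
          Real.sin_le_sin_of_le_of_le_pi_div_two (by linarith [Real.pi_pos]) (by linarith) hlt.le
        rw [Real.sin_pi_div_four] at h3
        have : (1 : ℝ) < Real.sqrt 2 := by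
          rw [Real.lt_sqrt (by norm_num)]; norm_num
        linarith
      have e2 : Real.sin (2 * θ) = Real.sin (2 * δ) := by
        rw [hθ, show 2 * (Real.pi / 2 - δ) = Real.pi - 2 * δ by ring, Real.sin_pi_sub]
      have e4 : Real.sin (4 * M * θ) = -Real.sin (4 * M * δ) := by
        rw [hθ, show 4 * (M : ℝ) * (Real.pi / 2 - δ) = M * (2 * Real.pi) - 4 * M * δ by ring,
          Real.sin_nat_mul_two_pi_sub]
      have hpos : 0 < Real.sin (2 * δ) :=
        Real.sin_pos_of_pos_of_lt_pi (by linarith) (by linarith [Real.pi_pos])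
      refine key (by rw [e2]; exact hpos) ?_
      rw [e2, e4]
      -- For small `4Mδ` the sign of `-sin(4Mδ)` is favourable; for large `4Mδ` Jordan's inequality
      -- gives `M sin 2δ ≥ 4Mδ/π ≥ 1`.
      by_cases h5 : 4 * M * δ ≤ Real.pi
      · have := Real.sin_nonneg_of_nonneg_of_le_pi (by positivity) h5
        have : 0 ≤ M * Real.sin (2 * δ) := by positivity
        linarith
      · push Not at h5
        have h6 := Real.mul_le_sin (x := 2 * δ) (by linarith) (by linarith)
        have h7 : (1 : ℝ) ≤ M * (2 / Real.pi * (2 * δ)) := by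
          rw [show (M : ℝ) * (2 / Real.pi * (2 * δ)) = 4 * M * δ / Real.pi by ring,
            le_div_iff₀ Real.pi_pos]
          linarith
        have h8 := mul_le_mul_of_nonneg_left h6 hM0.le
        linarith [Real.neg_one_le_sin (4 * M * δ)]

/-! ### One trial of exponential search -/

namespace Subroutine

theorem sqrtCeil_pos {N : ℕ} (hN : 0 < N) : 0 < sqrtCeil N := by
  rw [sqrtCeil, Nat.ceil_pos]
  exact Real.sqrt_pos.mpr (by exact_mod_cast hN)

theorem searchRange_pos {N : ℕ} (hN : 0 < N) (e : ℕ) : 0 < searchRange N e :=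
  lt_min (Nat.ceil_pos.mpr (by positivity)) (sqrtCeil_pos hN)

/-- Since `(6/5)⁴ > 2`, the growing range exceeds `√N` after `2⌈log₂ N⌉` failures. This number is
the length of the warm-up phase in the potential below. -/
theorem searchRange_eq {N e : ℕ} (he : 2 * Nat.clog 2 N ≤ e) : searchRange N e = sqrtCeil N := by
  refine min_eq_right (Nat.ceil_mono ?_)
  have h1 : Real.sqrt N ≤ ((6 : ℝ) / 5) ^ (2 * Nat.clog 2 N) := by
    rw [pow_mul]
    refine Real.sqrt_le_iff.mpr ⟨by positivity, ?_⟩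
    rw [← pow_mul, mul_comm, pow_mul]
    calc (N : ℝ) ≤ (2 : ℝ) ^ Nat.clog 2 N := by exact_mod_cast Nat.le_pow_clog (by norm_num) N
      _ ≤ _ := pow_le_pow_left₀ (by norm_num) (by norm_num) _
  exact h1.trans (pow_le_pow_right₀ (by norm_num) he)

/-- The success probability of one trial of exponential search, for `t` marked elements among
`n`. -/
def searchSuccess (N e t n : ℕ) : ℝ :=
  (∑ k ∈ Finset.range (searchRange N e), Real.sin ((2 * k + 1) * groverAngle t n) ^ 2)
    / searchRange N e

theorem searchSuccess_nonneg (N e t n : ℕ) : 0 ≤ searchSuccess N e t n := by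
  unfold searchSuccess; positivity

theorem searchSuccess_le_one (N e t n : ℕ) : searchSuccess N e t n ≤ 1 := by
  refine div_le_one_of_le₀ ?_ (by positivity)
  refine (Finset.sum_le_sum fun k _ => Real.sin_sq_le_one _).trans ?_
  simp

/-- With the full range, `⌈√N⌉ sin θ ≥ √(N t / n) ≥ 1`, which is the requirement of
`quarter_le_sum_sin_sq`. -/
theorem quarter_le_searchSuccess {N e t n : ℕ} (ht : 0 < t) (htn : t ≤ n) (hn : n ≤ N)
    (he : 2 * Nat.clog 2 N ≤ e) : 1 / 4 ≤ searchSuccess N e t n := by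
  have hN : 0 < N := by omega
  rw [searchSuccess, searchRange_eq he, le_div_iff₀ (by exact_mod_cast sqrtCeil_pos hN)]
  refine le_trans (by linarith) (quarter_le_sum_sin_sq (Real.arcsin_nonneg.mpr (Real.sqrt_nonneg _))
    (Real.arcsin_le_pi_div_two _) ?_)
  have hn0 : (0 : ℝ) < n := by exact_mod_cast (by omega : 0 < n)
  have h1 : Real.sqrt N ≤ sqrtCeil N := Nat.le_ceil _
  change 1 ≤ (sqrtCeil N : ℝ) * Real.sin (groverAngle t n)
  rw [sin_groverAngle htn]
  refine le_trans ?_ (mul_le_mul_of_nonneg_right h1 (Real.sqrt_nonneg _))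
  rw [← Real.sqrt_mul (Nat.cast_nonneg _), Real.one_le_sqrt, mul_div_assoc', le_div_iff₀ hn0,
    one_mul]
  have a1 : (1 : ℝ) ≤ t := by exact_mod_cast ht
  have a2 : (n : ℝ) ≤ N := by exact_mod_cast hn
  nlinarith

theorem sum_filter_val_lt {n M : ℕ} (h : M ≤ n) (g : ℕ → ℝ) :
    ∑ k ∈ Finset.univ.filter (fun k : Fin n => (k : ℕ) < M), g k = ∑ k ∈ Finset.range M, g k := by
  refine Finset.sum_bij (fun k _ => (k : ℕ)) (fun k hk => by simpa using hk)
    (fun a _ b _ hab => Fin.ext hab)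
    (fun b hb => ⟨⟨b, by have := Finset.mem_range.mp hb; omega⟩, by simpa using hb, rfl⟩)
    (fun _ _ => rfl)

open scoped Classical

variable {J A X : Type} [Fintype X]

theorem failure_mono {I : Type} (f : Subroutine I A) (i : I) {p q : A → Prop}
    (h : ∀ a, p a → q a) : f.failure i q ≤ f.failure i p := by
  refine expect_mono _ _ fun a => ?_
  by_cases hp : p a
  · simp [hp, h a hp]
  · simp only [hp, if_false]; split_ifs <;> norm_num

theorem failure_nonneg {I : Type} (f : Subroutine I A) (i : I) (p : A → Prop) :
    0 ≤ f.failure i p :=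
  expect_nonneg _ _ fun a => by split_ifs <;> norm_num

/-- If `g ≤ 1` is at most `c` on good outputs, its mean is at most `c` plus the failure
probability. -/
theorem expect_le_add_failure {I : Type} (f : Subroutine I A) (i : I) (good : A → Prop) {ε c : ℝ}
    (hf : f.failure i good ≤ ε) (hc : 0 ≤ c) {g : A → ℝ} (h1 : ∀ a, g a ≤ 1)
    (hg : ∀ a, good a → g a ≤ c) : f.expect i g ≤ c + ε := by
  have : f.expect i g ≤ f.expect i fun a => c + (if good a then 0 else 1) := by
    refine expect_mono _ _ fun a => ?_
    by_cases hp : good a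
    · simpa [hp] using hg a hp
    · simp only [hp, if_false]; linarith [h1 a]
  refine this.trans ?_
  rw [expect_add, expect_const]
  exact add_le_add_right hf c

/-- The error of one trial of exponential search caused by the failure probability `ε` of the
subroutine. -/
def trialError (N : ℕ) (ε : ℝ) : ℝ := 2 * (sqrtCeil N * Real.sqrt (8 * ε)) + 2 * ε

/-- In the ideal trial a success selects a uniformly random better candidate, and a failure keeps
the threshold and increments `e`. The error consists of the Grover drift and `2ε` for re-evaluating
the candidate and the threshold. If there is no better candidate, the success probability and the
average over the empty set are both zero. -/
theorem expect_trial_le (N : ℕ) (x₀ : X) (C : J → Finset X) (val : A → WithBot ℕ)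
    (f : Subroutine (J × X) A) (j : J) (thr : X) (e : ℕ) (V : X → WithBot ℕ) (ε : ℝ)
    (hf : ∀ x ∈ C j, f.failure (j, x) (fun a => val a = V x) ≤ ε) (hthr : thr ∈ C j)
    (hN : 0 < N) {G : X × ℕ → ℝ} (hG0 : ∀ s, 0 ≤ G s) (hG1 : ∀ s, G s ≤ 1) :
    (trial N x₀ C val f).expect (j, (thr, e)) G ≤
      searchSuccess N e ((C j).filter fun x => V thr < V x).card (C j).card
          * ((∑ x ∈ (C j).filter (fun x => V thr < V x), G (x, 0))
              / ((C j).filter fun x => V thr < V x).card)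
        + (1 - searchSuccess N e ((C j).filter fun x => V thr < V x).card (C j).card)
          * G (thr, e + 1)
        + trialError N ε := by
  have hC : (C j).Nonempty := ⟨thr, hthr⟩
  set t := ((C j).filter fun x => V thr < V x).card with ht
  set n := (C j).card with hn
  set M := searchRange N e with hM
  have hMle : M ≤ sqrtCeil N := min_le_right _ _
  have hM0 : 0 < M := searchRange_pos hN e
  have hM0' : (0 : ℝ) < M := by exact_mod_cast hM0
  have hε : 0 ≤ ε := (f.failure_nonneg _ _).trans (hf thr hthr)
  -- The value of `G` after a correct comparison. Off the candidates nothing is assumed about `f`,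
  -- so the trivial bound `1` is used; the ideal state has no mass there.
  set H : X → ℝ := fun x => if x ∈ C j then
    (if V thr < V x then G (x, 0) else G (thr, e + 1)) else 1 with hH
  have hH0 : ∀ x, 0 ≤ H x := fun x => by
    simp only [hH]; split_ifs <;> simp [hG0]
  have hH1 : ∀ x, H x ≤ 1 := fun x => by
    simp only [hH]; split_ifs <;> simp [hG1]
  have hinner : ∀ k : ℕ, (grover x₀ C val f).expect (j, (thr, k)) (fun x =>
      f.expect (j, x) fun a => f.expect (j, thr) fun b =>
        G (if val b < val a then (x, 0) else (thr, e + 1)))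
      ≤ (Real.sin ((2 * k + 1) * groverAngle t n) ^ 2
          * ((∑ x ∈ (C j).filter (fun x => V thr < V x), G (x, 0)) / t)
        + (1 - Real.sin ((2 * k + 1) * groverAngle t n) ^ 2) * G (thr, e + 1))
        + 2 * (k * Real.sqrt (8 * ε)) + 2 * ε := by
    intro k
    have s1 : (grover x₀ C val f).expect (j, (thr, k)) (fun x =>
      f.expect (j, x) fun a => f.expect (j, thr) fun b =>
        G (if val b < val a then (x, 0) else (thr, e + 1)))
        ≤ (grover x₀ C val f).expect (j, (thr, k)) (fun x => H x + 2 * ε) := by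
      refine expect_mono _ _ fun x => ?_
      have hle1 : ∀ a, (f.expect (j, thr) fun b =>
        G (if val b < val a then (x, 0) else (thr, e + 1))) ≤ 1 :=
          fun a => expect_le_of_le _ _ fun b => hG1 _
      by_cases hx : x ∈ C j
      · have h2 := expect_le_add_failure f (j, x) (fun a => val a = V x) (hf x hx)
          (c := H x + ε) (add_nonneg (hH0 x) hε)
          (g := fun a => min 1 (f.expect (j, thr) fun b =>
            G (if val b < val a then (x, 0) else (thr, e + 1)))) (fun a => min_le_left _ _)
          (fun a ha => (min_le_right _ _).trans
            (expect_le_add_failure f (j, thr) (fun b => val b = V thr) (hf thr hthr) (hH0 x)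
              (fun b => hG1 _) (fun b hb => by
                simp only [hH, hx, if_true, ha, hb]
                by_cases hlt : V thr < V x <;> simp [hlt])))
        have h3 : ∀ a, min 1 (f.expect (j, thr) fun b =>
            G (if val b < val a then (x, 0) else (thr, e + 1))) = f.expect (j, thr) fun b =>
            G (if val b < val a then (x, 0) else (thr, e + 1)) := fun a => min_eq_right (hle1 a)
        simp_rw [h3] at h2
        linarith
      · have : H x = 1 := by simp [hH, hx]
        rw [this]
        have := expect_le_of_le f (j, x) hle1
        linarith
    refine s1.trans ?_
    rw [expect_add, expect_const]
    have s2 := expect_grover_le x₀ C val f j thr V ε hf hthr k hH0 hH1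
    rw [sum_idealGrover hC, ← ht, ← hn] at s2
    have s3 : ∑ x ∈ (C j).filter (fun x => V thr < V x), H x
        = ∑ x ∈ (C j).filter (fun x => V thr < V x), G (x, 0) := by
      refine Finset.sum_congr rfl fun x hx => ?_
      rw [Finset.mem_filter] at hx
      simp [hH, hx.1, hx.2]
    -- Only an inequality: if every candidate is better than the threshold, the left side is `0/0 =
    -- 0`.
    have s4 : (∑ x ∈ (C j).filter (fun x => ¬ V thr < V x), H x) / ((n - t : ℕ) : ℝ)
        ≤ G (thr, e + 1) := by
      have : ∑ x ∈ (C j).filter (fun x => ¬ V thr < V x), H x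
        = ((n - t : ℕ) : ℝ) * G (thr, e + 1) := by
        have hcu : ((C j).filter fun x => ¬ V thr < V x).card = n - t := by
          have := Finset.card_filter_add_card_filter_not (s := C j) (fun x => V thr < V x)
          omega
        rw [← hcu, ← nsmul_eq_mul, ← Finset.sum_const]
        refine Finset.sum_congr rfl fun x hx => ?_
        rw [Finset.mem_filter] at hx
        simp only [hH, hx.1, hx.2, if_true, if_false]
      rw [this]
      rcases Nat.eq_zero_or_pos (n - t) with h | h
      · simp [h, hG0]
      · rw [mul_div_cancel_left₀]
        exact_mod_cast h.ne'
    rw [s3, Real.cos_sq'] at s2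
    have s5 : 0 ≤ 1 - Real.sin ((2 * k + 1) * groverAngle t n) ^ 2 := by
      linarith [Real.sin_sq_le_one ((2 * k + 1) * groverAngle t n)]
    have s6 := mul_le_mul_of_nonneg_left s4 s5
    linarith
  have houter : (trial N x₀ C val f).expect (j, (thr, e)) G
      = (∑ k ∈ Finset.range M, (grover x₀ C val f).expect (j, (thr, k)) (fun x =>
      f.expect (j, x) fun a => f.expect (j, thr) fun b =>
        G (if val b < val a then (x, 0) else (thr, e + 1)))) / M := by
    rw [trial, expect_bind, expect_sample]
    · simp_rw [expect_bind, expect_comap, expect_ret]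
      have hcard : ((Finset.univ.filter fun k : Fin (sqrtCeil N + 1) =>
          (k : ℕ) < searchRange N e).card : ℝ) = M := by
        have := sum_filter_val_lt (n := sqrtCeil N + 1) (M := M) (by omega) (fun _ => 1)
        simpa using this
      rw [hcard]
      congr 1
      exact sum_filter_val_lt (n := sqrtCeil N + 1) (M := M) (by omega)
        (fun k => (grover x₀ C val f).expect (j, (thr, k)) (fun x =>
          f.expect (j, x) fun a => f.expect (j, thr) fun b =>
          G (if val b < val a then (x, 0) else (thr, e + 1))))
    · exact ⟨0, by simpa using hM0⟩
  rw [houter, div_le_iff₀ hM0']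
  refine (Finset.sum_le_sum fun k _ => hinner k).trans ?_
  have hk : ∀ k ∈ Finset.range M, 2 * ((k : ℝ) * Real.sqrt (8 * ε)) + 2 * ε ≤ trialError N ε := by
    intro k hk
    have : (k : ℝ) ≤ sqrtCeil N := by
      exact_mod_cast (Finset.mem_range.mp hk).le.trans hMle
    unfold trialError
    have := mul_le_mul_of_nonneg_right this (Real.sqrt_nonneg (8 * ε))
    linarith
  have hsum := Finset.sum_le_sum hk
  rw [Finset.sum_const, Finset.card_range, nsmul_eq_mul] at hsum
  have hs : ∑ k ∈ Finset.range M, Real.sin ((2 * k + 1) * groverAngle t n) ^ 2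
      = searchSuccess N e t n * M := by
    rw [searchSuccess, div_mul_cancel₀ _ hM0'.ne']
  simp_rw [add_assoc]
  rw [Finset.sum_add_distrib, Finset.sum_add_distrib, ← Finset.sum_mul, ← Finset.sum_mul,
    Finset.sum_sub_distrib, hs, Finset.sum_const, Finset.card_range, nsmul_eq_mul]
  linarith

end Subroutine

end

end LongestTrail

namespace LongestTrail

noncomputable section

namespace Subroutine

open scoped Classical

/-! ### Dürr–Høyer maximum finding -/

section Potential

variable {X : Type}

/-- The number of candidates that are better than `x`. -/
def numBetter (C : Finset X) (V : X → WithBot ℕ) (x : X) : ℕ := (C.filter fun y => V x < V y).card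

theorem numBetter_le (C : Finset X) (V : X → WithBot ℕ) (x : X) : numBetter C V x ≤ C.card :=
  Finset.card_filter_le _ _

/-- On average the number of better candidates is halved by the choice of a random better one. -/
theorem two_mul_sum_numBetter_le (C : Finset X) (V : X → WithBot ℕ) (x : X) :
    2 * ∑ y ∈ C.filter (fun y => V x < V y), numBetter C V y ≤ numBetter C V x ^ 2 := by
  set D := C.filter fun y => V x < V y with hD
  have h1 : ∀ y ∈ D, numBetter C V y = ∑ z ∈ D, if V y < V z then 1 else 0 := by
    intro y hy
    rw [← Finset.card_filter, numBetter]
    congr 1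
    ext z
    have hy' := (Finset.mem_filter.mp hy).2
    simp only [hD, Finset.mem_filter]
    exact ⟨fun h => ⟨⟨h.1, hy'.trans h.2⟩, h.2⟩, fun h => ⟨h.1.1, h.2⟩⟩
  rw [Finset.sum_congr rfl h1, two_mul]
  -- Exchanging the roles of `y` and `z` in one copy pairs `V y < V z` with `V z < V y`; at most one
  -- of them holds, so the total is at most `|D|²`.
  nth_rewrite 2 [Finset.sum_comm]
  rw [← Finset.sum_add_distrib]
  have h2 : ∀ y ∈ D, (∑ z ∈ D, if V y < V z then 1 else 0) + (∑ z ∈ D, if V z < V y then 1 else 0)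
      ≤ D.card := by
    intro y _
    rw [← Finset.sum_add_distrib, Finset.card_eq_sum_ones]
    refine Finset.sum_le_sum fun z _ => ?_
    by_cases h : V y < V z
    · simp [h, h.not_gt]
    · simp only [h, if_false]; split_ifs <;> norm_num
  refine (Finset.sum_le_sum h2).trans_eq ?_
  rw [Finset.sum_const, smul_eq_mul, sq]
  rfl

/-- The rate at which the potential of Dürr–Høyer maximum finding decreases. -/
def decayRate (N : ℕ) : ℝ := 1 - 1 / (6 * (Nat.clog 2 N + 3))

theorem decayRate_le (N : ℕ) : decayRate N ≤ 1 := by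
  have : (0 : ℝ) ≤ 1 / (6 * (Nat.clog 2 N + 3)) := by positivity
  unfold decayRate; linarith

theorem le_decayRate (N : ℕ) : 17 / 18 ≤ decayRate N := by
  have h : (1 : ℝ) / (6 * (Nat.clog 2 N + 3)) ≤ 1 / 18 := by
    apply one_div_le_one_div_of_le (by norm_num)
    have : (0 : ℝ) ≤ Nat.clog 2 N := by positivity
    linarith
  unfold decayRate; linarith

theorem decayRate_pos (N : ℕ) : 0 < decayRate N := by linarith [le_decayRate N]

/-- Bernoulli's inequality: `1 - 2L/(6(L+3)) ≥ 2/3`. Resetting `e` thus costs a factor at most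
`3/2`, less than the factor `2` gained by halving the number of better candidates. -/
theorem inv_decayRate_pow_le (N : ℕ) : (decayRate N)⁻¹ ^ (2 * Nat.clog 2 N) ≤ 3 / 2 := by
  have h := one_add_mul_le_pow (a := -(1 / (6 * ((Nat.clog 2 N : ℝ) + 3))))
    (by have := le_decayRate N; unfold decayRate at this; linarith) (2 * Nat.clog 2 N)
  have h2 : (2 : ℝ) / 3 ≤ decayRate N ^ (2 * Nat.clog 2 N) := by
    refine le_trans ?_ h
    have hL : (0 : ℝ) ≤ Nat.clog 2 N := by positivity
    have : ((2 * Nat.clog 2 N : ℕ) : ℝ) * (1 / (6 * ((Nat.clog 2 N : ℝ) + 3))) ≤ 1 / 3 := by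
      push_cast
      rw [mul_one_div, div_le_iff₀ (by positivity)]
      linarith
    linarith
  rw [inv_pow]
  exact (inv_anti₀ (by norm_num) h2).trans_eq (by norm_num)

/-- With `16(L+3)²` trials the decay is at most `exp(-(8/3)(L+3)) ≤ 14^(-(L+3))`, which absorbs the
initial potential `(3/2)N ≤ (3/2)2^L`. -/
theorem decayRate_pow_le {N : ℕ} :
    decayRate N ^ numTrials N * (N * (3 / 2)) ≤ (1 / 2) ^ 10 := by
  set L := Nat.clog 2 N with hL
  have h14 : (14 : ℝ) ≤ Real.exp (8 / 3) := by
    refine le_of_pow_le_pow_left₀ three_ne_zero (Real.exp_pos _).le ?_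
    rw [← Real.exp_nat_mul]
    have : ((3 : ℕ) : ℝ) * (8 / 3) = (8 : ℕ) * 1 := by norm_num
    rw [this, Real.exp_nat_mul]
    refine le_trans ?_ (pow_le_pow_left₀ (by norm_num)
      (Real.exp_one_gt_d9.le.trans' (by norm_num : (2.7182 : ℝ) ≤ 2.7182818283)) 8)
    norm_num
  have h1 : decayRate N ≤ Real.exp (-(1 / (6 * ((L : ℝ) + 3)))) := by
    have := Real.add_one_le_exp (-(1 / (6 * ((L : ℝ) + 3))))
    unfold decayRate; linarith
  have h2 : decayRate N ^ numTrials N ≤ (1 / 14) ^ (L + 3) := by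
    refine (pow_le_pow_left₀ (decayRate_pos N).le h1 _).trans ?_
    rw [← Real.exp_nat_mul]
    have e : ((numTrials N : ℕ) : ℝ) * -(1 / (6 * ((L : ℝ) + 3)))
        = ((L + 3 : ℕ) : ℝ) * (-(8 / 3)) := by
      have : (L : ℝ) + 3 ≠ 0 := by positivity
      rw [numTrials]
      push_cast
      field_simp
      ring
    rw [e, Real.exp_nat_mul, Real.exp_neg]
    refine pow_le_pow_left₀ (by positivity) ?_ _
    rw [one_div]
    exact inv_anti₀ (by norm_num) h14
  have h3 : (N : ℝ) ≤ 2 ^ L := by exact_mod_cast Nat.le_pow_clog (by norm_num) N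
  calc _ ≤ (1 / 14 : ℝ) ^ (L + 3) * (2 ^ L * (3 / 2)) := by gcongr
    _ = (1 / 7 : ℝ) ^ L * ((1 / 14) ^ 3 * (3 / 2)) := by
      rw [pow_add, show (1 / 7 : ℝ) = 1 / 14 * 2 by norm_num, mul_pow]; ring
    _ ≤ 1 * ((1 / 14) ^ 3 * (3 / 2)) := by
      refine mul_le_mul_of_nonneg_right (pow_le_one₀ (by norm_num) (by norm_num)) (by norm_num)
    _ ≤ _ := by norm_num

/-- The truncated potential of the state `(x, e)` of Dürr–Høyer maximum finding. -/
def potential (N : ℕ) (C : Finset X) (V : X → WithBot ℕ) (c : ℝ) (s : X × ℕ) : ℝ :=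
  if s.1 ∈ C then
    min 1 (c * (numBetter C V s.1 * (decayRate N)⁻¹ ^ (2 * Nat.clog 2 N - s.2)))
  else 1

theorem potential_nonneg (N : ℕ) (C : Finset X) (V : X → WithBot ℕ) {c : ℝ} (hc : 0 ≤ c)
    (s : X × ℕ) : 0 ≤ potential N C V c s := by
  have := decayRate_pos N
  unfold potential
  split_ifs
  · exact le_min zero_le_one (by positivity)
  · exact zero_le_one

theorem potential_le_one (N : ℕ) (C : Finset X) (V : X → WithBot ℕ) (c : ℝ) (s : X × ℕ) :
    potential N C V c s ≤ 1 := by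
  unfold potential
  split_ifs
  · exact min_le_left _ _
  · exact le_rfl

end Potential

variable {J A X : Type} [Fintype X]

theorem trialError_nonneg (N : ℕ) {ε : ℝ} (hε : 0 ≤ ε) : 0 ≤ trialError N ε := by
  unfold trialError; positivity

/-- During the warm-up, `e < 2L`, a failure shortens the remaining clock and thereby gains exactly
one factor `decayRate`, whatever the success probability is. Afterwards a success has probability at
least `1/4` and reduces the potential on average to at most `3/4`, so the mean factor is at most
`15/16 < 17/18`. -/
theorem expect_trial_potential_le (N : ℕ) (x₀ : X) (C : J → Finset X) (val : A → WithBot ℕ)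
    (f : Subroutine (J × X) A) (j : J) (V : X → WithBot ℕ) {ε : ℝ} (hε : 0 ≤ ε)
    (hf : ∀ x ∈ C j, f.failure (j, x) (fun a => val a = V x) ≤ ε)
    (hN : (C j).card ≤ N) {c : ℝ} (hc : 0 ≤ c) (s : X × ℕ) :
    (trial N x₀ C val f).expect (j, s) (potential N (C j) V c)
      ≤ potential N (C j) V (c * decayRate N) s + trialError N ε := by
  obtain ⟨thr, e⟩ := s
  have hτ := trialError_nonneg N hε
  have hone : (trial N x₀ C val f).expect (j, (thr, e)) (potential N (C j) V c) ≤ 1 :=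
    expect_le_of_le _ _ fun s => potential_le_one _ _ _ _ _
  by_cases hthr : thr ∈ C j
  swap
  · have : potential N (C j) V (c * decayRate N) (thr, e) = 1 := by simp [potential, hthr]
    linarith
  have hN0 : 0 < N := (Finset.card_pos.mpr ⟨thr, hthr⟩).trans_le hN
  have hmain := expect_trial_le N x₀ C val f j thr e V ε hf hthr hN0
    (G := potential N (C j) V c) (potential_nonneg _ _ _ hc) (potential_le_one _ _ _ _)
  set W := 2 * Nat.clog 2 N with hW
  set μ := (decayRate N)⁻¹ with hμ
  have hlam := decayRate_pos N
  have hμ0 : 0 < μ := inv_pos.mpr hlam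
  have hμ1 : 1 ≤ μ := one_le_inv₀ hlam |>.mpr (decayRate_le N)
  have hμW : μ ^ W ≤ 3 / 2 := inv_decayRate_pow_le N
  set t := numBetter (C j) V thr with ht
  change _ ≤ searchSuccess N e t (C j).card * ((∑ x ∈ (C j).filter (fun x => V thr < V x),
    potential N (C j) V c (x, 0)) / (t : ℕ)) + (1 - searchSuccess N e t (C j).card)
      * potential N (C j) V c (thr, e + 1) + trialError N ε at hmain
  set p := searchSuccess N e t (C j).card with hp
  have hp0 : 0 ≤ p := searchSuccess_nonneg _ _ _ _
  have hp1 : p ≤ 1 := searchSuccess_le_one _ _ _ _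
  have hsum : (∑ x ∈ (C j).filter (fun x => V thr < V x), potential N (C j) V c (x, 0)) / (t : ℕ)
      ≤ c * (t / 2 * μ ^ W) := by
    have h1 : ∑ x ∈ (C j).filter (fun x => V thr < V x), potential N (C j) V c (x, 0)
        ≤ ∑ x ∈ (C j).filter (fun x => V thr < V x), c * (numBetter (C j) V x * μ ^ W) := by
      refine Finset.sum_le_sum fun x hx => ?_
      rw [potential, if_pos (Finset.mem_filter.mp hx).1]
      exact min_le_right _ _
    rw [← Finset.mul_sum, ← Finset.sum_mul] at h1
    have h2 : (2 : ℝ) * ∑ x ∈ (C j).filter (fun x => V thr < V x), (numBetter (C j) V x : ℝ)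
        ≤ (t : ℝ) ^ 2 := by exact_mod_cast two_mul_sum_numBetter_le (C j) V thr
    refine div_le_of_le_mul₀ (by positivity) (by positivity) (h1.trans ?_)
    rw [show c * ((t : ℝ) / 2 * μ ^ W) * t = c * ((t : ℝ) ^ 2 / 2 * μ ^ W) by ring]
    gcongr
    linarith
  have hfail : potential N (C j) V c (thr, e + 1) ≤ c * (t * μ ^ (W - (e + 1))) := by
    rw [potential, if_pos hthr]
    exact min_le_right _ _
  have hstep : p * (c * (t / 2 * μ ^ W)) + (1 - p) * (c * (t * μ ^ (W - (e + 1))))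
      ≤ c * decayRate N * (t * μ ^ (W - e)) := by
    have hct : 0 ≤ c * t := by positivity
    -- The factor `t` has been divided out. If `t = 0` the threshold is already best and both sides
    -- vanish, although the success bound would not apply.
    have key : t = 0 ∨ p * (1 / 2 * μ ^ W) + (1 - p) * μ ^ (W - (e + 1))
        ≤ decayRate N * μ ^ (W - e) := by
      by_cases he : e < W
      · right
        have e1 : W - e = (W - (e + 1)) + 1 := by omega
        have e2 : decayRate N * μ ^ (W - e) = μ ^ (W - (e + 1)) := by
          rw [e1, pow_succ, hμ]
          field_simp
        rw [e2]
        have h1 : 1 ≤ μ ^ (W - (e + 1)) := one_le_pow₀ hμ1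
        nlinarith
      · rcases Nat.eq_zero_or_pos t with h | h
        · exact Or.inl h
        · right
          have hq : 1 / 4 ≤ p :=
            quarter_le_searchSuccess h (numBetter_le _ _ _) hN (by omega)
          have e1 : W - e = 0 := by omega
          have e2 : W - (e + 1) = 0 := by omega
          rw [e1, e2, pow_zero, mul_one, mul_one]
          have := le_decayRate N
          nlinarith
    rcases key with h | h
    · simp [h]
    · have := mul_le_mul_of_nonneg_left h hct
      linarith
  have h1 := mul_le_mul_of_nonneg_left hsum hp0
  have h2 := mul_le_mul_of_nonneg_left hfail (sub_nonneg.mpr hp1)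
  have hval : potential N (C j) V (c * decayRate N) (thr, e)
      = min 1 (c * decayRate N * (t * μ ^ (W - e))) := by
    rw [potential, if_pos hthr]
  -- The truncation at `1` costs nothing, since any expectation of the potential is at most `1`.
  rw [hval, ← min_add_add_right]
  exact le_min (by linarith) (by linarith)

/-- Dürr–Høyer maximum finding returns a candidate except with a small probability, and a best
candidate except with probability `2⁻¹⁰` and a small probability. The small probability is the one
of a candidate having been lost through failures of the subroutine `f`. -/
theorem expect_durrHoyer_le (N : ℕ) (x₀ : X) (C : J → Finset X) (val : A → WithBot ℕ)
    (f : Subroutine (J × X) A) (j : J) (V : X → WithBot ℕ) {ε : ℝ} (hε : 0 ≤ ε)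
    (hf : ∀ x ∈ C j, f.failure (j, x) (fun a => val a = V x) ≤ ε)
    (hC : (C j).Nonempty) (hN : (C j).card ≤ N) {c : ℝ} (hc : 0 ≤ c) (hc1 : c ≤ 1) :
    (durrHoyer N x₀ C val f).expect j (fun x =>
        if x ∈ C j then (if ∀ y ∈ C j, V y ≤ V x then 0 else c) else 1)
      ≤ c * (1 / 2) ^ 10 + numTrials N * trialError N ε := by
  set T := numTrials N with hT
  set u : X → ℝ := fun x => if x ∈ C j then (if ∀ y ∈ C j, V y ≤ V x then 0 else c) else 1 with hu
  have hlam := decayRate_pos N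
  have h1 : ∀ s : X × ℕ, u s.1 ≤ potential N (C j) V c s := by
    intro s
    have hnn := potential_nonneg N (C j) V hc s
    simp only [hu]
    split_ifs with h2 h3
    · exact hnn
    · rw [potential, if_pos h2]
      push Not at h3
      obtain ⟨y, hy, hlt⟩ := h3
      have ht : (1 : ℝ) ≤ numBetter (C j) V s.1 := by
        exact_mod_cast Finset.card_pos.mpr ⟨y, Finset.mem_filter.mpr ⟨hy, hlt⟩⟩
      have hμ : (1 : ℝ) ≤ (decayRate N)⁻¹ ^ (2 * Nat.clog 2 N - s.2) :=
        one_le_pow₀ (one_le_inv₀ hlam |>.mpr (decayRate_le N))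
      refine le_min hc1 (le_mul_of_one_le_right hc ?_)
      nlinarith
    · rw [potential, if_neg h2]
  have h2 : ∀ x ∈ C j, ((trial N x₀ C val f).iterate T).expect (j, (x, 0)) (fun s => u s.1)
      ≤ c * (1 / 2) ^ 10 + T * trialError N ε := by
    intro x hx
    refine (expect_mono _ _ h1).trans ?_
    -- The test function is pulled back through the trials: weight `c` after the last one becomes `c
    -- * decayRate N ^ T` at the start.
    have := expect_iterate_le (trial N x₀ C val f) j
      (fun k => potential N (C j) V (c * decayRate N ^ k)) (trialError N ε)
      (fun k s => by
        have := expect_trial_potential_le N x₀ C val f j V hε hf hN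
          (c := c * decayRate N ^ k) (by positivity) s
        rwa [mul_assoc, ← pow_succ] at this) T 0 (x, 0)
    simp only [pow_zero, mul_one, zero_add] at this
    refine this.trans (add_le_add_left ?_ _)
    rw [potential, if_pos hx]
    refine (min_le_right _ _).trans ?_
    have h3 := decayRate_pow_le (N := N)
    have h4 : (numBetter (C j) V x : ℝ) ≤ N := by exact_mod_cast (numBetter_le _ _ _).trans hN
    have h5 := inv_decayRate_pow_le N
    calc c * decayRate N ^ T * (numBetter (C j) V x * (decayRate N)⁻¹ ^ (2 * Nat.clog 2 N - 0))
        ≤ c * decayRate N ^ T * (N * (3 / 2)) := by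
          rw [Nat.sub_zero]
          gcongr
      _ = c * (decayRate N ^ T * (N * (3 / 2))) := by ring
      _ ≤ _ := by gcongr
  rw [durrHoyer, expect_bind, expect_bind]
  simp_rw [expect_ret, expect_comap]
  rw [expect_sample _ _ _ hC, div_le_iff₀ (by exact_mod_cast hC.card_pos)]
  refine (Finset.sum_le_sum fun x hx => h2 x hx).trans_eq ?_
  rw [Finset.sum_const, nsmul_eq_mul, mul_comm]

/-! ### Boosted maximum finding -/

/-- A bound for the failure probability of boosted maximum finding with `r` repetitions over at
most `N` candidates, when the subroutine fails with probability at most `ε`. -/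
def maxError (r N : ℕ) (ε : ℝ) : ℝ :=
  ((1 / 2) ^ 10) ^ r + r * (numTrials N * trialError N ε + ε)

/-- Progress and corruption are tracked together. The test function is `1` once the stored result is
incorrect, `0` once it is correct and optimal, and `q^k` otherwise, where `q = 2⁻¹⁰`. The invariant
is essential: a wrong but large value would never be replaced by a correct smaller one. Correctness
is a relation `good`, because several best paths may exist; only their value is determined. -/
theorem failure_qmax_le (r N : ℕ) (x₀ : X) (a₀ : A) (C : J → Finset X) (val : A → WithBot ℕ)
    (f : Subroutine (J × X) A) (j : J) (good : X → A → Prop) {ε : ℝ} (hε : 0 ≤ ε)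
    (hf : ∀ x ∈ C j, f.failure (j, x) (good x) ≤ ε)
    (hgood : ∀ x ∈ C j, ∀ a b, good x a → good x b → val a = val b)
    (hC : (C j).Nonempty) (hN : (C j).card ≤ N) :
    (qmax r N x₀ a₀ C val f).failure j (fun a =>
        (a = a₀ ∨ ∃ x ∈ C j, good x a) ∧ ∀ x ∈ C j, ∀ b, good x b → val b ≤ val a)
      ≤ maxError r N ε := by
  -- `V x` is the common value of all good outputs at `x`; `⊥` is a dummy for candidates without
  -- any.
  obtain ⟨V, hV⟩ : ∃ V : X → WithBot ℕ, ∀ x ∈ C j, ∀ a, good x a → val a = V x := by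
    refine ⟨fun x => if h : ∃ a, good x a then val h.choose else ⊥, fun x hx a ha => ?_⟩
    have h : ∃ a, good x a := ⟨a, ha⟩
    simp only [h, dif_pos]
    exact hgood x hx _ _ ha h.choose_spec
  have hfV : ∀ x ∈ C j, f.failure (j, x) (fun a => val a = V x) ≤ ε :=
    fun x hx => (f.failure_mono _ (hV x hx)).trans (hf x hx)
  set inv : A → Prop := fun a => a = a₀ ∨ ∃ x ∈ C j, good x a with hinv
  set done : A → Prop := fun a => ∀ x ∈ C j, ∀ b, good x b → val b ≤ val a with hdone
  set q : ℝ := (1 / 2) ^ 10 with hq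
  have hq0 : 0 ≤ q := by rw [hq]; norm_num
  have hq1 : q ≤ 1 := by rw [hq]; norm_num
  set τ : ℝ := numTrials N * trialError N ε + ε with hτ
  have hτ0 : 0 ≤ τ := by
    have := trialError_nonneg N hε
    positivity
  set h : ℕ → A → ℝ := fun k a => if inv a then (if done a then 0 else q ^ k) else 1 with hh
  have h1 : ∀ k a, h k a ≤ 1 := fun k a => by
    simp only [hh]
    split_ifs
    · norm_num
    · exact pow_le_one₀ hq0 hq1
    · norm_num
  set run : Subroutine (J × A) A :=
    ((durrHoyer N x₀ C val f).comap fun t : J × A => t.1).bind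
    ((f.comap fun t : (J × A) × X => (t.1.1, t.2)).bind
    (ret fun t : ((J × A) × X) × A => if val t.1.1.2 < val t.2 then t.2 else t.1.1.2)) with hrun
  have hstep : ∀ k a, run.expect (j, a) (h k) ≤ h (k + 1) a + τ := by
    intro k a
    by_cases ha : inv a
    swap
    · have : h (k + 1) a = 1 := by simp [hh, ha]
      rw [this]
      linarith [run.expect_le_of_le (j, a) (h1 k)]
    -- Weight zero once an optimum is stored: then only the loss of correctness matters, not whether
    -- the new run succeeds.
    set c : ℝ := if done a then 0 else q ^ k with hc
    have hc0 : 0 ≤ c := by rw [hc]; split_ifs <;> positivity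
    have hc1 : c ≤ 1 := by
      rw [hc]; split_ifs
      · norm_num
      · exact pow_le_one₀ hq0 hq1
    set u : X → ℝ := fun x => if x ∈ C j then (if ∀ y ∈ C j, V y ≤ V x then 0 else c) else 1 with hu
    have hu0 : ∀ x, 0 ≤ u x := fun x => by
      simp only [hu]; split_ifs <;> first | exact le_rfl | exact hc0 | exact zero_le_one
    have hx : ∀ x, (f.expect (j, x) fun b => h k (if val a < val b then b else a)) ≤ u x + ε := by
      intro x
      by_cases hxC : x ∈ C j
      · refine expect_le_add_failure f (j, x) (good x) (hf x hxC) (hu0 x) (fun b => h1 k _) ?_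
        intro b hb
        have hmax : val a ≤ val (if val a < val b then b else a) ∧
            val b ≤ val (if val a < val b then b else a) := by
          by_cases hlt : val a < val b
          · simp [hlt, hlt.le]
          · simp [hlt, not_lt.mp hlt]
        have hinv' : inv (if val a < val b then b else a) := by
          by_cases hlt : val a < val b
          · rw [if_pos hlt]; exact Or.inr ⟨x, hxC, hb⟩
          · rw [if_neg hlt]; exact ha
        simp only [hh, hinv', if_true]
        by_cases hd : done (if val a < val b then b else a)
        · rw [if_pos hd]; exact hu0 x
        · rw [if_neg hd]
          have hda : ¬ done a := fun hda => hd fun y hy b' hb' => (hda y hy b' hb').trans hmax.1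
          have hxm : ¬ ∀ y ∈ C j, V y ≤ V x := fun hm => hd fun y hy b' hb' => by
            rw [hV y hy b' hb']
            refine (hm y hy).trans ?_
            rw [← hV x hxC b hb]
            exact hmax.2
          simp only [hu, hxC, if_true, hxm, if_false, hc, hda]
          exact le_rfl
      · have : u x = 1 := by simp [hu, hxC]
        rw [this]
        linarith [f.expect_le_of_le (j, x) (g := fun b => h k (if val a < val b then b else a))
          (fun b => h1 k _)]
    have hexp : run.expect (j, a) (h k) = (durrHoyer N x₀ C val f).expect j fun x =>
        f.expect (j, x) fun b => h k (if val a < val b then b else a) := by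
      rw [hrun, expect_bind]
      simp_rw [expect_bind, expect_ret, expect_comap]
    rw [hexp]
    refine (expect_mono _ _ hx).trans ?_
    rw [expect_add, expect_const]
    have hdh := expect_durrHoyer_le N x₀ C val f j V hε hfV hC hN hc0 hc1
    have hval : h (k + 1) a = c * (1 / 2) ^ 10 := by
      simp only [hh, ha, if_true, hc]
      split_ifs
      · simp
      · rw [pow_succ]
    rw [hval]
    linarith
  have hit := run.expect_iterate_le j h τ hstep r 0 a₀
  have hfin : (qmax r N x₀ a₀ C val f).failure j (fun a => inv a ∧ done a)
      = (run.iterate r).expect (j, a₀) (h 0) := by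
    have : ∀ a, (if inv a ∧ done a then (0 : ℝ) else 1) = h 0 a := by
      intro a
      by_cases h2 : inv a <;> by_cases h3 : done a <;> simp [hh, h2, h3]
    rw [failure]
    refine (congrArg ((qmax r N x₀ a₀ C val f).expect j)
      (funext fun a => (?_ : _ = h 0 a))).trans ?_
    · rw [← this]
      congr
    · rw [qmax, expect_comap]
  refine hfin.trans_le (hit.trans ?_)
  rw [maxError, zero_add]
  refine add_le_add_left ?_ _
  have : inv a₀ := Or.inl rfl
  simp only [hh, this, if_true]
  split_ifs
  · positivity
  · exact le_rfl

end Subroutine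

end

end LongestTrail

namespace LongestTrail

noncomputable section

open scoped Classical

/-! ### Trails with prescribed first and last edge -/

/-- `l` is an edge-simple path inside `S` from the edge `v` to the edge `u`. -/
structure IsTrail {m : ℕ} (adj : Fin m → Fin m → Prop) (S : Finset (Fin m)) (v u : Fin m)
    (l : List (Fin m)) : Prop where
  nodup : l.Nodup
  chain : l.IsChain adj
  subset : ∀ x ∈ l, x ∈ S
  head : l.head? = some v
  last : l.getLast? = some u

/-- `r` is a correct value of `F(S, v, u)`. -/
def IsBest {m : ℕ} (adj : Fin m → Fin m → Prop) (S : Finset (Fin m)) (v u : Fin m)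
    (r : Entry m) : Prop :=
  (∀ l, r = some l → IsTrail adj S v u l.1) ∧
    ∀ l, IsTrail adj S v u l → ((l.length : ℕ) : WithBot ℕ) ≤ r.len

section Trails

variable {m : ℕ} {adj : Fin m → Fin m → Prop} {S : Finset (Fin m)} {v u y : Fin m}

theorem IsTrail.ne_nil {l : List (Fin m)} (h : IsTrail adj S v u l) : l ≠ [] := by
  rintro rfl
  simpa using h.head

theorem IsTrail.fst_mem {l : List (Fin m)} (h : IsTrail adj S v u l) : v ∈ S :=
  h.subset v (List.mem_of_mem_head? h.head)

theorem IsTrail.snd_mem {l : List (Fin m)} (h : IsTrail adj S v u l) : u ∈ S :=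
  h.subset u (List.mem_of_getLast? h.last)

theorem IsBest.len_le {r r' : Entry m} (h : IsBest adj S v u r) (h' : IsBest adj S v u r') :
    r.len ≤ r'.len := by
  cases r with
  | none => exact bot_le
  | some l => exact h'.2 _ (h.1 l rfl)

/-- Duplicate-free lists over `Fin m` form a finite type, and `none` is always admissible, so a
maximum exists. -/
theorem exists_isBest (adj : Fin m → Fin m → Prop) (S : Finset (Fin m)) (v u : Fin m) :
    ∃ r, IsBest adj S v u r := by
  obtain ⟨r, hr, hmax⟩ := Set.exists_max_image
    {r : Entry m | ∀ l, r = some l → IsTrail adj S v u l.1} Entry.len (Set.toFinite _)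
    ⟨none, fun l hl => by cases hl⟩
  refine ⟨r, hr, fun l hl => ?_⟩
  exact hmax (some ⟨l, hl.nodup⟩) fun l' hl' => by
    cases hl'; exact hl

theorem isBest_none_of_notMem (h : ¬ (v ∈ S ∧ u ∈ S)) : IsBest adj S v u none :=
  ⟨fun l hl => by (cases hl), fun _ hl => (h ⟨hl.fst_mem, hl.snd_mem⟩).elim⟩

theorem Entry.exists_of_len_ge {r : Entry m} {n : ℕ} (h : (n : WithBot ℕ) ≤ r.len) :
    ∃ l, r = some l ∧ n ≤ l.1.length := by
  cases r with
  | none => simp [Entry.len] at h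
  | some l => exact ⟨l, rfl, by simpa [Entry.len] using h⟩

/-- Trails that meet in the edge `y` only can be concatenated. -/
theorem IsTrail.join {S' : Finset (Fin m)} (hS' : S' ⊆ S) (hy : y ∈ S') {l l' : List (Fin m)}
    (h : IsTrail adj S' v y l) (h' : IsTrail adj (insert y (S \ S')) y u l') :
    IsTrail adj S v u (l ++ l'.tail) := by
  obtain ⟨t, rfl⟩ : ∃ t, l' = y :: t := by
    cases l' with
    | nil => exact absurd rfl h'.ne_nil
    | cons a t => have := h'.head; simp at this; exact ⟨t, by rw [this]⟩
  have hnd := List.nodup_cons.mp h'.nodup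
  have ht : ∀ x ∈ t, x ∈ S \ S' := fun x hx => by
    have := h'.subset x (List.mem_cons_of_mem _ hx)
    rw [Finset.mem_insert] at this
    rcases this with rfl | h1
    · exact absurd hx hnd.1
    · exact h1
  rw [List.tail_cons]
  refine ⟨?_, ?_, ?_, ?_, ?_⟩
  · refine List.nodup_append.mpr ⟨h.nodup, hnd.2, fun a ha b hb hab => ?_⟩
    exact (Finset.mem_sdiff.mp (ht b hb)).2 (hab ▸ h.subset a ha)
  · refine List.isChain_append.mpr ⟨h.chain, h'.chain.tail, fun a ha b hb => ?_⟩
    have : a = y := by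
      have := h.last ▸ ha
      simpa using this.symm
    subst this
    exact (List.isChain_cons.mp h'.chain).1 b hb
  · intro x hx
    rcases List.mem_append.mp hx with hx | hx
    · exact hS' (h.subset x hx)
    · exact (Finset.mem_sdiff.mp (ht x hx)).1
  · rw [List.head?_append_of_ne_nil _ h.ne_nil, h.head]
  · have h1 := h'.last
    rw [List.getLast?_append, h.last]
    cases t with
    | nil => simpa using h1
    | cons a t => rw [List.getLast?_cons_cons] at h1; rw [h1]; rfl

/-- A trail in `S` splits into trails in `S'` and in `(S \ S') ∪ {y}` for some `S' ⊆ S` of size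
`k`. -/
theorem IsTrail.split {l : List (Fin m)} (h : IsTrail adj S v u l) {k : ℕ} (hk : 1 ≤ k)
    (hkS : k ≤ S.card) :
    ∃ (S' : Finset (Fin m)) (y : Fin m) (l₁ l₂ : List (Fin m)), (S', y) ∈ splits k S ∧
      IsTrail adj S' v y l₁ ∧ IsTrail adj (insert y (S \ S')) y u l₂ ∧
      l₁.length + l₂.length = l.length + 1 := by
  have hne : l.take k ≠ [] := by
    have := List.length_pos_iff.mpr h.ne_nil
    intro h0
    have h1 := congrArg List.length h0
    simp only [List.length_take, List.length_nil] at h1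
    omega
  have happ := List.take_append_drop k l
  have hnd : (l.take k ++ l.drop k).Nodup := by rw [happ]; exact h.nodup
  have hch : (l.take k ++ l.drop k).IsChain adj := by rw [happ]; exact h.chain
  rw [List.nodup_append] at hnd
  rw [List.isChain_append] at hch
  have hsub : (l.take k).toFinset ⊆ S := fun x hx =>
    h.subset x (List.mem_of_mem_take (List.mem_toFinset.mp hx))
  have hcard : (l.take k).toFinset.card = min k l.length := by
    rw [List.toFinset_card_of_nodup hnd.1, List.length_take]
  -- A trail shorter than `k` leaves room in `S'`, which is padded with arbitrary elements of `S`.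
  -- This is harmless because the rest of the trail is then empty; otherwise `S'` is exactly the
  -- prefix.
  obtain ⟨S', h1, h2, h3⟩ := Finset.exists_subsuperset_card_eq hsub
    (by rw [hcard]; exact min_le_left _ _) hkS
  have hlast : (l.take k).getLast? = some ((l.take k).getLast hne) :=
    List.getLast?_eq_some_getLast hne
  set y := (l.take k).getLast hne with hy
  have hyS : y ∈ S' := h1 (List.mem_toFinset.mpr (List.getLast_mem hne))
  have hdrop : ∀ x ∈ l.drop k, x ∈ S \ S' := by
    intro x hx
    refine Finset.mem_sdiff.mpr ⟨h.subset x (List.mem_of_mem_drop hx), fun hxS => ?_⟩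
    have hlen : k < l.length := by
      by_contra hle
      rw [List.drop_eq_nil_of_le (by omega)] at hx
      simp at hx
    have : (l.take k).toFinset = S' := Finset.eq_of_subset_of_card_le h1 (by rw [hcard, h3]; omega)
    rw [← this, List.mem_toFinset] at hxS
    exact hnd.2.2 x hxS x hx rfl
  refine ⟨S', y, l.take k, y :: l.drop k, ?_, ⟨hnd.1, hch.1, ?_, ?_, hlast⟩,
    ⟨?_, ?_, ?_, rfl, ?_⟩, ?_⟩
  · simp only [splits, Finset.mem_filter, Finset.mem_univ, true_and]
    exact ⟨h2, h3, hyS⟩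
  · exact fun x hx => h1 (List.mem_toFinset.mpr hx)
  · have := h.head
    rw [← happ, List.head?_append_of_ne_nil _ hne] at this
    exact this
  · exact List.nodup_cons.mpr ⟨fun hyd => (Finset.mem_sdiff.mp (hdrop y hyd)).2 hyS, hnd.2.1⟩
  · exact List.isChain_cons.mpr ⟨fun b hb => hch.2.2 y hlast b hb, hch.2.1⟩
  · intro x hx
    rcases List.mem_cons.mp hx with rfl | hx
    · exact Finset.mem_insert_self _ _
    · exact Finset.mem_insert_of_mem (hdrop x hx)
  · have := h.last
    rw [← happ, List.getLast?_append, hlast] at this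
    cases hd : l.drop k with
    | nil => rw [hd] at this; simpa using this
    | cons a t =>
      rw [hd] at this
      rw [List.getLast?_cons_cons]
      rw [List.getLast?_eq_some_getLast (List.cons_ne_nil a t)] at this ⊢
      simpa using this
  · have := congrArg List.length happ
    rw [List.length_append] at this
    rw [List.length_cons]
    omega

/-- The values that are found for the candidate `c` if both partial searches are correct. -/
def IsBestJoin (adj : Fin m → Fin m → Prop) (S : Finset (Fin m)) (v u : Fin m)
    (c : Finset (Fin m) × Fin m) (a : Entry m) : Prop :=
  ∃ r r', IsBest adj c.1 v c.2 r ∧ IsBest adj (insert c.2 (S \ c.1)) c.2 u r' ∧ a = r.join r'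

theorem Entry.len_join {k : ℕ} {c : Finset (Fin m) × Fin m} (hc : c ∈ splits k S)
    {l l' : {l : List (Fin m) // l.Nodup}} (h : IsTrail adj c.1 v c.2 l.1)
    (h' : IsTrail adj (insert c.2 (S \ c.1)) c.2 u l'.1) :
    ∃ h, Entry.join (some l) (some l') = some ⟨l.1 ++ l'.1.tail, h⟩ := by
  simp only [splits, Finset.mem_filter, Finset.mem_univ, true_and] at hc
  have := (h.join hc.1 hc.2.2 h').nodup
  exact ⟨this, by simp [Entry.join, Entry.ofList, this]⟩

/-- Best partial values may be different paths, but they have the same length and can always be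
joined. So every candidate has a well-defined value, as `failure_qmax_le` requires. -/
theorem IsBestJoin.len_le {k : ℕ} {c : Finset (Fin m) × Fin m} (hc : c ∈ splits k S)
    {a b : Entry m} (ha : IsBestJoin adj S v u c a) (hb : IsBestJoin adj S v u c b) :
    a.len ≤ b.len := by
  obtain ⟨r, r', h, h', rfl⟩ := ha
  obtain ⟨q, q', g, g', rfl⟩ := hb
  cases r with
  | none => exact bot_le
  | some l =>
    cases r' with
    | none => exact bot_le
    | some l' =>
      have hl := h.1 l rfl
      have hl' := h'.1 l' rfl
      obtain ⟨p, rfl, h1⟩ := Entry.exists_of_len_ge (g.2 _ hl)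
      obtain ⟨p', rfl, h2⟩ := Entry.exists_of_len_ge (g'.2 _ hl')
      obtain ⟨_, e1⟩ := Entry.len_join hc hl hl'
      obtain ⟨_, e2⟩ := Entry.len_join hc (g.1 p rfl) (g'.1 p' rfl)
      rw [e1, e2]
      simp only [Entry.len, List.length_append, List.length_tail]
      exact_mod_cast (by omega)

/-- The recursion for `F(S, v, u)`. -/
theorem isBest_of_max {k : ℕ} (hk : 1 ≤ k) (hkS : k ≤ S.card) {a : Entry m}
    (h1 : a = none ∨ ∃ c ∈ splits k S, IsBestJoin adj S v u c a)
    (h2 : ∀ c ∈ splits k S, ∀ b, IsBestJoin adj S v u c b → b.len ≤ a.len) :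
    IsBest adj S v u a := by
  refine ⟨fun l hl => ?_, fun l hl => ?_⟩
  · rcases h1 with rfl | ⟨c, hc, r, r', h, h', rfl⟩
    · cases hl
    · cases r with
      | none => cases hl
      | some p =>
        cases r' with
        | none => cases hl
        | some p' =>
          obtain ⟨_, e⟩ := Entry.len_join hc (h.1 p rfl) (h'.1 p' rfl)
          rw [e] at hl
          cases hl
          simp only [splits, Finset.mem_filter, Finset.mem_univ, true_and] at hc
          exact (h.1 p rfl).join hc.1 hc.2.2 (h'.1 p' rfl)
  · obtain ⟨S', y, l₁, l₂, hc, t₁, t₂, hlen⟩ := hl.split hk hkS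
    obtain ⟨r, hr⟩ := exists_isBest adj S' v y
    obtain ⟨r', hr'⟩ := exists_isBest adj (insert y (S \ S')) y u
    -- Best values for the two pieces of `l` are at least as long as those pieces, and their join
    -- counts `y` once.
    refine le_trans ?_ (h2 (S', y) hc _ ⟨r, r', hr, hr', rfl⟩)
    obtain ⟨p, rfl, q1⟩ := Entry.exists_of_len_ge (hr.2 _ t₁)
    obtain ⟨p', rfl, q2⟩ := Entry.exists_of_len_ge (hr'.2 _ t₂)
    obtain ⟨_, e⟩ := Entry.len_join hc (hr.1 p rfl) (hr'.1 p' rfl)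
    rw [e]
    simp only [Entry.len, List.length_append, List.length_tail]
    exact_mod_cast (by omega)

/-! ### The classical precomputation -/

/-- A fold with strict replacement maintains a maximum. Stated for an abstract step so that the step
counter of `getLen` plays no role. -/
theorem foldl_max {α : Type} {new : α → Entry m} {cond : α → Prop}
    {step : Entry m × ℕ → α → Entry m × ℕ}
    (h1 : ∀ st y, cond y → st.1.len < (new y).len → (step st y).1 = new y)
    (h2 : ∀ st y, ¬ (cond y ∧ st.1.len < (new y).len) → (step st y).1 = st.1)
    (ys : List α) (st : Entry m × ℕ) :
    ((ys.foldl step st).1 = st.1 ∨ ∃ y ∈ ys, cond y ∧ (ys.foldl step st).1 = new y) ∧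
      st.1.len ≤ (ys.foldl step st).1.len ∧
      ∀ y ∈ ys, cond y → (new y).len ≤ (ys.foldl step st).1.len := by
  induction ys generalizing st with
  | nil => simp
  | cons y ys ih =>
    obtain ⟨i1, i2, i3⟩ := ih (step st y)
    rw [List.foldl_cons]
    by_cases h : cond y ∧ st.1.len < (new y).len
    · have e := h1 st y h.1 h.2
      rw [e] at i1 i2
      refine ⟨Or.inr ?_, h.2.le.trans i2, ?_⟩
      · rcases i1 with i1 | ⟨z, hz, hcz, i1⟩
        · exact ⟨y, List.mem_cons_self, h.1, i1⟩
        · exact ⟨z, List.mem_cons_of_mem _ hz, hcz, i1⟩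
      · intro z hz hcz
        rcases List.mem_cons.mp hz with rfl | hz
        · exact i2
        · exact i3 z hz hcz
    · have e := h2 st y h
      rw [e] at i1 i2
      refine ⟨?_, i2, ?_⟩
      · rcases i1 with i1 | ⟨z, hz, hcz, i1⟩
        · exact Or.inl i1
        · exact Or.inr ⟨z, List.mem_cons_of_mem _ hz, hcz, i1⟩
      · intro z hz hcz
        rcases List.mem_cons.mp hz with rfl | hz
        · exact (not_lt.mp fun hlt => h ⟨hcz, hlt⟩).trans i2
        · exact i3 z hz hcz

theorem isTrail_singleton (hv : v ∈ S) : IsTrail adj S v v [v] :=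
  ⟨by simp, by simp, by simpa using hv, rfl, rfl⟩

theorem IsTrail.length_eq_one {l : List (Fin m)} (h : IsTrail adj S v v l) : l.length = 1 := by
  obtain ⟨hn, -, -, hh, hl⟩ := h
  cases l with
  | nil => simp at hh
  | cons a t =>
    simp only [List.head?_cons, Option.some.injEq] at hh
    subst hh
    cases t with
    | nil => rfl
    | cons b t =>
      rw [List.getLast?_cons_cons] at hl
      exact absurd (List.mem_of_getLast? hl) (List.nodup_cons.mp hn).1

theorem IsTrail.snoc (hu : u ∈ S) (huy : adj y u) {l : List (Fin m)}
    (h : IsTrail adj (S.erase u) v y l) : IsTrail adj S v u (l ++ [u]) := by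
  refine ⟨?_, ?_, ?_, ?_, by simp⟩
  · refine List.nodup_append.mpr ⟨h.nodup, by simp, fun a ha b hb hab => ?_⟩
    have : a = u := hab.trans (by simpa using hb)
    exact Finset.ne_of_mem_erase (h.subset a ha) this
  · refine List.isChain_append.mpr ⟨h.chain, by simp, fun a ha b hb => ?_⟩
    have h1 : y = a := by
      have := h.last ▸ ha
      simpa using this
    have h2 : u = b := by simpa using hb
    rwa [← h1, ← h2]
  · intro x hx
    rcases List.mem_append.mp hx with hx | hx
    · exact Finset.mem_of_mem_erase (h.subset x hx)
    · have : x = u := by simpa using hx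
      rwa [this]
  · rw [List.head?_append_of_ne_nil _ h.ne_nil, h.head]

theorem IsTrail.unsnoc (hvu : v ≠ u) {l : List (Fin m)} (h : IsTrail adj S v u l) :
    ∃ l' y, l = l' ++ [u] ∧ y ∈ S.erase u ∧ adj y u ∧ IsTrail adj (S.erase u) v y l' := by
  obtain ⟨l', a, rfl⟩ := List.eq_nil_or_concat' l |>.resolve_left h.ne_nil
  have ha : a = u := by simpa using h.last
  subst ha
  have hne : l' ≠ [] := by
    rintro rfl
    have := h.head
    simp at this
    exact hvu this.symm
  have hnd := List.nodup_append.mp h.nodup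
  have hch := List.isChain_append.mp h.chain
  have hsub : ∀ x ∈ l', x ∈ S.erase a := fun x hx =>
    Finset.mem_erase.mpr ⟨hnd.2.2 x hx a (by simp), h.subset x (List.mem_append_left _ hx)⟩
  have hl := List.getLast?_eq_some_getLast hne
  refine ⟨l', l'.getLast hne, rfl, hsub _ (List.getLast_mem hne), ?_, hnd.1, hch.1, hsub, ?_, hl⟩
  · exact hch.2.2 _ hl a rfl
  · have := h.head
    rwa [List.head?_append_of_ne_nil _ hne] at this

/-- For `v ≠ u`, removing and appending the last edge `u` puts trails in `S` in correspondence with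
trails in `S \ {u}` ending next to `u`. The case `v = u` is separate: the only such trail is `[v]`.
-/
theorem isBest_getLen {T : Table m} (hv : v ∈ S) (hu : u ∈ S)
    (hT : ∀ y, IsBest adj (S.erase u) v y (T (S.erase u) v y)) :
    IsBest adj S v u (getLen adj T S v u).1 := by
  by_cases hvu : v = u
  · subst hvu
    have : (getLen adj T S v v).1 = some ⟨[v], by simp⟩ := by
      simp [getLen, Entry.ofList]
    rw [this]
    refine ⟨fun l hl => ?_, fun l hl => ?_⟩
    · cases hl; exact isTrail_singleton hv
    · rw [hl.length_eq_one]; exact le_rfl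
  · rw [getLen, if_neg hvu]
    obtain ⟨i1, -, i3⟩ := foldl_max (new := fun y => (T (S.erase u) v y).snoc u)
      (cond := fun y => y ∈ S.erase u ∧ adj y u)
      (step := fun st y =>
        let new := (T (S.erase u) v y).snoc u
        (if y ∈ S.erase u ∧ adj y u ∧ st.1.len < new.len then new else st.1, st.2 + 1))
      (fun st y hc hlt => if_pos ⟨hc.1, hc.2, hlt⟩)
      (fun st y hn => if_neg fun h => hn ⟨⟨h.1, h.2.1⟩, h.2.2⟩) (List.finRange m) (none, 1)
    have hnew : ∀ y, adj y u → ∀ l, T (S.erase u) v y = some l → ∃ h,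
        (T (S.erase u) v y).snoc u = some ⟨l.1 ++ [u], h⟩ := fun y hy l hl => by
      have := (((hT y).1 l hl).snoc hu hy).nodup
      exact ⟨this, by simp [hl, Entry.snoc, Entry.ofList, this]⟩
    refine ⟨fun l hl => ?_, fun l hl => ?_⟩
    · rcases i1 with i1 | ⟨y, -, hc, i1⟩
      · rw [i1] at hl; cases hl
      · rw [i1] at hl
        cases hTy : T (S.erase u) v y with
        | none => simp [hTy, Entry.snoc] at hl
        | some p =>
          obtain ⟨_, e⟩ := hnew y hc.2 p hTy
          rw [e] at hl
          cases hl
          exact ((hT y).1 p hTy).snoc hu hc.2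
    · obtain ⟨l', y, rfl, hy, hadj, ht⟩ := hl.unsnoc hvu
      refine le_trans ?_ (i3 y (List.mem_finRange y) ⟨hy, hadj⟩)
      obtain ⟨p, hp, hlen⟩ := Entry.exists_of_len_ge ((hT y).2 _ ht)
      obtain ⟨_, e⟩ := hnew y hadj p hp
      simp only [e, Entry.len, List.length_append, List.length_singleton]
      exact_mod_cast (by omega)

/-- The table is correct for sets of less than `s` edges, and its other entries are correct or not
yet filled. -/
def TableInv (adj : Fin m → Fin m → Prop) (s : ℕ) (T : Table m) : Prop :=
  (∀ S v u, S.card < s → IsBest adj S v u (T S v u)) ∧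
    ∀ S v u, IsBest adj S v u (T S v u) ∨ T S v u = none

/-- The computation reads only sets with one element less, which are already correct. Keys with an
endpoint outside `S` are skipped, but there the initial `none` is the right answer. Keeping the
entries correct or unfilled makes this survive all later updates. -/
theorem fillEntry_spec {s : ℕ} {st : Table m × ℕ} (h : TableInv adj s st.1)
    (k : Finset (Fin m) × Fin m × Fin m) (hk : k.1.card = s) :
    TableInv adj s (fillEntry adj st k).1 ∧
      (∀ S v u, IsBest adj S v u (st.1 S v u) → IsBest adj S v u ((fillEntry adj st k).1 S v u)) ∧
      IsBest adj k.1 k.2.1 k.2.2 ((fillEntry adj st k).1 k.1 k.2.1 k.2.2) := by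
  obtain ⟨S, v, u⟩ := k
  dsimp only at hk ⊢
  by_cases hvu : v ∈ S ∧ u ∈ S
  · have hb : IsBest adj S v u (getLen adj st.1 S v u).1 := by
      refine isBest_getLen hvu.1 hvu.2 fun y => h.1 _ _ _ ?_
      rw [← hk]
      exact Finset.card_erase_lt_of_mem hvu.2
    have hval : ∀ S' v' u', (fillEntry adj st (S, v, u)).1 S' v' u' =
        if (S', v', u') = (S, v, u) then (getLen adj st.1 S v u).1 else st.1 S' v' u' := by
      intro S' v' u'
      rw [fillEntry, if_pos hvu]
    have hmono : ∀ S' v' u', IsBest adj S' v' u' (st.1 S' v' u') →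
        IsBest adj S' v' u' ((fillEntry adj st (S, v, u)).1 S' v' u') := by
      intro S' v' u' h'
      rw [hval]
      split_ifs with he
      · cases he; exact hb
      · exact h'
    refine ⟨⟨fun S' v' u' hS' => hmono _ _ _ (h.1 _ _ _ hS'), fun S' v' u' => ?_⟩, hmono, ?_⟩
    · rw [hval]
      split_ifs with he
      · cases he; exact Or.inl hb
      · exact h.2 _ _ _
    · rw [hval, if_pos rfl]; exact hb
  · have : (fillEntry adj st (S, v, u)).1 = st.1 := by rw [fillEntry, if_neg hvu]
    rw [this]
    refine ⟨h, fun _ _ _ h' => h', ?_⟩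
    rcases h.2 S v u with h' | h'
    · exact h'
    · rw [h']; exact isBest_none_of_notMem hvu

theorem foldl_fillEntry_spec {s : ℕ} (ks : List (Finset (Fin m) × Fin m × Fin m))
    (hks : ∀ k ∈ ks, k.1.card = s) {st : Table m × ℕ} (h : TableInv adj s st.1) :
    TableInv adj s (ks.foldl (fillEntry adj) st).1 ∧
      (∀ S v u, IsBest adj S v u (st.1 S v u) →
        IsBest adj S v u ((ks.foldl (fillEntry adj) st).1 S v u)) ∧
      ∀ k ∈ ks, IsBest adj k.1 k.2.1 k.2.2 ((ks.foldl (fillEntry adj) st).1 k.1 k.2.1 k.2.2) := by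
  induction ks generalizing st with
  | nil => exact ⟨h, fun _ _ _ h' => h', fun k hk => by simp at hk⟩
  | cons k ks ih =>
    obtain ⟨i1, i2, i3⟩ := fillEntry_spec h k (hks k List.mem_cons_self)
    obtain ⟨j1, j2, j3⟩ := ih (fun k' hk' => hks k' (List.mem_cons_of_mem _ hk')) i1
    rw [List.foldl_cons]
    refine ⟨j1, fun S v u h' => j2 _ _ _ (i2 _ _ _ h'), fun k' hk' => ?_⟩
    rcases List.mem_cons.mp hk' with rfl | hk'
    · exact j2 _ _ _ i3
    · exact j3 k' hk'

/-- The keys for the sets of size `s`. -/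
def keysOfSize (m s : ℕ) : List (Finset (Fin m) × Fin m × Fin m) :=
  (Finset.powersetCard s (Finset.univ : Finset (Fin m))).toList.flatMap fun S =>
    (List.finRange m).flatMap fun v => (List.finRange m).map fun u => (S, v, u)

theorem mem_keysOfSize {s : ℕ} {k : Finset (Fin m) × Fin m × Fin m} :
    k ∈ keysOfSize m s ↔ k.1.card = s := by
  obtain ⟨S, v, u⟩ := k
  simp [keysOfSize]

theorem length_keysOfSize (m s : ℕ) : (keysOfSize m s).length = m.choose s * (m * m) := by
  simp [keysOfSize, List.length_flatMap]

theorem keys_eq (m K : ℕ) : keys m K = (List.range (K + 1)).flatMap (keysOfSize m) := rfl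

theorem tableInv_foldl_keys (adj : Fin m → Fin m → Prop) (n : ℕ) :
    TableInv adj n (((List.range n).flatMap (keysOfSize m)).foldl (fillEntry adj)
      (fun _ _ _ => none, 0)).1 := by
  induction n with
  | zero => exact ⟨fun _ _ _ h => by simp at h, fun _ _ _ => Or.inr rfl⟩
  | succ n ih =>
    rw [List.range_succ, List.flatMap_append, List.foldl_append]
    have hflat : [n].flatMap (keysOfSize m) = keysOfSize m n := by simp
    rw [hflat]
    obtain ⟨j1, -, j3⟩ := foldl_fillEntry_spec (keysOfSize m n)
      (fun k hk => mem_keysOfSize.mp hk) ih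
    refine ⟨fun S v u hS => ?_, j1.2⟩
    rcases Nat.lt_succ_iff_lt_or_eq.mp hS with h | h
    · exact j1.1 _ _ _ h
    · exact j3 (S, v, u) (mem_keysOfSize.mpr h)

/-- The classical precomputation is correct. -/
theorem isBest_stepOne (adj : Fin m → Fin m → Prop) {K : ℕ} {S : Finset (Fin m)} (hS : S.card ≤ K)
    (v u : Fin m) : IsBest adj S v u ((stepOne adj K).1 S v u) := by
  rw [stepOne, keys_eq]
  exact (tableInv_foldl_keys adj (K + 1)).1 S v u (by omega)

theorem foldl_snd_le {α β : Type} {step : β × ℕ → α → β × ℕ} {b : ℕ}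
    (h : ∀ st y, (step st y).2 ≤ st.2 + b) (ys : List α) (st : β × ℕ) :
    (ys.foldl step st).2 ≤ st.2 + ys.length * b := by
  induction ys generalizing st with
  | nil => simp
  | cons y ys ih =>
    rw [List.foldl_cons, List.length_cons]
    have := ih (step st y)
    have := h st y
    linarith [Nat.succ_mul ys.length b]

/-- The number of steps of the classical precomputation. -/
theorem stepOne_cost_le (adj : Fin m → Fin m → Prop) (K : ℕ) :
    (stepOne adj K).2 ≤ (∑ s ∈ Finset.range (K + 1), m.choose s) * (m * m) * (m + 2) := by
  have hget : ∀ T S v u, (getLen adj T S v u).2 ≤ m + 1 := by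
    intro T S v u
    unfold getLen
    split_ifs
    · simp
    · refine (foldl_snd_le (b := 1) (fun st y => le_rfl) _ _).trans ?_
      simp [add_comm]
  have hfill : ∀ st k, (fillEntry adj st k).2 ≤ st.2 + (m + 2) := by
    intro st k
    unfold fillEntry
    split_ifs
    · have := hget st.1 k.1 k.2.1 k.2.2
      dsimp only
      omega
    · dsimp only
      omega
  refine (foldl_snd_le hfill _ _).trans ?_
  rw [zero_add, keys_eq, List.length_flatMap]
  refine Nat.mul_le_mul_right _ (le_of_eq ?_)
  simp_rw [length_keysOfSize]
  rw [Finset.sum_mul, Finset.sum_range]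
  rw [← List.sum_ofFn, List.ofFn_eq_map, ← List.map_coe_finRange_eq_range, List.map_map]
  rfl

end Trails

end

end LongestTrail

namespace LongestTrail

noncomputable section

open scoped Classical

/-! ### Correctness of the quantum part -/

theorem card_splits_le {m : ℕ} {s k : ℕ} {S : Finset (Fin m)} (hS : S.card ≤ s) :
    (splits k S).card ≤ s.choose k * k := by
  have h : splits k S ⊆ (S.powersetCard k).biUnion fun A => A.image fun y => (A, y) := by
    rintro ⟨A, y⟩ h
    simp only [splits, Finset.mem_filter, Finset.mem_univ, true_and] at h
    simp only [Finset.mem_biUnion, Finset.mem_powersetCard, Finset.mem_image]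
    exact ⟨A, ⟨h.1, h.2.1⟩, y, h.2.2, rfl⟩
  refine (Finset.card_le_card h).trans ((Finset.card_biUnion_le_card_mul _ _ k fun A hA => ?_).trans ?_)
  · exact Finset.card_image_le.trans (Finset.mem_powersetCard.mp hA).2.le
  · rw [Finset.card_powersetCard]
    exact Nat.mul_le_mul_right _ (Nat.choose_le_choose k hS)

theorem splits_nonempty {m : ℕ} {k : ℕ} {S : Finset (Fin m)} (hk : 1 ≤ k) (hkS : k ≤ S.card) :
    (splits k S).Nonempty := by
  obtain ⟨A, hA, hc⟩ := Finset.exists_subset_card_eq hkS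
  obtain ⟨y, hy⟩ := Finset.card_pos.mp (by omega : 0 < A.card)
  exact ⟨(A, y), by simp [splits, hA, hc, hy]⟩

/-- One level of the recursion returns a correct value of `F(S, v, u)`, if the next one does for
the pieces of `S`. -/
theorem failure_level_le {m : ℕ} (adj : Fin m → Fin m → Prop) {s k : ℕ} (e₀ : Fin m)
    (sub : PathFinder m) {ε : ℝ} (hε : 0 ≤ ε) {S : Finset (Fin m)} (hk : 1 ≤ k) (hkS : k ≤ S.card)
    (hS : S.card ≤ s)
    (hsub : ∀ S' v u, (S'.card = k ∨ S'.card = S.card - k + 1) →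
      sub.failure (S', v, u) (IsBest adj S' v u) ≤ ε) (v u : Fin m) :
    (level s k e₀ sub).failure (S, v, u) (IsBest adj S v u)
      ≤ Subroutine.maxError (repetitions m) (s.choose k * k) (2 * ε) := by
  refine (Subroutine.failure_mono _ _ (p := fun a =>
    (a = none ∨ ∃ c ∈ splits k S, IsBestJoin adj S v u c a) ∧
      ∀ c ∈ splits k S, ∀ b, IsBestJoin adj S v u c b → Entry.len b ≤ Entry.len a)
      fun a ha => isBest_of_max hk hkS ha.1 ha.2).trans ?_
  rw [level]
  refine Subroutine.failure_qmax_le (repetitions m) (s.choose k * k) (∅, e₀) none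
    (fun t : Finset (Fin m) × Fin m × Fin m => splits k t.1) Entry.len _ (S, v, u)
    (IsBestJoin adj S v u) (by positivity) ?_ (fun c hc a b ha hb =>
      le_antisymm (ha.len_le hc hb) (hb.len_le hc ha)) (splits_nonempty hk hkS) (card_splits_le hS)
  intro c hc
  have hc' := hc
  simp only [splits, Finset.mem_filter, Finset.mem_univ, true_and] at hc'
  have hcard : (insert c.2 (S \ c.1)).card = S.card - k + 1 := by
    rw [Finset.card_insert_of_notMem (fun h => (Finset.mem_sdiff.mp h).2 hc'.2.2),
      Finset.card_sdiff_of_subset hc'.1, hc'.2.1]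
  rw [Subroutine.failure]
  simp_rw [Subroutine.expect_bind, Subroutine.expect_ret, Subroutine.expect_comap]
  -- Union bound over the two pieces: the second search contributes `ε` given a correct first one,
  -- and the first contributes another `ε`.
  have h2 : ∀ r, IsBest adj c.1 v c.2 r → (sub.expect (insert c.2 (S \ c.1), c.2, u) fun r' =>
      if IsBestJoin adj S v u c (r.join r') then (0 : ℝ) else 1) ≤ ε := by
    intro r hr
    have := Subroutine.expect_le_add_failure sub (insert c.2 (S \ c.1), c.2, u)
      (IsBest adj (insert c.2 (S \ c.1)) c.2 u) (hsub _ _ _ (Or.inr hcard)) le_rfl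
      (g := fun r' => if IsBestJoin adj S v u c (r.join r') then (0 : ℝ) else 1)
      (fun a => by split_ifs <;> norm_num)
      (fun r' hr' => by
        rw [if_pos ⟨r, r', hr, hr', rfl⟩])
    linarith
  have h1 := Subroutine.expect_le_add_failure sub (c.1, v, c.2) (IsBest adj c.1 v c.2)
    (hsub _ _ _ (Or.inl hc'.2.1)) hε (g := fun r => sub.expect (insert c.2 (S \ c.1), c.2, u)
      fun r' => if IsBestJoin adj S v u c (r.join r') then (0 : ℝ) else 1)
    (fun r => Subroutine.expect_le_of_le _ _ fun r' => by split_ifs <;> norm_num) h2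
  refine h1.trans_eq (by ring)

/-! ### Sizes -/

theorem size₂_bounds (m : ℕ) : m ≤ 2 * size₂ m ∧ 2 * size₂ m ≤ m + 1 := by
  have h1 : (m : ℚ) / 2 ≤ size₂ m := Nat.le_ceil _
  have h2 : (size₂ m : ℚ) < (m : ℚ) / 2 + 1 := Nat.ceil_lt_add_one (by positivity)
  have h3 : (m : ℚ) ≤ (2 * size₂ m : ℕ) := by push_cast; linarith
  have h4 : ((2 * size₂ m : ℕ) : ℚ) < (m + 2 : ℕ) := by push_cast; linarith
  have h3' := Nat.cast_le.mp h3
  have h4' := Nat.cast_lt.mp h4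
  omega

theorem size₄_bounds (m : ℕ) : m ≤ 4 * size₄ m ∧ 4 * size₄ m ≤ m + 3 := by
  have h1 : (m : ℚ) / 4 ≤ size₄ m := Nat.le_ceil _
  have h2 : (size₄ m : ℚ) < (m : ℚ) / 4 + 1 := Nat.ceil_lt_add_one (by positivity)
  have h3 : (m : ℚ) ≤ (4 * size₄ m : ℕ) := by push_cast; linarith
  have h4 : ((4 * size₄ m : ℕ) : ℚ) < (m + 4 : ℕ) := by push_cast; linarith
  have h3' := Nat.cast_le.mp h3
  have h4' := Nat.cast_lt.mp h4
  omega

theorem sizeα_bounds (m : ℕ) : 189 * m ≤ 800 * sizeα m ∧ 800 * sizeα m < 189 * m + 800 := by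
  have e : (1 - alpha) * (m : ℚ) / 4 = 189 * m / 800 := by rw [alpha]; ring
  have h1 : (1 - alpha) * (m : ℚ) / 4 ≤ sizeα m := Nat.le_ceil _
  have h2 : (sizeα m : ℚ) < (1 - alpha) * (m : ℚ) / 4 + 1 :=
    Nat.ceil_lt_add_one (by rw [e]; positivity)
  rw [e] at h1 h2
  have h3 : ((189 * m : ℕ) : ℚ) ≤ (800 * sizeα m : ℕ) := by push_cast; linarith
  have h4 : ((800 * sizeα m : ℕ) : ℚ) < (189 * m + 800 : ℕ) := by push_cast; linarith
  exact ⟨Nat.cast_le.mp h3, Nat.cast_lt.mp h4⟩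

/-! ### Error bounds -/

theorem choose_mul_le_four_pow {m s k : ℕ} (hs : s ≤ m) (hk : k ≤ m) :
    s.choose k * k ≤ 4 ^ m := by
  calc s.choose k * k ≤ 2 ^ s * 2 ^ m :=
        Nat.mul_le_mul (Nat.choose_le_two_pow s k) (hk.trans Nat.lt_two_pow_self.le)
    _ ≤ 2 ^ m * 2 ^ m := Nat.mul_le_mul_right _ (Nat.pow_le_pow_right (by norm_num) hs)
    _ = 4 ^ m := by rw [← mul_pow]; norm_num

theorem clog_le_of_le_four_pow {m N : ℕ} (hN : N ≤ 4 ^ m) : Nat.clog 2 N ≤ 2 * m := by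
  refine Nat.clog_le_of_le_pow (hN.trans_eq ?_)
  rw [pow_mul]; norm_num

theorem sqrtCeil_le_of_le_four_pow {m N : ℕ} (hN : N ≤ 4 ^ m) :
    Subroutine.sqrtCeil N ≤ 2 ^ m := by
  rw [Subroutine.sqrtCeil, Nat.ceil_le, Real.sqrt_le_iff]
  refine ⟨by positivity, ?_⟩
  have : (N : ℝ) ≤ 4 ^ m := by exact_mod_cast hN
  refine this.trans_eq ?_
  push_cast
  rw [← pow_mul, mul_comm, pow_mul]
  norm_num

theorem succ_le_two_pow (m : ℕ) : m + 1 ≤ 2 ^ m := Nat.lt_two_pow_self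

/-- With `y = 2^(-(m+1))`, the `10(m+1)` repetitions turn `2⁻¹⁰` into `y^100`. The accumulated
oracle error is at most `2^(4m+16) √ε`-sized, and `4m + 16 ≤ 11(m + 1)` for `m ≥ 1`. This explains
the loss of `11` in the exponent; the square root doubles the exponent required of `ε`. -/
theorem maxError_le {m N : ℕ} (hm : 1 ≤ m) (hN : N ≤ 4 ^ m) {ε : ℝ} {k : ℕ}
    (hε0 : 0 ≤ ε) (hε : ε ≤ ((1 / 2) ^ (m + 1)) ^ (2 * (k + 11))) :
    Subroutine.maxError (repetitions m) N ε
      ≤ ((1 / 2) ^ (m + 1)) ^ 100 + ((1 / 2) ^ (m + 1)) ^ k := by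
  set y : ℝ := (1 / 2) ^ (m + 1) with hy
  have hy0 : 0 < y := by positivity
  have hy1 : y ≤ 1 := pow_le_one₀ (by norm_num) (by norm_num)
  have hsq : Real.sqrt ε ≤ y ^ (k + 11) := by
    rw [Real.sqrt_le_iff]
    exact ⟨by positivity, hε.trans_eq (by rw [← pow_mul y, mul_comm])⟩
  have hε1 : ε ≤ y ^ (k + 11) :=
    hε.trans (pow_le_pow_of_le_one hy0.le hy1 (by omega))
  have h8 : Real.sqrt (8 * ε) ≤ 3 * y ^ (k + 11) := by
    rw [Real.sqrt_mul (by norm_num)]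
    have : Real.sqrt 8 ≤ 3 := by rw [Real.sqrt_le_iff]; norm_num
    exact mul_le_mul this hsq (Real.sqrt_nonneg _) (by norm_num)
  have hR : (Subroutine.sqrtCeil N : ℝ) ≤ 2 ^ m := by
    exact_mod_cast sqrtCeil_le_of_le_four_pow hN
  have hT : (Subroutine.numTrials N : ℝ) ≤ 2 ^ (2 * m + 8) := by
    have h1 : Subroutine.numTrials N ≤ 16 * (2 ^ (m + 2)) ^ 2 := by
      unfold Subroutine.numTrials
      have h2 := clog_le_of_le_four_pow hN
      have h3 := succ_le_two_pow m
      have h4 : Nat.clog 2 N + 3 ≤ 2 ^ (m + 2) := by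
        rw [pow_add]; omega
      exact Nat.mul_le_mul_left _ (Nat.pow_le_pow_left h4 2)
    have h5 : 16 * (2 ^ (m + 2)) ^ 2 = 2 ^ (2 * m + 8) := by ring
    rw [h5] at h1
    exact_mod_cast h1
  have hr : ((repetitions m : ℕ) : ℝ) ≤ 2 ^ (m + 4) := by
    have h1 : repetitions m ≤ 2 ^ (m + 4) := by
      unfold repetitions
      have h3 := succ_le_two_pow m
      rw [pow_add]; omega
    exact_mod_cast h1
  have h2m : (1 : ℝ) ≤ 2 ^ m := one_le_pow₀ (by norm_num)
  have hin : (Subroutine.numTrials N : ℝ) * Subroutine.trialError N ε + ε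
      ≤ 2 ^ (2 * m + 8) * (2 ^ m * (9 * y ^ (k + 11))) := by
    have h1 : Subroutine.trialError N ε ≤ 2 * (2 ^ m * (3 * y ^ (k + 11))) + 2 * y ^ (k + 11) := by
      unfold Subroutine.trialError
      gcongr
    have h2 : (1 : ℝ) ≤ 2 ^ (2 * m + 8) := one_le_pow₀ (by norm_num)
    have hz : 0 < y ^ (k + 11) := by positivity
    calc _ ≤ (2 : ℝ) ^ (2 * m + 8) * (2 * (2 ^ m * (3 * y ^ (k + 11))) + 2 * y ^ (k + 11))
          + 1 * y ^ (k + 11) := by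
            rw [one_mul]
            refine add_le_add (mul_le_mul hT h1 (Subroutine.trialError_nonneg _ hε0)
              (by positivity)) hε1
      _ ≤ (2 : ℝ) ^ (2 * m + 8) * (2 * (2 ^ m * (3 * y ^ (k + 11))) + 2 * y ^ (k + 11))
          + 2 ^ (2 * m + 8) * y ^ (k + 11) := by gcongr
      _ = (2 : ℝ) ^ (2 * m + 8) * ((2 ^ m * 6 + 3) * y ^ (k + 11)) := by ring
      _ ≤ (2 : ℝ) ^ (2 * m + 8) * ((2 ^ m * 9) * y ^ (k + 11)) := by
            gcongr
            linarith
      _ = _ := by ring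
  have hin0 : 0 ≤ (Subroutine.numTrials N : ℝ) * Subroutine.trialError N ε + ε := by
    have := Subroutine.trialError_nonneg N hε0
    positivity
  unfold Subroutine.maxError
  refine add_le_add (le_of_eq ?_) ?_
  · rw [hy, repetitions, ← pow_mul, ← pow_mul]
    ring_nf
  · calc _ ≤ (2 : ℝ) ^ (m + 4) * (2 ^ (2 * m + 8) * (2 ^ m * (9 * y ^ (k + 11)))) :=
          mul_le_mul hr hin hin0 (by positivity)
      _ ≤ (2 : ℝ) ^ (m + 4) * (2 ^ (2 * m + 8) * (2 ^ m * (2 ^ 4 * y ^ (k + 11)))) := by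
          gcongr; norm_num
      _ = 2 ^ (4 * m + 16) * y ^ (k + 11) := by ring
      _ ≤ 2 ^ ((m + 1) * 11) * y ^ (k + 11) := by
          gcongr
          · norm_num
          · omega
      _ = y ^ k := by
          rw [pow_add, mul_comm, mul_assoc, hy, ← pow_mul, ← pow_mul, ← mul_pow]
          norm_num

/-- The nested maximum findings find a longest path with high probability. -/
theorem failure_finder_le {m : ℕ} (hm : 1 ≤ m) (adj : Fin m → Fin m → Prop) (e₀ v u : Fin m) :
    (finder (stepOne adj (tableSize m)).1 e₀).failure (Finset.univ, v, u)
      (IsBest adj Finset.univ v u) ≤ ((1 / 2) ^ (m + 1)) ^ 6 := by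
  obtain ⟨a1, a2⟩ := size₂_bounds m
  obtain ⟨b1, b2⟩ := size₄_bounds m
  obtain ⟨c1, c2⟩ := sizeα_bounds m
  set T := (stepOne adj (tableSize m)).1 with hT
  set k₁ := size₂ m with hk₁
  set k₂ := size₄ m with hk₂
  set k₃ := sizeα m with hk₃
  set s₁ := pieceSize m k₁ with hs₁
  set s₂ := pieceSize s₁ k₂ with hs₂
  have hK : tableSize m = pieceSize s₂ k₃ := rfl
  have es₁ : s₁ = max k₁ (m - k₁ + 1) := rfl
  have es₂ : s₂ = max k₂ (s₁ - k₂ + 1) := rfl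
  have eK : pieceSize s₂ k₃ = max k₃ (s₂ - k₃ + 1) := rfl
  set y : ℝ := (1 / 2) ^ (m + 1) with hy
  have hy0 : 0 < y := by positivity
  have hy2 : 2 * y ≤ 1 := by
    rw [hy, pow_succ]
    have : ((1 : ℝ) / 2) ^ m ≤ 1 := pow_le_one₀ (by norm_num) (by norm_num)
    linarith
  have hy1 : y ≤ 1 := by linarith
  have hdbl : ∀ n : ℕ, 2 * y ^ (n + 1) ≤ y ^ n := by
    intro n
    calc 2 * y ^ (n + 1) = (2 * y) * y ^ n := by ring
      _ ≤ 1 * y ^ n := by gcongr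
      _ = y ^ n := one_mul _
  set f₀ : PathFinder m := Subroutine.lookup fun k => T k.1 k.2.1 k.2.2 with hf₀
  have h0 : ∀ S v u, S.card ≤ tableSize m → f₀.failure (S, v, u) (IsBest adj S v u) ≤ 0 := by
    intro S v u hS
    rw [Subroutine.failure, hf₀, Subroutine.expect_lookup, if_pos (isBest_stepOne adj hS v u)]
  set f₃ := level s₂ k₃ e₀ f₀ with hf₃
  have h3 : ∀ S v u, k₃ ≤ S.card → S.card ≤ s₂ →
      f₃.failure (S, v, u) (IsBest adj S v u) ≤ y ^ 99 := by
    intro S v u h1 h2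
    refine (failure_level_le adj e₀ f₀ le_rfl (by omega) h1 h2 (fun S' v u h => h0 _ _ _ (by omega))
      v u).trans ?_
    -- The table is exact, so any exponent is available; `100` matches the repetition error. The
    -- exponents then run `99 → 98 = 2(38 + 11)` and `37 → 36 = 2(7 + 11)`, one power of `y` paying
    -- for each factor `2`.
    refine (maxError_le hm (choose_mul_le_four_pow (by omega) (by omega)) (k := 100) (by norm_num)
      (by rw [mul_zero]; positivity)).trans ?_
    rw [← hy]
    have : 2 * y ^ 100 ≤ y ^ 99 := hdbl 99
    linarith
  set f₂ := level s₁ k₂ e₀ f₃ with hf₂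
  -- The lower bound leaves at least `k₃` elements in the complementary piece, which has `|S| - k₂ +
  -- 1` elements; the innermost level must be able to choose `k₃` of them.
  have h2 : ∀ S v u, k₂ + k₃ - 1 ≤ S.card → S.card ≤ s₁ →
      f₂.failure (S, v, u) (IsBest adj S v u) ≤ y ^ 37 := by
    intro S v u h1 h2
    refine (failure_level_le adj e₀ f₃ (ε := y ^ 99) (by positivity) (by omega) (by omega) h2
      (fun S' v u h => h3 _ _ _ (by omega) (by omega)) v u).trans ?_
    refine (maxError_le hm (choose_mul_le_four_pow (by omega) (by omega)) (k := 38) (by positivity)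
      (hdbl 98)).trans ?_
    rw [← hy]
    have : 2 * y ^ 38 ≤ y ^ 37 := hdbl 37
    have : y ^ 100 ≤ y ^ 38 := pow_le_pow_of_le_one hy0.le hy1 (by norm_num)
    linarith
  refine (failure_level_le adj e₀ f₂ (ε := y ^ 37) (by positivity) (by omega)
    (by rw [Finset.card_univ, Fintype.card_fin]; omega)
    (by rw [Finset.card_univ, Fintype.card_fin])
    (fun S' v u h => h2 _ _ _ (by rw [Finset.card_univ, Fintype.card_fin] at h; omega)
      (by rw [Finset.card_univ, Fintype.card_fin] at h; omega)) v u).trans ?_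
  refine (maxError_le hm (choose_mul_le_four_pow (by omega) (by omega)) (k := 7) (by positivity)
    (hdbl 36)).trans ?_
  rw [← hy]
  have : 2 * y ^ 7 ≤ y ^ 6 := hdbl 6
  have : y ^ 100 ≤ y ^ 7 := pow_le_pow_of_le_one hy0.le hy1 (by norm_num)
  linarith

end

end LongestTrail

namespace LongestTrail

noncomputable section

open scoped Classical

/-! ### The number of elementary steps of the quantum part -/

namespace Circuit

variable {X Y C : Type} [Fintype X] [Fintype Y] [Fintype C]

theorem select_cost_le {a : C → Circuit X} {c : ℕ} (h : ∀ i, (a i).cost ≤ c) :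
    (select a).cost ≤ c :=
  Finset.sup_le fun i _ => h i

theorem onSnd_cost_le (a : Circuit Y) : (onSnd (X := X) a).cost ≤ a.cost :=
  select_cost_le fun _ => le_rfl

theorem onFst_cost_le (a : Circuit X) : (onFst (Y := Y) a).cost ≤ a.cost :=
  onSnd_cost_le a

theorem pow_cost (a : Circuit X) (n : ℕ) : (a.pow n).cost = n * a.cost := by
  induction n with
  | zero => simp [pow, idle]
  | succ n ih => rw [pow, comp, ih, Nat.succ_mul]

end Circuit

namespace Subroutine

variable {I J A B S X : Type}

/-- The subroutine makes at most `c` elementary steps. -/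
def CostLE (p : Subroutine I A) (c : ℕ) : Prop := ∀ i, (p.circ i).cost ≤ c

theorem CostLE.mono {p : Subroutine I A} {c c' : ℕ} (h : p.CostLE c) (hc : c ≤ c') : p.CostLE c' :=
  fun i => (h i).trans hc

theorem costLE_ret (f : I → A) : (ret f).CostLE 1 := fun _ => le_rfl

theorem costLE_sample [Fintype X] (x₀ : X) (C : I → Finset X) : (sample x₀ C).CostLE 1 :=
  fun _ => le_rfl

theorem costLE_lookup [Fintype A] [Nonempty A] (T : I → A) : (lookup T).CostLE 1 := fun _ => le_rfl

theorem CostLE.comap {p : Subroutine I A} {c : ℕ} (h : p.CostLE c) (g : J → I) :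
    (p.comap g).CostLE c :=
  fun j => h (g j)

theorem CostLE.bind {p : Subroutine I A} {q : Subroutine (I × A) B} {c d : ℕ} (hp : p.CostLE c)
    (hq : q.CostLE d) : (p.bind q).CostLE (c + d) := fun i =>
  add_le_add ((Circuit.onFst_cost_le _).trans (hp i)) (Circuit.select_cost_le fun _ => hq _)

theorem CostLE.iterate {p : Subroutine (I × S) S} {c : ℕ} (h : p.CostLE c) (n : ℕ) :
    (p.iterate n).CostLE (1 + n * c) := by
  induction n with
  | zero => exact (costLE_ret _).mono (by omega)
  | succ n ih => exact (ih.bind (h.comap _)).mono (by rw [Nat.succ_mul]; omega)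

variable [Fintype X]

theorem mark_cost_le (val : A → WithBot ℕ) {f : Subroutine (J × X) A} {c : ℕ} (h : f.CostLE c)
    (j : J) (thr : X) : (mark val f j thr).cost ≤ 4 * c + 1 := by
  have h1 : (Circuit.select fun x => ((f.circ (j, x)).onFst).comp
      ((f.circ (j, thr)).onSnd (X := f.W))).cost ≤ c + c :=
    Circuit.select_cost_le fun x =>
      add_le_add ((Circuit.onFst_cost_le _).trans (h _)) ((Circuit.onSnd_cost_le _).trans (h _))
  have h2 : (mark val f j thr).cost = (Circuit.select fun x => ((f.circ (j, x)).onFst).comp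
      ((f.circ (j, thr)).onSnd (X := f.W))).cost + 1
      + (Circuit.select fun x => ((f.circ (j, x)).onFst).comp
      ((f.circ (j, thr)).onSnd (X := f.W))).cost := by
    rw [mark]
    rfl
  omega

theorem grover_cost_le (x₀ : X) (C : J → Finset X) (val : A → WithBot ℕ)
    {f : Subroutine (J × X) A} {c : ℕ} (h : f.CostLE c) (t : J × (X × ℕ)) :
    ((grover x₀ C val f).circ t).cost ≤ 1 + t.2.2 * (4 * c + 2) := by
  change ((Circuit.step (prepareGate x₀ (C t.1))).onFst (Y := f.W × f.W)).cost +
    (Circuit.pow ((mark val f t.1 t.2.1).comp (Circuit.step (diffusionGate (C t.1))).onFst)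
      t.2.2).cost ≤ _
  rw [Circuit.pow_cost]
  refine add_le_add (Circuit.onFst_cost_le _) (Nat.mul_le_mul_left _ ?_)
  have h1 := mark_cost_le val h t.1 t.2.1
  have h2 := Circuit.onFst_cost_le (Y := f.W × f.W) (Circuit.step (diffusionGate (C t.1)))
  exact (add_le_add h1 h2).trans (le_of_eq rfl)

theorem costLE_trial (N : ℕ) (x₀ : X) (C : J → Finset X) (val : A → WithBot ℕ)
    {f : Subroutine (J × X) A} {c : ℕ} (h : f.CostLE c) :
    (trial N x₀ C val f).CostLE (1 + ((1 + sqrtCeil N * (4 * c + 2)) + (c + (c + 1)))) := by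
  rw [trial]
  refine (costLE_sample _ _).bind (CostLE.bind ?_ ((h.comap _).bind
    ((h.comap _).bind (costLE_ret _))))
  intro t
  refine (grover_cost_le x₀ C val h _).trans ?_
  exact Nat.add_le_add_left (Nat.mul_le_mul_right _ (Nat.lt_succ_iff.mp t.2.2)) 1

theorem costLE_durrHoyer (N : ℕ) (x₀ : X) (C : J → Finset X) (val : A → WithBot ℕ)
    {f : Subroutine (J × X) A} {c : ℕ} (h : f.CostLE c) :
    (durrHoyer N x₀ C val f).CostLE
      (1 + (1 + numTrials N * (1 + ((1 + sqrtCeil N * (4 * c + 2)) + (c + (c + 1))))) + 1) := by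
  rw [durrHoyer]
  exact ((costLE_sample _ _).bind (((costLE_trial N x₀ C val h).iterate _).comap _)).bind
    (costLE_ret _)

theorem costLE_qmax (r N : ℕ) (x₀ : X) (a₀ : A) (C : J → Finset X) (val : A → WithBot ℕ)
    {f : Subroutine (J × X) A} {c : ℕ} (h : f.CostLE c) :
    (qmax r N x₀ a₀ C val f).CostLE
      (1 + r * ((1 + (1 + numTrials N * (1 + ((1 + sqrtCeil N * (4 * c + 2)) + (c + (c + 1))))) + 1)
        + (c + 1))) := by
  rw [qmax]
  exact CostLE.comap (CostLE.iterate (((costLE_durrHoyer N x₀ C val h).comap _).bind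
    ((h.comap _).bind (costLE_ret _))) r) _

end Subroutine

open Subroutine

/-- The factor by which one level of the recursion multiplies the number of steps. -/
def levelFactor (m N : ℕ) : ℕ := 19 * repetitions m * numTrials N * sqrtCeil N

/-- Bounding cost plus one, here `c'`, makes the recurrence purely multiplicative: lower-order terms
are absorbed. Of the `19`, the share `17` covers the repeated runs and `2` the remaining constants.
-/
theorem costLE_level {m : ℕ} (s k : ℕ) (hk : 1 ≤ k) (hks : k ≤ s) (e₀ : Fin m) {sub : PathFinder m}
    {c' : ℕ} (hc : 0 < c') (h : sub.CostLE (c' - 1)) :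
    (level s k e₀ sub).CostLE (levelFactor m (s.choose k * k) * c' - 1) := by
  obtain ⟨c, rfl⟩ : ∃ c, c' = c + 1 := ⟨c' - 1, by omega⟩
  rw [Nat.add_sub_cancel] at h
  rw [level, levelFactor]
  refine (costLE_qmax _ _ _ _ _ _ ((h.comap _).bind ((h.comap _).bind (costLE_ret _)))).mono ?_
  have hN : 0 < s.choose k * k := Nat.mul_pos (Nat.choose_pos hks) hk
  have hR : 1 ≤ sqrtCeil (s.choose k * k) := sqrtCeil_pos hN
  have hT : 1 ≤ numTrials (s.choose k * k) := by
    unfold numTrials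
    have : 0 < (Nat.clog 2 (s.choose k * k) + 3) ^ 2 := by positivity
    omega
  have hr : 1 ≤ repetitions m := by unfold repetitions; omega
  generalize sqrtCeil (s.choose k * k) = R at *
  generalize numTrials (s.choose k * k) = T at *
  generalize repetitions m = r at *
  refine Nat.le_sub_one_of_lt (Nat.lt_of_succ_le ?_)
  have h1 : 1 + ((1 + R * (4 * (c + (c + 1)) + 2)) + ((c + (c + 1)) + ((c + (c + 1)) + 1)))
      ≤ 12 * (R * (c + 1)) := by nlinarith
  have h2 : c + 1 ≤ R * (c + 1) := Nat.le_mul_of_pos_left _ hR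
  generalize 1 + ((1 + R * (4 * (c + (c + 1)) + 2)) + ((c + (c + 1)) + ((c + (c + 1)) + 1))) = t at *
  have h3 : (1 + (1 + T * t) + 1) + ((c + (c + 1)) + 1) 
      ≤ 12 * (T * (R * (c + 1))) + 5 * (R * (c + 1)) := by
    have : T * t ≤ T * (12 * (R * (c + 1))) := Nat.mul_le_mul_left _ h1
    nlinarith
  generalize (1 + (1 + T * t) + 1) + ((c + (c + 1)) + 1) = d at *
  have h4 : R * (c + 1) ≤ T * (R * (c + 1)) := Nat.le_mul_of_pos_left _ hT
  have h5 : r * d ≤ r * (17 * (T * (R * (c + 1)))) := Nat.mul_le_mul_left _ (by omega)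
  have h6 : 1 ≤ T * (R * (c + 1)) := Nat.one_le_iff_ne_zero.mpr (by positivity)
  have h7 : 1 ≤ r * (T * (R * (c + 1))) := Nat.one_le_iff_ne_zero.mpr (by positivity)
  have h8 : 19 * r * T * R * (c + 1) = r * (17 * (T * (R * (c + 1)))) + 2 * (r * (T * (R * (c + 1)))) := by
    ring
  omega

theorem levelFactor_pos (m : ℕ) {N : ℕ} (hN : 0 < N) : 0 < levelFactor m N := by
  have hR : 0 < sqrtCeil N := sqrtCeil_pos hN
  have hT : 0 < numTrials N := by unfold numTrials; positivity
  have hr : 0 < repetitions m := by unfold repetitions; omega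
  unfold levelFactor
  positivity

theorem levelFactor_le {m N : ℕ} (hN : N ≤ 4 ^ m) (hN0 : 0 < N) :
    (levelFactor m N : ℝ) ≤ 54720 * ((m : ℝ) + 1) ^ 3 * Real.sqrt N := by
  have hT : (numTrials N : ℝ) ≤ 144 * ((m : ℝ) + 1) ^ 2 := by
    have h1 : numTrials N ≤ 144 * (m + 1) ^ 2 := by
      unfold numTrials
      have h2 := clog_le_of_le_four_pow hN
      calc 16 * (Nat.clog 2 N + 3) ^ 2 ≤ 16 * (3 * (m + 1)) ^ 2 := by gcongr; omega
        _ = _ := by ring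
    exact_mod_cast h1
  have hR : (sqrtCeil N : ℝ) ≤ 2 * Real.sqrt N := by
    have h1 : (sqrtCeil N : ℝ) < Real.sqrt N + 1 := Nat.ceil_lt_add_one (Real.sqrt_nonneg _)
    have h2 : 1 ≤ Real.sqrt N := Real.one_le_sqrt.mpr (by exact_mod_cast hN0)
    linarith
  calc (levelFactor m N : ℝ) = 190 * ((m : ℝ) + 1) * numTrials N * sqrtCeil N := by
        rw [levelFactor, repetitions]; push_cast; ring
    _ ≤ 190 * ((m : ℝ) + 1) * (144 * ((m : ℝ) + 1) ^ 2) * (2 * Real.sqrt N) := by gcongr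
    _ = _ := by ring

theorem costLE_finder {m : ℕ} (hm : 1 ≤ m) (T : Table m) (e₀ : Fin m) :
    (finder T e₀).CostLE
      (levelFactor m (m.choose (size₂ m) * size₂ m)
        * (levelFactor m ((pieceSize m (size₂ m)).choose (size₄ m) * size₄ m)
          * (levelFactor m ((pieceSize (pieceSize m (size₂ m)) (size₄ m)).choose (sizeα m)
            * sizeα m) * 2)) - 1) := by
  obtain ⟨a1, a2⟩ := size₂_bounds m
  obtain ⟨b1, b2⟩ := size₄_bounds m
  obtain ⟨c1, c2⟩ := sizeα_bounds m
  have e1 : ∀ s k, pieceSize s k = max k (s - k + 1) := fun _ _ => rfl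
  have l₁ : size₂ m ≤ m := by omega
  have l₂ : size₄ m ≤ pieceSize m (size₂ m) := by rw [e1]; omega
  have l₃ : sizeα m ≤ pieceSize (pieceSize m (size₂ m)) (size₄ m) := by rw [e1]; omega
  have p₁ : 1 ≤ size₂ m := by omega
  have p₂ : 1 ≤ size₄ m := by omega
  have p₃ : 1 ≤ sizeα m := by omega
  have q₂ := levelFactor_pos m (Nat.mul_pos (Nat.choose_pos l₂) p₂)
  have q₃ := levelFactor_pos m (Nat.mul_pos (Nat.choose_pos l₃) p₃)
  have h3 := costLE_level _ _ p₃ l₃ e₀ two_pos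
    (costLE_lookup fun k : Finset (Fin m) × Fin m × Fin m => T k.1 k.2.1 k.2.2)
  have h2 := costLE_level _ _ p₂ l₂ e₀ (Nat.mul_pos q₃ two_pos) h3
  exact costLE_level _ _ p₁ l₁ e₀ (Nat.mul_pos q₂ (Nat.mul_pos q₃ two_pos)) h2

/-! ### Binomial coefficients -/

/-- One term of `(1 + x)^n` with `x = 1/17`, close to the optimal `α/(1-α)` for `j ≈ αn`. -/
theorem choose_le_mul_pow (n j : ℕ) : (n.choose j : ℝ) ≤ (18 / 17) ^ n * 17 ^ j := by
  have h := add_pow (1 / 17 : ℝ) 1 n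
  rcases le_or_gt j n with hj | hj
  · have h1 : (1 / 17 : ℝ) ^ j * 1 ^ (n - j) * n.choose j ≤ (1 / 17 + 1) ^ n := by
      rw [h]
      exact Finset.single_le_sum (f := fun i => (1 / 17 : ℝ) ^ i * 1 ^ (n - i) * n.choose i)
        (fun i _ => by positivity) (Finset.mem_range.mpr (by omega))
    rw [one_pow, mul_one, one_div, inv_pow, inv_mul_le_iff₀ (by positivity)] at h1
    refine h1.trans_eq ?_
    norm_num [mul_comm]
  · rw [Nat.choose_eq_zero_of_lt hj]
    push_cast
    positivity

/-- The generating-function bound with `x = 4/13`, close to the optimum for `K ≈ 0.236n`. As `x <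
1`, replacing `x^s` by the smaller `x^K` handles all terms up to `K` at once. -/
theorem sum_choose_le_mul_pow (n K : ℕ) :
    ((∑ s ∈ Finset.range (K + 1), n.choose s : ℕ) : ℝ) ≤ (17 / 13) ^ n * (13 / 4) ^ K := by
  have h := add_pow (4 / 13 : ℝ) 1 n
  have hx : ∀ s ∈ Finset.range (K + 1), (n.choose s : ℝ) * (4 / 13) ^ K
      ≤ (4 / 13 : ℝ) ^ s * 1 ^ (n - s) * n.choose s := by
    intro s hs
    have : (4 / 13 : ℝ) ^ K ≤ (4 / 13) ^ s :=
      pow_le_pow_of_le_one (by norm_num) (by norm_num) (by have := Finset.mem_range.mp hs; omega)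
    rw [one_pow, mul_one, mul_comm]
    gcongr
  have h1 : ∑ s ∈ Finset.range (K + 1), (4 / 13 : ℝ) ^ s * 1 ^ (n - s) * n.choose s
      ≤ (4 / 13 + 1) ^ n := by
    rw [h]
    have hz : ∀ s, n < s → (4 / 13 : ℝ) ^ s * 1 ^ (n - s) * n.choose s = 0 := fun s hs => by
      rw [Nat.choose_eq_zero_of_lt hs]; simp
    -- `K` may exceed `n`, so both ranges are embedded in a longer one whose extra terms vanish.
    calc _ ≤ ∑ s ∈ Finset.range (K + 1 + (n + 1)), (4 / 13 : ℝ) ^ s * 1 ^ (n - s) * n.choose s :=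
          Finset.sum_le_sum_of_subset_of_nonneg (Finset.range_mono (by omega))
            (fun _ _ _ => by positivity)
      _ = _ := by
          symm
          refine Finset.sum_subset (Finset.range_mono (by omega)) fun s _ hs => hz s ?_
          have := Finset.mem_range.not.mp hs
          omega
  have h2 := (Finset.sum_le_sum hx).trans h1
  rw [← Finset.sum_mul] at h2
  push_cast
  have h3 : (0 : ℝ) < (4 / 13) ^ K := by positivity
  rw [← le_div_iff₀ h3] at h2
  refine h2.trans_eq ?_
  rw [div_eq_mul_inv, ← inv_pow]
  norm_num

-- The inequality `2^(3/2) C(m/4, 0.055m/4)^(1/m) ≤ 1.728²`, with the binomial bounded by its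
-- estimate, raised to the power `800` to clear the denominators of `3/2`, `1/4` and `0.055/4 =
-- 11/800`.
set_option exponentiation.threshold 2000 in
theorem base_quantum : (2 : ℝ) ^ 1200 * (18 / 17) ^ 200 * 17 ^ 11 ≤ 1.728 ^ 1600 := by norm_num

set_option exponentiation.threshold 2000 in
theorem base_classical : (17 / 13 : ℝ) ^ 800 * (13 / 4) ^ 189 ≤ 1.728 ^ 800 := by norm_num

/-- The bound for the size of the precomputed table. -/
theorem sum_choose_tableSize_le (m : ℕ) :
    ((∑ s ∈ Finset.range (tableSize m + 1), m.choose s : ℕ) : ℝ) ≤ 35 * 1.728 ^ m := by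
  obtain ⟨a1, a2⟩ := size₂_bounds m
  obtain ⟨b1, b2⟩ := size₄_bounds m
  obtain ⟨c1, c2⟩ := sizeα_bounds m
  have e1 : ∀ s k, pieceSize s k = max k (s - k + 1) := fun _ _ => rfl
  -- Rounding and the repeated join edges add less than or exactly `3` to `189m/800`; hence the
  -- constant `35 ≥ (13/4)³`.
  have hK : 800 * tableSize m ≤ 189 * m + 2400 := by
    rw [tableSize, e1, e1, e1]; omega
  refine (sum_choose_le_mul_pow m (tableSize m)).trans ?_
  refine le_of_pow_le_pow_left₀ (n := 800) (by norm_num) (by positivity) ?_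
  calc ((17 / 13 : ℝ) ^ m * (13 / 4) ^ tableSize m) ^ 800
      = (17 / 13) ^ (800 * m) * (13 / 4) ^ (800 * tableSize m) := by ring
    _ ≤ (17 / 13) ^ (800 * m) * (13 / 4) ^ (189 * m + 2400) := by
        gcongr
        norm_num
    _ = ((17 / 13 : ℝ) ^ 800 * (13 / 4) ^ 189) ^ m * ((13 / 4) ^ 3) ^ 800 := by
        rw [pow_add, pow_mul, pow_mul, mul_pow, ← pow_mul (13 / 4 : ℝ) 3 800]
        ac_rfl
    _ ≤ (1.728 ^ 800) ^ m * 35 ^ 800 := by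
        have h1 := base_classical
        have h2 : ((13 / 4 : ℝ)) ^ 3 ≤ 35 := by norm_num
        gcongr
    _ = (35 * 1.728 ^ m) ^ 800 := by
        rw [mul_pow, ← pow_mul, ← pow_mul, mul_comm m 800, mul_comm]

/-- The bound for the product of the numbers of candidates of the three maximum findings. -/
theorem prod_candidates_le {m : ℕ} (hm : 1 ≤ m) :
    ((m.choose (size₂ m) * size₂ m : ℕ) : ℝ)
      * ((pieceSize m (size₂ m)).choose (size₄ m) * size₄ m : ℕ)
      * ((pieceSize (pieceSize m (size₂ m)) (size₄ m)).choose (sizeα m) * sizeα m : ℕ)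
      ≤ (26 * ((m : ℝ) + 1) ^ 2 * 1.728 ^ m) ^ 2 := by
  obtain ⟨a1, a2⟩ := size₂_bounds m
  obtain ⟨b1, b2⟩ := size₄_bounds m
  obtain ⟨c1, c2⟩ := sizeα_bounds m
  have e1 : ∀ s k, pieceSize s k = max k (s - k + 1) := fun _ _ => rfl
  have hs₁ : 2 * pieceSize m (size₂ m) ≤ m + 2 := by rw [e1]; omega
  have hs₂ : 4 * pieceSize (pieceSize m (size₂ m)) (size₄ m) ≤ m + 8 := by
    rw [e1]; omega
  have l₃ : sizeα m ≤ pieceSize (pieceSize m (size₂ m)) (size₄ m) := by rw [e1, e1]; omega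
  set s₁ := pieceSize m (size₂ m)
  set s₂ := pieceSize s₁ (size₄ m)
  have hk₁ : (size₂ m : ℝ) ≤ (m : ℝ) + 1 := by exact_mod_cast (by omega : size₂ m ≤ m + 1)
  have hk₂ : (size₄ m : ℝ) ≤ (m : ℝ) + 1 := by exact_mod_cast (by omega : size₄ m ≤ m + 1)
  have hk₃ : (sizeα m : ℝ) ≤ (m : ℝ) + 1 := by exact_mod_cast (by omega : sizeα m ≤ m + 1)
  have n₁ : (m.choose (size₂ m) : ℝ) ≤ 2 ^ m := by exact_mod_cast Nat.choose_le_two_pow _ _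
  have n₂ : (s₁.choose (size₄ m) : ℝ) ≤ 2 ^ s₁ := by exact_mod_cast Nat.choose_le_two_pow _ _
  -- Only about an `α` fraction of the set is left out, so the complementary binomial coefficient is
  -- the one to estimate.
  have n₃ : (s₂.choose (sizeα m) : ℝ) ≤ (18 / 17) ^ s₂ * 17 ^ (s₂ - sizeα m) := by
    rw [← Nat.choose_symm l₃]
    exact choose_le_mul_pow _ _
  have r₁ : ∀ a b c : ℝ, a ^ (1200 * m + 800) * b ^ (200 * m + 1600) * c ^ (11 * m + 1600)
      = (a ^ 1200 * b ^ 200 * c ^ 11) ^ m * (a * b ^ 2 * c ^ 2) ^ 800 := fun a b c => by ring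
  have r₂ : ∀ a b : ℝ, (a ^ 1600) ^ m * b ^ 800 = (b * (a ^ m) ^ 2) ^ 800 := fun a b => by ring
  have hexp : (2 : ℝ) ^ m * 2 ^ s₁ * ((18 / 17) ^ s₂ * 17 ^ (s₂ - sizeα m))
      ≤ 648 * (1.728 ^ m) ^ 2 := by
    refine le_of_pow_le_pow_left₀ (n := 800) (by norm_num) (by positivity) ?_
    calc ((2 : ℝ) ^ m * 2 ^ s₁ * ((18 / 17) ^ s₂ * 17 ^ (s₂ - sizeα m))) ^ 800
        = 2 ^ (800 * m + 800 * s₁) * (18 / 17) ^ (800 * s₂) * 17 ^ (800 * (s₂ - sizeα m)) := by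
          rw [pow_add]; ring
      _ ≤ 2 ^ (1200 * m + 800) * (18 / 17) ^ (200 * m + 1600) * 17 ^ (11 * m + 1600) := by
          have f₁ : (2 : ℝ) ^ (800 * m + 800 * s₁) ≤ 2 ^ (1200 * m + 800) :=
            pow_le_pow_right₀ (by norm_num) (by omega)
          have f₂ : (18 / 17 : ℝ) ^ (800 * s₂) ≤ (18 / 17) ^ (200 * m + 1600) :=
            pow_le_pow_right₀ (by norm_num) (by omega)
          have f₃ : (17 : ℝ) ^ (800 * (s₂ - sizeα m)) ≤ 17 ^ (11 * m + 1600) :=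
            pow_le_pow_right₀ (by norm_num) (by omega)
          exact mul_le_mul (mul_le_mul f₁ f₂ (by positivity) (by positivity)) f₃ (by positivity)
            (by positivity)
      _ = ((2 : ℝ) ^ 1200 * (18 / 17) ^ 200 * 17 ^ 11) ^ m * (2 * (18 / 17) ^ 2 * 17 ^ 2) ^ 800 := by
          exact r₁ _ _ _
      _ ≤ (1.728 ^ 1600) ^ m * 648 ^ 800 := by
          have h1 := base_quantum
          have h2 : (2 * (18 / 17) ^ 2 * 17 ^ 2 : ℝ) ≤ 648 := by norm_num
          gcongr
      _ = (648 * (1.728 ^ m) ^ 2) ^ 800 := by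
          exact r₂ _ _
  push_cast
  have hm1 : (1 : ℝ) ≤ (m : ℝ) + 1 := by
    have : (0 : ℝ) ≤ m := Nat.cast_nonneg m
    linarith
  calc (m.choose (size₂ m) : ℝ) * size₂ m * (s₁.choose (size₄ m) * size₄ m)
        * (s₂.choose (sizeα m) * sizeα m)
      ≤ (2 ^ m * ((m : ℝ) + 1)) * (2 ^ s₁ * ((m : ℝ) + 1))
        * (((18 / 17) ^ s₂ * 17 ^ (s₂ - sizeα m)) * ((m : ℝ) + 1)) := by gcongr
    _ = (2 ^ m * 2 ^ s₁ * ((18 / 17) ^ s₂ * 17 ^ (s₂ - sizeα m))) * ((m : ℝ) + 1) ^ 3 := by ring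
    -- The fourth power, and `676 = 26²` in place of `648`, make the bound a perfect square for the
    -- later square root.
    _ ≤ (648 * (1.728 ^ m) ^ 2) * ((m : ℝ) + 1) ^ 4 :=
        mul_le_mul hexp (pow_le_pow_right₀ hm1 (by norm_num)) (by positivity) (by positivity)
    _ ≤ (676 * (1.728 ^ m) ^ 2) * ((m : ℝ) + 1) ^ 4 := by gcongr; norm_num
    _ = _ := by ring

/-- The running time for one pair of edges. -/
theorem finder_cost_le {m : ℕ} (hm : 1 ≤ m) (T : Table m) (e₀ : Fin m)
    (i : Finset (Fin m) × Fin m × Fin m) :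
    ((((finder T e₀).circ i).cost + 1 : ℕ) : ℝ)
      ≤ 52 * 54720 ^ 3 * ((m : ℝ) + 1) ^ 11 * 1.728 ^ m := by
  have h := costLE_finder hm T e₀ i
  have hprod := prod_candidates_le hm
  obtain ⟨a1, a2⟩ := size₂_bounds m
  obtain ⟨b1, b2⟩ := size₄_bounds m
  obtain ⟨c1, c2⟩ := sizeα_bounds m
  have e1 : ∀ s k, pieceSize s k = max k (s - k + 1) := fun _ _ => rfl
  have l₁ : size₂ m ≤ m := by omega
  have l₂ : size₄ m ≤ pieceSize m (size₂ m) := by rw [e1]; omega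
  have l₃ : sizeα m ≤ pieceSize (pieceSize m (size₂ m)) (size₄ m) := by rw [e1, e1]; omega
  have g₁ : pieceSize m (size₂ m) ≤ m := by rw [e1]; omega
  have g₂ : pieceSize (pieceSize m (size₂ m)) (size₄ m) ≤ m := by rw [e1, e1]; omega
  have p₁ := Nat.mul_pos (Nat.choose_pos l₁) (by omega : 0 < size₂ m)
  have p₂ := Nat.mul_pos (Nat.choose_pos l₂) (by omega : 0 < size₄ m)
  have p₃ := Nat.mul_pos (Nat.choose_pos l₃) (by omega : 0 < sizeα m)
  have u₁ : m.choose (size₂ m) * size₂ m ≤ 4 ^ m := choose_mul_le_four_pow le_rfl (by omega)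
  have u₂ : (pieceSize m (size₂ m)).choose (size₄ m) * size₄ m ≤ 4 ^ m :=
    choose_mul_le_four_pow g₁ (by omega)
  have u₃ : (pieceSize (pieceSize m (size₂ m)) (size₄ m)).choose (sizeα m) * sizeα m ≤ 4 ^ m :=
    choose_mul_le_four_pow g₂ (by omega)
  generalize (pieceSize (pieceSize m (size₂ m)) (size₄ m)).choose (sizeα m) * sizeα m = N₃ at *
  generalize (pieceSize m (size₂ m)).choose (size₄ m) * size₄ m = N₂ at *
  generalize m.choose (size₂ m) * size₂ m = N₁ at *
  have q₁ := levelFactor_pos m p₁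
  have q₂ := levelFactor_pos m p₂
  have q₃ := levelFactor_pos m p₃
  have h' : ((finder T e₀).circ i).cost + 1
      ≤ levelFactor m N₁ * (levelFactor m N₂ * (levelFactor m N₃ * 2)) := by
    have : 0 < levelFactor m N₁ * (levelFactor m N₂ * (levelFactor m N₃ * 2)) :=
      Nat.mul_pos q₁ (Nat.mul_pos q₂ (Nat.mul_pos q₃ two_pos))
    omega
  have hsqrt : Real.sqrt N₁ * Real.sqrt N₂ * Real.sqrt N₃
      ≤ 26 * ((m : ℝ) + 1) ^ 2 * 1.728 ^ m := by
    rw [← Real.sqrt_mul (Nat.cast_nonneg _), ← Real.sqrt_mul (mul_nonneg (Nat.cast_nonneg _)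
      (Nat.cast_nonneg _)), Real.sqrt_le_iff]
    exact ⟨by positivity, hprod⟩
  calc ((((finder T e₀).circ i).cost + 1 : ℕ) : ℝ)
      ≤ (levelFactor m N₁ : ℝ) * (levelFactor m N₂ * (levelFactor m N₃ * 2)) := by
        exact_mod_cast h'
    _ ≤ (54720 * ((m : ℝ) + 1) ^ 3 * Real.sqrt N₁) * ((54720 * ((m : ℝ) + 1) ^ 3 * Real.sqrt N₂)
        * ((54720 * ((m : ℝ) + 1) ^ 3 * Real.sqrt N₃) * 2)) := by
        have f₁ := levelFactor_le u₁ p₁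
        have f₂ := levelFactor_le u₂ p₂
        have f₃ := levelFactor_le u₃ p₃
        gcongr
    _ = 2 * 54720 ^ 3 * ((m : ℝ) + 1) ^ 9 * (Real.sqrt N₁ * Real.sqrt N₂ * Real.sqrt N₃) := by ring
    _ ≤ 2 * 54720 ^ 3 * ((m : ℝ) + 1) ^ 9 * (26 * ((m : ℝ) + 1) ^ 2 * 1.728 ^ m) := by gcongr
    _ = _ := by ring

theorem list_sum_le_mul {α : Type} (l : List α) (f : α → ℕ) {c : ℝ} (h : ∀ a ∈ l, (f a : ℝ) ≤ c) :
    (((l.map f).sum : ℕ) : ℝ) ≤ l.length * c := by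
  induction l with
  | nil => simp
  | cons a l ih =>
    have h1 := h a List.mem_cons_self
    have h2 := ih fun b hb => h b (List.mem_cons_of_mem _ hb)
    rw [List.map_cons, List.sum_cons, List.length_cons, Nat.cast_add,
      Nat.cast_succ]
    linarith

theorem length_edgePairs (m : ℕ) : (edgePairs m).length = m * m := by
  rw [edgePairs, List.product.eq_1]
  simp

/-- The running time of the algorithm. -/
theorem ltpTime_le {m : ℕ} (adj : Fin m → Fin m → Prop) :
    (ltpTime adj : ℝ) ≤ (70 + 52 * 54720 ^ 3) * ((m : ℝ) + 1) ^ 13 * 1.728 ^ m := by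
  have hm0 : (0 : ℝ) ≤ m := Nat.cast_nonneg m
  have hm1 : (1 : ℝ) ≤ (m : ℝ) + 1 := by linarith
  have h1 : ((stepOne adj (tableSize m)).2 : ℝ) ≤ 70 * ((m : ℝ) + 1) ^ 13 * 1.728 ^ m := by
    have h2 : ((stepOne adj (tableSize m)).2 : ℝ)
        ≤ ((∑ s ∈ Finset.range (tableSize m + 1), m.choose s : ℕ) : ℝ) * (m * m) * (m + 2) := by
      exact_mod_cast stepOne_cost_le adj (tableSize m)
    calc _ ≤ _ := h2
      _ ≤ (35 * 1.728 ^ m) * (((m : ℝ) + 1) * ((m : ℝ) + 1)) * (2 * ((m : ℝ) + 1)) := by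
          have h3 := sum_choose_tableSize_le m
          gcongr <;> linarith
      _ = 70 * 1.728 ^ m * ((m : ℝ) + 1) ^ 3 := by ring
      _ ≤ 70 * 1.728 ^ m * ((m : ℝ) + 1) ^ 13 :=
          mul_le_mul_of_nonneg_left (pow_le_pow_right₀ hm1 (by norm_num)) (by positivity)
      _ = _ := by ring
  have h2 := list_sum_le_mul (edgePairs m) (fun p =>
    ((finder (stepOne adj (tableSize m)).1 p.1).circ (Finset.univ, p.1, p.2)).cost + 1)
    (c := 52 * 54720 ^ 3 * ((m : ℝ) + 1) ^ 11 * 1.728 ^ m)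
    (fun p _ => finder_cost_le (by have := p.1.pos; omega) _ _ _)
  rw [length_edgePairs] at h2
  have h3 : ((m * m : ℕ) : ℝ) * (52 * 54720 ^ 3 * ((m : ℝ) + 1) ^ 11 * 1.728 ^ m)
      ≤ 52 * 54720 ^ 3 * ((m : ℝ) + 1) ^ 13 * 1.728 ^ m := by
    push_cast
    calc _ ≤ (((m : ℝ) + 1) * ((m : ℝ) + 1)) * (52 * 54720 ^ 3 * ((m : ℝ) + 1) ^ 11 * 1.728 ^ m) := by
          gcongr <;> linarith
      _ = _ := by ring
  rw [ltpTime, Nat.cast_add]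
  linarith

end

end LongestTrail

namespace LongestTrail

noncomputable section

open scoped Classical

/-! ### The output of the algorithm -/

/-- The union bound for two successive random choices: `A` collects the bad first outcomes, and
after any other one `B` has probability at most `δ`. -/
theorem toOuterMeasure_bind_le {α β : Type} (p : PMF α) (f : α → PMF β) (A : Set α) (B : Set β)
    (δ : ENNReal) (h : ∀ a ∉ A, (f a).toOuterMeasure B ≤ δ) :
    (p.bind f).toOuterMeasure B ≤ p.toOuterMeasure A + δ := by
  rw [PMF.toOuterMeasure_bind_apply, PMF.toOuterMeasure_apply]
  have h1 : ∀ a, p a * (f a).toOuterMeasure B ≤ A.indicator p a + p a * δ := by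
    intro a
    by_cases ha : a ∈ A
    · rw [Set.indicator_of_mem ha]
      refine le_trans ?_ le_self_add
      refine mul_le_of_le_one_right' (((f a).toOuterMeasure.mono (Set.subset_univ B)).trans_eq ?_)
      exact ((f a).toOuterMeasure_apply_eq_one_iff Set.univ).mpr (Set.subset_univ _)
    · rw [Set.indicator_of_notMem ha, zero_add]
      exact mul_le_mul_right (h a ha) _
  refine (ENNReal.tsum_le_tsum h1).trans_eq ?_
  rw [ENNReal.tsum_add, ENNReal.tsum_mul_right, PMF.tsum_coe, one_mul]

/-- The entry `b` is the empty one or a trail, and at least as long as all trails between the pairs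
of edges in `L`. -/
def IsBestFor {m : ℕ} (adj : Fin m → Fin m → Prop) (L : List (Fin m × Fin m)) (b : Entry m) : Prop :=
  (∀ l, b = some l → ∃ v u, IsTrail adj Finset.univ v u l.1) ∧
    ∀ p ∈ L, ∀ l, IsTrail adj Finset.univ p.1 p.2 l → ((l.length : ℕ) : WithBot ℕ) ≤ b.len

theorem IsBestFor.update {m : ℕ} {adj : Fin m → Fin m → Prop} {L : List (Fin m × Fin m)}
    {b r : Entry m} {p : Fin m × Fin m} (hb : IsBestFor adj L b)
    (hr : IsBest adj Finset.univ p.1 p.2 r) :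
    IsBestFor adj (L ++ [p]) (if b.len < r.len then r else b) := by
  have h1 : b.len ≤ (if b.len < r.len then r else b).len := by
    split_ifs with h
    · exact h.le
    · exact le_rfl
  have h2 : r.len ≤ (if b.len < r.len then r else b).len := by
    split_ifs with h
    · exact le_rfl
    · exact not_lt.mp h
  refine ⟨fun l hl => ?_, fun q hq l hl => ?_⟩
  · split_ifs at hl
    · exact ⟨_, _, hr.1 l hl⟩
    · exact hb.1 l hl
  · rcases List.mem_append.mp hq with hq | hq
    · exact (hb.2 q hq l hl).trans h1
    · have : q = p := by simpa using hq
      subst this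
      exact (hr.2 l hl).trans h2

/-- One `δ` per pair. The search results enter only through their individual failure probabilities,
and correct results preserve `IsBestFor`. -/
theorem foldl_search_le {m : ℕ} (adj : Fin m → Fin m → Prop) (q : Fin m × Fin m → PMF (Entry m))
    (δ : ENNReal)
    (hq : ∀ p, (q p).toOuterMeasure {r | ¬ IsBest adj Finset.univ p.1 p.2 r} ≤ δ)
    (L : List (Fin m × Fin m)) :
    (L.foldl (fun (acc : PMF (Entry m)) p => acc.bind fun best =>
        (q p).map fun r => if best.len < r.len then r else best)
      (PMF.pure none)).toOuterMeasure {b | ¬ IsBestFor adj L b} ≤ L.length * δ := by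
  induction L using List.reverseRecOn with
  | nil =>
    have : IsBestFor adj [] (none : Entry m) := ⟨fun l hl => by (cases hl), fun p hp => by simp at hp⟩
    simp [this]
  | append_singleton L p ih =>
    rw [List.foldl_append, List.foldl_cons, List.foldl_nil]
    refine (toOuterMeasure_bind_le _ _ {b | ¬ IsBestFor adj L b} _ δ fun b hb => ?_).trans ?_
    · rw [PMF.toOuterMeasure_map_apply]
      refine le_trans ((q p).toOuterMeasure.mono fun r hr => ?_) (hq p)
      intro hr'
      exact hr ((not_not.mp hb).update hr')
    · rw [List.length_append, List.length_singleton]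
      push_cast
      rw [add_mul, one_mul]
      gcongr

theorem mem_edgePairs {m : ℕ} (p : Fin m × Fin m) : p ∈ edgePairs m :=
  List.pair_mem_product.mpr ⟨List.mem_finRange _, List.mem_finRange _⟩

/-! ### From edge numbers back to the graph, and the success probability -/

theorem isPath_map_iff {V : Type*} (G : SimpleGraph V) {m : ℕ} (e : Fin m ≃ G.edgeSet)
    (l : List (Fin m)) : IsPath G (l.map e) ↔ l.IsChain (edgeAdj G e) := by
  -- In `IsPath` the list itself is coerced to a list of `Sym2 V`, by a monadic bind; this
  -- identifies it with an ordinary map.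
  have h : ∀ P : List G.edgeSet, (do let a ← P; pure (a : Sym2 V)) = P.map Subtype.val := by
    intro P
    induction P with
    | nil => rfl
    | cons a P ih => simp
  rw [IsPath, h, List.map_map, List.isChain_map]
  rfl

theorem isLongestTrail_of_isBestFor {V : Type*} (G : SimpleGraph V) {m : ℕ} (e : Fin m ≃ G.edgeSet)
    {b : Entry m} (hb : IsBestFor (edgeAdj G e) (edgePairs m) b) :
    IsLongestTrail G (((b.map Subtype.val).getD []).map e) := by
  constructor
  · cases b with
    | none => exact ⟨List.isChain_nil, List.nodup_nil⟩
    | some l =>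
      obtain ⟨v, u, h⟩ := hb.1 l rfl
      exact ⟨(isPath_map_iff G e _).mpr h.chain, h.nodup.map e.injective⟩
  · intro Q hQ
    -- A nonempty trail has a first and a last edge, and this pair has been searched; the empty path
    -- needs no search.
    rcases Q.eq_nil_or_concat' with rfl | ⟨Q', z, hQ'⟩
    · simp
    have hne : Q ≠ [] := by rw [hQ']; simp
    set l := Q.map e.symm with hl
    have hlne : l ≠ [] := by simpa [hl] using hne
    have hle : l.map e = Q := by simp [hl]
    have ht : IsTrail (edgeAdj G e) Finset.univ (l.head hlne) (l.getLast hlne) l := by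
      refine ⟨hQ.2.map e.symm.injective, ?_, fun _ _ => Finset.mem_univ _,
        List.head?_eq_some_head hlne, List.getLast?_eq_some_getLast hlne⟩
      have h1 := hQ.1
      rw [← hle] at h1
      exact (isPath_map_iff G e _).mp h1
    obtain ⟨p, rfl, hlen⟩ := Entry.exists_of_len_ge
      (hb.2 (l.head hlne, l.getLast hlne) (mem_edgePairs _) l ht)
    have : l.length = Q.length := by simp [hl]
    simpa [this] using hlen

theorem le_ltpOutput {V : Type*} (G : SimpleGraph V) {m : ℕ} (e : Fin m ≃ G.edgeSet) :
    ENNReal.ofReal (4 / 5) ≤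
      (ltpOutput (edgeAdj G e)).toOuterMeasure {P | IsLongestTrail G (P.map e)} := by
  set adj := edgeAdj G e
  set T := (stepOne adj (tableSize m)).1 with hT
  set y : ℝ := (1 / 2) ^ (m + 1) with hy
  have hq : ∀ p : Fin m × Fin m,
      ((finder T p.1).dist (Finset.univ, p.1, p.2)).toOuterMeasure
        {r | ¬ IsBest adj Finset.univ p.1 p.2 r} ≤ ENNReal.ofReal (y ^ 6) := by
    intro p
    rw [Subroutine.dist_apply_set]
    refine ENNReal.ofReal_le_ofReal (le_trans (le_of_eq ?_)
      (failure_finder_le (by have := p.1.pos; omega) adj p.1 p.1 p.2))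
    rw [Subroutine.failure]
    congr 1
    ext r
    by_cases h : IsBest adj Finset.univ p.1 p.2 r <;> simp [h]
  have hbad := foldl_search_le adj
    (fun p => (finder T p.1).dist (Finset.univ, p.1, p.2)) _ hq (edgePairs m)
  set D := (edgePairs m).foldl (fun (acc : PMF (Entry m)) p => acc.bind fun best =>
      ((finder T p.1).dist (Finset.univ, p.1, p.2)).map fun r =>
        if best.len < r.len then r else best) (PMF.pure none) with hD
  have hout : ltpOutput adj = D.map fun best => (best.map Subtype.val).getD [] := rfl
  -- The union bound gives `m² y⁶ = (my)² y⁴ ≤ 1/16`, because `my ≤ 1` and `y ≤ 1/2`.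
  have hsmall : ((edgePairs m).length : ENNReal) * ENNReal.ofReal (y ^ 6) ≤ ENNReal.ofReal (1 / 5) := by
    rw [length_edgePairs, ← ENNReal.ofReal_natCast, ← ENNReal.ofReal_mul (Nat.cast_nonneg _)]
    refine ENNReal.ofReal_le_ofReal ?_
    have h1 : (m : ℝ) * y ≤ 1 := by
      have h2 : (m : ℝ) ≤ 2 ^ (m + 1) := by
        exact_mod_cast (Nat.lt_two_pow_self.le.trans (Nat.pow_le_pow_right (by norm_num) (by omega)) :
          m ≤ 2 ^ (m + 1))
      calc (m : ℝ) * y ≤ 2 ^ (m + 1) * y := by gcongr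
        _ = 1 := by rw [hy, ← mul_pow]; norm_num
    have h0 : 0 ≤ (m : ℝ) * y := by positivity
    have hy2 : y ≤ 1 / 2 := by
      rw [hy, pow_succ]
      have : ((1 : ℝ) / 2) ^ m ≤ 1 := pow_le_one₀ (by norm_num) (by norm_num)
      linarith
    push_cast
    calc (m : ℝ) * m * y ^ 6 = (m * y) ^ 2 * y ^ 4 := by ring
      _ ≤ 1 ^ 2 * (1 / 2) ^ 4 := by gcongr
      _ ≤ 1 / 5 := by norm_num
  rw [hout, PMF.toOuterMeasure_map_apply]
  set good : Set (Entry m) := (fun best => (best.map Subtype.val).getD []) ⁻¹'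
    {P | IsLongestTrail G (P.map e)} with hgood
  have hone : (1 : ENNReal) ≤ D.toOuterMeasure good + ENNReal.ofReal (1 / 5) := by
    have h1 : D.toOuterMeasure Set.univ = 1 := by
      rw [PMF.toOuterMeasure_apply_eq_one_iff]
      exact Set.subset_univ _
    rw [← h1]
    refine (D.toOuterMeasure.mono (fun b _ => ?_)).trans
      ((MeasureTheory.measure_union_le good {b | ¬ IsBestFor adj (edgePairs m) b}).trans
        (add_le_add_right (hbad.trans hsmall) _))
    by_cases h : IsBestFor adj (edgePairs m) b
    · exact Or.inl (isLongestTrail_of_isBestFor G e h)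
    · exact Or.inr h
  have h45 : ENNReal.ofReal (4 / 5) + ENNReal.ofReal (1 / 5) = 1 := by
    rw [← ENNReal.ofReal_add (by norm_num) (by norm_num)]
    norm_num
  rw [← h45] at hone
  exact (ENNReal.add_le_add_iff_right ENNReal.ofReal_ne_top).mp hone

end

end LongestTrail

/-! ### The main theorem -/

theorem mainTheorem1 :
    ∃ (K : ℝ) (d : ℕ), ∀ (V : Type*) [Finite V] (G : SimpleGraph V) (m : ℕ) (e : Fin m ≃ G.edgeSet),
      (LongestTrail.ltpTime (LongestTrail.edgeAdj G e) : ℝ)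
          ≤ K * ((m : ℝ) + 1) ^ d * (1.728 : ℝ) ^ m ∧
      ENNReal.ofReal (4 / 5) ≤
        (LongestTrail.ltpOutput (LongestTrail.edgeAdj G e)).toOuterMeasure
          {P | LongestTrail.IsLongestTrail G (P.map e)} :=
  ⟨_, 13, fun _ _ G _ e => ⟨LongestTrail.ltpTime_le _, LongestTrail.le_ltpOutput G e⟩⟩
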